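/- **Weil reciprocity law.** Let $k$ be a perfect field and let $C$ be an irreducible projective curve over $k$, i.e. an integral one-dimensional scheme which admits a closed immersion over $k$ into some projective space $\mathbb P^n_k$. Let $k(C)$ be its field of rational functions. For a closed point $p\in C$ let $\mathcal O_p$ be the local ring, $k(p)$ the residue field, $\hat{\mathcal O}_p$ the completion of $\mathcal O_p$ at its maximal ideal, and $K_p$ the localization of $\hat{\mathcal O}_p$ at the multiplicative system $\mathcal O_p\setminus\{0\}$; it contains $k(C)$. The ring $K_p$ is a finite product of fields $K_{p,i}$. The integral closure of $\hat{\mathcal O}_p$ in $K_{p,i}$ is a discrete valuation ring; let $\nu_i$ be its normalized valuation and let $k_i$ be its residue field, a finite extension of $k(p)$. (If $p$ is a smooth point, then there is one factor, $K_p\cong k(p)((t))$.) For $f,g\in k(C)^\times$ put $$\{f,g\}_{p,i}=(-1)^{\nu_i(f)\nu_i(g)}\,\frac{f^{\nu_i(g)}}{g^{\nu_i(f)}}\ \bmod \mathfrak m_i\ \in k_i^\times,\qquad \{f,g\}_p=\prod_i \mathrm{Nm}_{k_i/k(p)}\{f,g\}_{p,i}\in k(p)^\times ,$$ where $\mathfrak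 m_i$ is the maximal ideal of the discrete valuation ring. Then for all $f,g\in k(C)^\times$ only finitely many closed points $p$ satisfy $\mathrm{Nm}_{k(p)/k}\{f,g\}_p\neq 1$, and $$\prod_{p}\mathrm{Nm}_{k(p)/k}\{f,g\}_p=1,$$ where $p$ runs over the closed points of $C$. (Here all products over $i$ are finite and all the field extensions $k_i/k(p)$ and $k(p)/k$ are finite, so that the norms are defined.) -/

import Mathlib

open AlgebraicGeometry CategoryTheory

universe u

namespace WeilReciprocity

/-! ### The tame symbol of a discretely valued field -/

section Tame

variable {K : Type u} [Field K] (A : ValuationSubring K) [IsDiscreteValuationRing A]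

/-- The normalized discrete valuation `ν : Kˣ → ℤ` of the discrete valuation ring `A` of `K`
(a uniformizer has value `1`). -/
noncomputable def ord (f : Kˣ) : ℤ :=
  WithZero.log (Ring.ordFrac A (f : K))

theorem ord_mul (f g : Kˣ) : ord A (f * g) = ord A f + ord A g := by
  have hf : Ring.ordFrac A (f : K) ≠ 0 := by simp
  have hg : Ring.ordFrac A (g : K) ≠ 0 := by simp
  simp [ord, WithZero.log_mul hf hg]

/-- `ord` as a homomorphism of groups. -/
noncomputable def ordHom : Kˣ →* Multiplicative ℤ where
  toFun f := Multiplicative.ofAdd (ord A f)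
  map_one' := by simp [ord]
  map_mul' f g := by rw [ord_mul]; rfl

theorem ord_inv (f : Kˣ) : ord A f⁻¹ = -ord A f :=
  congrArg Multiplicative.toAdd (map_inv (ordHom A) f)

theorem ord_zpow (f : Kˣ) (n : ℤ) : ord A (f ^ n) = n * ord A f := by
  have h := congrArg Multiplicative.toAdd (map_zpow (ordHom A) f n)
  simpa [ordHom] using h

theorem mem_unitGroup_of_ord_eq_zero {f : Kˣ} (h : ord A f = 0) : f ∈ A.unitGroup := by
  have hf : Ring.ordFrac A (f : K) ≠ 0 := by simp
  have h1 : Ring.ordFrac A (f : K) = 1 := by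
    have := WithZero.exp_log hf
    rw [← this]
    change WithZero.exp (ord A f) = 1
    rw [h]; rfl
  have h2 : (f : K) ∈ MonoidHom.mker (Ring.ordFrac A (K := K)) := h1
  rw [Ring.mker_ordFrac_eq_isUnitSubmonoid] at h2
  obtain ⟨x, hx, hxf⟩ := h2
  rw [ValuationSubring.mem_unitGroup_iff, ← hxf]
  exact (A.valuation_eq_one_iff x).1 hx

/-- The element `(-1) ^ (ν(f) ν(g)) * f ^ ν(g) / g ^ ν(f)` of `Kˣ`. -/
noncomputable def tameElement (f g : Kˣ) : Kˣ :=
  (-1) ^ (ord A f * ord A g) * (f ^ ord A g / g ^ ord A f)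

theorem tameElement_mem_unitGroup (f g : Kˣ) : tameElement A f g ∈ A.unitGroup := by
  refine mul_mem (zpow_mem ?_ _) (mem_unitGroup_of_ord_eq_zero A ?_)
  · rw [ValuationSubring.mem_unitGroup_iff]; simp
  · rw [div_eq_mul_inv, ord_mul, ord_inv, ord_zpow, ord_zpow]; ring

/-- The tame symbol `{f, g} = (-1) ^ (ν(f) ν(g)) * f ^ ν(g) / g ^ ν(f)` modulo the maximal ideal,
an element of the multiplicative group of the residue field. -/
noncomputable def tameSymbol (f g : Kˣ) : (IsLocalRing.ResidueField A)ˣ :=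
  A.unitGroupToResidueFieldUnits ⟨tameElement A f g, tameElement_mem_unitGroup A f g⟩

end Tame

/-- The norm on unit groups along a homomorphism of fields `R → S`. -/
noncomputable def unitsNorm {R S : Type u} [Field R] [Field S] (φ : R →+* S) : Sˣ →* Rˣ :=
  letI := φ.toAlgebra
  Units.map (Algebra.norm R)

/-! ### The local ring of a point, its completion, and the branches -/

section Local

variable (O : Type u) [CommRing O] [IsLocalRing O]

/-- The completion `Ô` of the local ring `O` at its maximal ideal. -/
abbrev Completion : Type u :=
  AdicCompletion (IsLocalRing.maximalIdeal O) O

/-- The localization of `Ô` at the multiplicative system `O \ {0}` (for `O` a domain). -/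
abbrev LocalizedCompletion : Type u :=
  Localization (Algebra.algebraMapSubmonoid (Completion O) (nonZeroDivisors O))

/-- The canonical map from the fraction field `F` of `O` to the localized completion. -/
noncomputable def fromFractionField (F : Type u) [Field F] [Algebra O F] [IsFractionRing O F] :
    F →+* LocalizedCompletion O :=
  IsLocalization.map (M := nonZeroDivisors O)
    (T := Algebra.algebraMapSubmonoid (Completion O) (nonZeroDivisors O))
    (LocalizedCompletion O) (algebraMap O (Completion O))
    (Submonoid.le_comap_map (nonZeroDivisors O))

/-- The canonical map from `Ô` to the residue field `K / m` of a maximal ideal `m` of the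
localized completion `K`. -/
noncomputable def toFactor (m : MaximalSpectrum (LocalizedCompletion O)) :
    Completion O →+* m.asIdeal.ResidueField :=
  (algebraMap (LocalizedCompletion O) m.asIdeal.ResidueField).comp
    (algebraMap (Completion O) (LocalizedCompletion O))

/-- One of the local fields whose product is the localized completion `K` of `O`: a maximal ideal
`m` of `K`, i.e. a field factor `K / m`, together with its ring of integers, i.e. the discrete
valuation ring of the field `K / m` that contains and dominates the image of `Ô`. (For the local
ring of a curve this discrete valuation ring is uniquely determined by `m`: it is the integral
closure of `Ô` in `K / m`.) -/
structure Branch where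
  /-- the maximal ideal of the localized completion -/
  ideal : MaximalSpectrum (LocalizedCompletion O)
  /-- the ring of integers of the local field -/
  integers : ValuationSubring ideal.asIdeal.ResidueField
  isDiscreteValuationRing : IsDiscreteValuationRing integers
  mem_integers : ∀ x : Completion O, toFactor O ideal x ∈ integers
  valuation_lt_one : ∀ x ∈ IsLocalRing.maximalIdeal O,
    integers.valuation (toFactor O ideal (algebraMap O (Completion O) x)) < 1

attribute [instance] Branch.isDiscreteValuationRing

namespace Branch

variable {O} (b : Branch O)

/-- The map from `O` to the ring of integers of a branch. -/
noncomputable def toIntegers : O →+* b.integers :=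
  ((toFactor O b.ideal).comp (algebraMap O (Completion O))).codRestrict b.integers.toSubring
    fun _ => b.mem_integers _

instance : IsLocalHom b.toIntegers where
  map_nonunit x hx := by
    by_contra h
    have h1 := b.valuation_lt_one x ((IsLocalRing.mem_maximalIdeal x).2 h)
    have h2 := (b.integers.valuation_eq_one_iff (b.toIntegers x)).1 hx
    exact h1.ne h2

/-- The extension of residue fields defined by a branch. -/
noncomputable def residueMap :
    IsLocalRing.ResidueField O →+* IsLocalRing.ResidueField b.integers :=
  IsLocalRing.ResidueField.map b.toIntegers

/-- The image in the local field of a branch of a nonzero element of the fraction field. -/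
noncomputable def fieldMap {F : Type u} [Field F] [Algebra O F] [IsFractionRing O F] :
    Fˣ →* (b.ideal.asIdeal.ResidueField)ˣ :=
  Units.map ((algebraMap (LocalizedCompletion O) b.ideal.asIdeal.ResidueField).comp
    (fromFractionField O F)).toMonoidHom

end Branch

/-- The symbol `{f, g}` at a local domain `O` with fraction field `F`, with values in the
multiplicative group of the residue field of `O`: the product over the local fields of which the
localized completion is the product of the tame symbols, each taken to the residue field of `O`
by the norm. (If `O` is a discrete valuation ring there is a single branch, with the same residue
field as `O`, and this is the usual tame symbol.) -/
noncomputable def localSymbol {F : Type u} [Field F] [Algebra O F] [IsFractionRing O F]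
    (f g : Fˣ) : (IsLocalRing.ResidueField O)ˣ :=
  ∏ᶠ b : Branch O, unitsNorm b.residueMap
    (tameSymbol b.integers (b.fieldMap f) (b.fieldMap g))

end Local

/-! ### Projective curves -/

section Curve

attribute [local instance] MvPolynomial.gradedAlgebra

/-- The projective space of dimension `n` over `k`. -/
noncomputable abbrev ProjSpace (k : Type u) [Field k] (n : ℕ) : Scheme.{u} :=
  Proj (MvPolynomial.homogeneousSubmodule (Fin (n + 1)) k)

/-- The structure morphism of projective space. -/
noncomputable def ProjSpace.toSpec (k : Type u) [Field k] (n : ℕ) :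
    ProjSpace k n ⟶ Spec (CommRingCat.of k) :=
  Proj.toSpecZero (MvPolynomial.homogeneousSubmodule (Fin (n + 1)) k) ≫
    Spec.map (CommRingCat.ofHom
      (algebraMap k (MvPolynomial.homogeneousSubmodule (Fin (n + 1)) k 0)))

variable {k : Type u} [Field k] {C : Scheme.{u}} (s : C ⟶ Spec (CommRingCat.of k))

/-- `C` is projective over `k`: it has a closed immersion over `k` into a projective space. -/
def IsProjective : Prop :=
  ∃ (n : ℕ) (i : C ⟶ ProjSpace k n), IsClosedImmersion i ∧ i ≫ ProjSpace.toSpec k n = s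

/-- The homomorphism from `k` to the residue field of a point of a `k`-scheme. -/
noncomputable def baseToResidueField (p : C) :
    k →+* IsLocalRing.ResidueField (C.presheaf.stalk p) :=
  (IsLocalRing.residue (C.presheaf.stalk p)).comp
    ((Scheme.ΓSpecIso (CommRingCat.of k)).inv ≫ s.appTop ≫
      C.presheaf.germ ⊤ p trivial).hom

/-- The local factor `Nm_{k(p)/k} {f, g}_p`. -/
noncomputable def localFactor [IsIntegral C] (f g : C.functionFieldˣ) (p : C) : kˣ :=
  unitsNorm (baseToResidueField s p) (localSymbol (C.presheaf.stalk p) f g)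

end Curve

end WeilReciprocity

/-!
The reciprocity law is first proved for the function field `F` of the curve, as a product formula
over its places, i.e. over the discrete valuation rings of `F` containing `k`; the places are then
grouped by their centers on the curve. The advantage of places is that they do not see the
singularities of `C`.

**The function field** (`finprod_symbol`). If `f` and `g` are both algebraic over `k`, all orders
vanish. Otherwise one of them is transcendental, and by antisymmetry and multiplicativity the symbol
is `{x, g}` with `x` transcendental and `g` integral over `k[x]`. Let `N` be the norm from `F` to
`k(x)`, so that `N g = x ^ m * h` with a polynomial `h` prime to `x`. The places of `F` are of three
kinds.
* The zeros of `x` are the primes of the integral closure of the local ring of the `x`-line at the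
  origin. The product of the symbols over them is `(-1) ^ m / h(0)` (`finprod_symbol_uniformizer`).
  By multiplicativity it is enough to treat a prime element `g = π`. With `x = π ^ e * c`, the norm
  of `π` is computed from its matrix in a basis adapted to the powers of `π` (`norm_prime`), and the
  two factors that occur are the symbol at the place of `π` and the product of those at the others.
* The poles of `x` are the zeros of `x⁻¹`, so that the same formula applies to them.
* The remaining places are the primes of the integral closure `B` of the Laurent polynomials. There
  `x` is a unit, and the product of the symbols is the norm of `x` on `B ⧸ (g)`. By elementary
  divisors this is the norm of `x` on the quotient of the Laurent polynomials by `N g`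
  (`quotientNorm_algebraMap`), that is, the product of the roots of `h` (`quotientNorm_X`).

The three contributions cancel (`finprod_symbol_of_isIntegral`). Integral closures of `k[x]` in `F`
are finite modules because `k` is perfect (`finite_integralClosure_polynomial`).

**The local rings** (`unitsNorm_localSymbol`). The branches of the local ring `O` of a closed point
correspond to the places dominating `O` (`branchEquivPlace`), with the same residue fields and the
same tame symbols. A branch restricts to a place of `F`, and since `F` is dense in the local field
the branch can be recovered from the place (`Branch.place_injective`). Conversely, if a place with
valuation ring `A` dominates `O`, the completion of `A` is finite over the completion of `O`
(`completionMap_finite`), so that the fraction field of the former is integral over the localized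
completion; the kernel of the map between them is the maximal ideal of a branch
(`Place.Dominates.exists_branch`).

**The curve.** Being projective, `C` is proper over `k`, and by the valuative criterion every place
dominates the local ring of exactly one point (`existsUnique_dominates`). This point is not the
generic one, hence it is closed, as `C` has dimension one. By Noether normalization `F` is finite
over `k(t)` for every transcendental `t` (`finiteDimensional_functionField`), so that the product
formula applies.
-/

namespace WeilReciprocity

/-! ### Discrete valuations and tame symbols -/

section Dvr
variable {K : Type u} [Field K] (A : ValuationSubring K) [IsDiscreteValuationRing A]

theorem ord_div (f g : Kˣ) : ord A (f / g) = ord A f - ord A g := by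
  rw [div_eq_mul_inv, ord_mul, ord_inv, sub_eq_add_neg]

theorem ord_pow (f : Kˣ) (n : ℕ) : ord A (f ^ n) = n * ord A f := by
  have := ord_zpow A f n
  simpa using this

theorem ord_eq_zero_of_mem_unitGroup {f : Kˣ} (h : f ∈ A.unitGroup) : ord A f = 0 := by
  have h2 : (f : K) ∈ MonoidHom.mker (Ring.ordFrac A (K := K)) := by
    rw [Ring.mker_ordFrac_eq_isUnitSubmonoid]
    exact ⟨(A.unitGroupMulEquiv ⟨f, h⟩ : Aˣ), Units.isUnit _, rfl⟩
  have h3 : Ring.ordFrac A (f : K) = 1 := h2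
  simp [ord, h3]

theorem ord_eq_zero_iff {f : Kˣ} : ord A f = 0 ↔ f ∈ A.unitGroup :=
  ⟨mem_unitGroup_of_ord_eq_zero A, ord_eq_zero_of_mem_unitGroup A⟩

theorem ord_irreducible {x : A} (hx : Irreducible x) {f : Kˣ} (hf : (f : K) = x) :
    ord A f = 1 := by
  have := Ring.ordFrac_irreducible (K := K) hx
  simp only [ord, hf]
  erw [this]
  rfl

theorem exists_ord_eq_one : ∃ p : Kˣ, ord A p = 1 := by
  obtain ⟨x, hx⟩ := IsDiscreteValuationRing.exists_irreducible A
  have h0 : (x : K) ≠ 0 := by simpa using hx.ne_zero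
  exact ⟨Units.mk0 (x : K) h0, ord_irreducible A hx rfl⟩

theorem mem_of_ord_eq_one {p : Kˣ} (hp : ord A p = 1) :
    ∃ x : A, Irreducible x ∧ (x : K) = p := by
  obtain ⟨x, hx⟩ := IsDiscreteValuationRing.exists_irreducible A
  have h0 : (x : K) ≠ 0 := by simpa using hx.ne_zero
  have h1 : ord A (p / Units.mk0 (x : K) h0) = 0 := by
    rw [ord_div, hp, ord_irreducible A hx (f := Units.mk0 (x : K) h0) rfl, sub_self]
  have h2 := mem_unitGroup_of_ord_eq_zero A h1
  set u := A.unitGroupMulEquiv ⟨_, h2⟩ with hu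
  refine ⟨x * u, ?_, ?_⟩
  · exact (irreducible_mul_units u).2 hx
  · have : ((u : A) : K) = p / x := by simp [hu]
    push_cast
    rw [this]
    field_simp

theorem ord_nonneg_iff {f : Kˣ} : 0 ≤ ord A f ↔ (f : K) ∈ A := by
  obtain ⟨p, hp⟩ := exists_ord_eq_one A
  obtain ⟨x, hx, hxp⟩ := mem_of_ord_eq_one A hp
  have hu : f / p ^ ord A f ∈ A.unitGroup := by
    apply mem_unitGroup_of_ord_eq_zero
    rw [ord_div, ord_zpow, hp]; ring
  set v := f / p ^ ord A f with hv
  have hf : f = v * p ^ ord A f := by rw [hv]; simp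
  have hvm : (v : K) ∈ A := (A.valuation_le_one_iff _).1 (le_of_eq hu)
  constructor
  · intro h
    obtain ⟨n, hn⟩ := Int.eq_ofNat_of_zero_le h
    rw [hf, hn]
    push_cast
    rw [← hxp]
    exact mul_mem hvm (by simpa using pow_mem x.2 n)
  · intro h
    by_contra hneg
    push Not at hneg
    -- then `f⁻¹` is a positive power of the uniformizer times a unit, hence not a unit
    obtain ⟨n, hn⟩ : ∃ n : ℕ, ord A f = -(n + 1 : ℕ) :=
      ⟨(-ord A f - 1).toNat, by omega⟩
    have h1 : (p : K) * ((f : K) * ((v⁻¹ : Kˣ) : K) * (p : K) ^ n) = 1 := by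
      have : p * (f * v⁻¹ * p ^ n) = 1 := by
        conv_lhs => rw [hf, hn]
        rw [show v * p ^ (-((n + 1 : ℕ) : ℤ)) * v⁻¹ = p ^ (-((n + 1 : ℕ) : ℤ)) by
          rw [mul_comm v]; group]
        rw [zpow_neg, zpow_natCast, pow_succ]; group
      simpa using congrArg Units.val this
    have hvi : ((v⁻¹ : Kˣ) : K) ∈ A := (A.valuation_le_one_iff _).1 (le_of_eq (inv_mem hu))
    have hm : (f : K) * ((v⁻¹ : Kˣ) : K) * (p : K) ^ n ∈ A :=
      mul_mem (mul_mem h hvi) (pow_mem (hxp ▸ x.2) n)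
    refine hx.not_isUnit (IsUnit.of_mul_eq_one ⟨_, hm⟩ ?_)
    apply Subtype.ext
    simpa [hxp] using h1

theorem ord_pos_iff {f : Kˣ} : 0 < ord A f ↔ A.valuation (f : K) < 1 := by
  rw [lt_iff_le_and_ne, ord_nonneg_iff, lt_iff_le_and_ne, ← A.valuation_le_one_iff, ne_comm, ne_eq,
    ord_eq_zero_iff, A.mem_unitGroup_iff]

theorem tameElement_mul_right (f g h : Kˣ) :
    tameElement A f (g * h) = tameElement A f g * tameElement A f h := by
  simp only [tameElement, ord_mul, mul_add, zpow_add, mul_zpow, div_eq_mul_inv, mul_inv]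
  simp only [mul_comm, mul_left_comm, mul_assoc]

theorem tameElement_mul_swap (f g : Kˣ) : tameElement A f g * tameElement A g f = 1 := by
  simp only [tameElement]
  have h : ((-1 : Kˣ) ^ (ord A f * ord A g)) * (-1) ^ (ord A g * ord A f) = 1 := by
    rw [mul_comm (ord A g), ← mul_zpow]; simp
  calc _ = ((-1 : Kˣ) ^ (ord A f * ord A g)) * (-1) ^ (ord A g * ord A f) *
        ((f ^ ord A g / g ^ ord A f) * (g ^ ord A f / f ^ ord A g)) := by
          simp only [mul_comm, mul_left_comm, mul_assoc]
    _ = 1 := by rw [h]; simp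

theorem tameSymbol_mul_right (f g h : Kˣ) :
    tameSymbol A f (g * h) = tameSymbol A f g * tameSymbol A f h := by
  rw [tameSymbol, tameSymbol, tameSymbol, ← map_mul]
  congr 1
  exact Subtype.ext (tameElement_mul_right A f g h)

theorem tameSymbol_mul_swap (f g : Kˣ) : tameSymbol A f g * tameSymbol A g f = 1 := by
  rw [tameSymbol, tameSymbol, ← map_mul, ← map_one A.unitGroupToResidueFieldUnits]
  congr 1
  exact Subtype.ext (tameElement_mul_swap A f g)

theorem tameSymbol_swap (f g : Kˣ) : tameSymbol A g f = (tameSymbol A f g)⁻¹ :=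
  eq_inv_of_mul_eq_one_right (tameSymbol_mul_swap A f g)

/-- The tame symbol `{f, ·}` as a homomorphism. -/
noncomputable def tameSymbolHom (f : Kˣ) : Kˣ →* (IsLocalRing.ResidueField A)ˣ :=
  MonoidHom.mk' (tameSymbol A f) (tameSymbol_mul_right A f)

theorem tameSymbol_inv_left (f g : Kˣ) : tameSymbol A f⁻¹ g = (tameSymbol A f g)⁻¹ := by
  rw [tameSymbol_swap A g, tameSymbol_swap A g]
  exact congrArg _ (map_inv (tameSymbolHom A g) f)

theorem tameSymbol_eq_one {f g : Kˣ} (hf : ord A f = 0) (hg : ord A g = 0) :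
    tameSymbol A f g = 1 := by
  rw [tameSymbol, ← map_one A.unitGroupToResidueFieldUnits]
  congr 1
  exact Subtype.ext (by simp [tameElement, hf, hg])

theorem tameSymbol_of_eq {f g u : Kˣ} (hu : u ∈ A.unitGroup) (h : tameElement A f g = u) :
    tameSymbol A f g = A.unitGroupToResidueFieldUnits ⟨u, hu⟩ := by
  subst h; rfl

/-- A valuation subring of which every nonzero element is a unit times a power of a fixed nonunit
is a discrete valuation ring. -/
theorem isDiscreteValuationRing_of_pow {L : Type u} [Field L] (V : ValuationSubring L) (p : V)
    (hp : p ≠ 0) (hp' : ¬ IsUnit p)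
    (h : ∀ x : V, x ≠ 0 → ∃ n : ℕ, Associated (p ^ n) x) : IsDiscreteValuationRing V := by
  refine IsDiscreteValuationRing.ofHasUnitMulPowIrreducibleFactorization ⟨p, ⟨hp', ?_⟩, ?_⟩
  · intro a b hab
    have ha : a ≠ 0 := by rintro rfl; simp at hab; exact hp hab
    have hb : b ≠ 0 := by rintro rfl; simp at hab; exact hp hab
    obtain ⟨n, u, hn⟩ := h a ha
    obtain ⟨m, v, hm⟩ := h b hb
    rcases Nat.eq_zero_or_pos n with rfl | hn0
    · left; rw [← hn]; simp
    rcases Nat.eq_zero_or_pos m with rfl | hm0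
    · right; rw [← hm]; simp
    exfalso
    apply hp'
    obtain ⟨n, rfl⟩ := Nat.exists_eq_succ_of_ne_zero hn0.ne'
    obtain ⟨m, rfl⟩ := Nat.exists_eq_succ_of_ne_zero hm0.ne'
    have h1 : p * 1 = p * (p * (p ^ n * p ^ m * u * v)) := by
      rw [mul_one]
      conv_lhs => rw [hab, ← hn, ← hm]
      simp only [Nat.succ_eq_add_one]; ring
    exact IsUnit.of_mul_eq_one _ (mul_left_cancel₀ hp h1).symm
  · intro x hx
    exact h x hx

end Dvr

section UnitsNorm

theorem unitsNorm_comp {R S T : Type u} [Field R] [Field S] [Field T] (φ : R →+* S) (ψ : S →+* T)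
    (x : Tˣ) : unitsNorm φ (unitsNorm ψ x) = unitsNorm (ψ.comp φ) x := by
  let _ := φ.toAlgebra
  let _ := ψ.toAlgebra
  let _ := (ψ.comp φ).toAlgebra
  have : IsScalarTower R S T := IsScalarTower.of_algebraMap_eq (fun _ => rfl)
  apply Units.ext
  exact Algebra.norm_norm (R := R) (S := S) (A := T) (a := (x : T))

theorem unitsNorm_equiv {R S T : Type u} [Field R] [Field S] [Field T] (φ : R →+* S) (e : S ≃+* T)
    (x : Sˣ) : unitsNorm ((e : S →+* T).comp φ) (Units.map (e : S →* T) x) = unitsNorm φ x := by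
  let _ := φ.toAlgebra
  let _ := ((e : S →+* T).comp φ).toAlgebra
  apply Units.ext
  exact Algebra.norm_eq_of_algEquiv
    (AlgEquiv.ofRingEquiv (f := e) (fun _ => rfl) : S ≃ₐ[R] T) (x : S)

end UnitsNorm

/-! ### Norms on quotients of Dedekind domains -/

/-- Determinants are multiplicative in short exact sequences. -/
theorem det_of_exact {k : Type*} [Field k] {M₁ M₂ M₃ : Type*} [AddCommGroup M₁] [AddCommGroup M₂]
    [AddCommGroup M₃] [Module k M₁] [Module k M₂] [Module k M₃] [Module.Finite k M₂]
    (i : M₁ →ₗ[k] M₂) (p : M₂ →ₗ[k] M₃) (hi : Function.Injective i) (hp : Function.Surjective p)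
    (hip : Function.Exact i p) (e₁ : M₁ →ₗ[k] M₁) (e₂ : M₂ →ₗ[k] M₂) (e₃ : M₃ →ₗ[k] M₃)
    (h₁ : ∀ x, i (e₁ x) = e₂ (i x)) (h₂ : ∀ x, p (e₂ x) = e₃ (p x)) :
    LinearMap.det e₂ = LinearMap.det e₁ * LinearMap.det e₃ := by
  have hker : LinearMap.ker p = LinearMap.range i := hip.linearMap_ker_eq
  have hc : LinearMap.ker p ≤ (LinearMap.ker p).comap e₂ := by
    intro x hx
    simp only [Submodule.mem_comap, LinearMap.mem_ker] at hx ⊢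
    rw [h₂, hx, map_zero]
  rw [LinearMap.det_eq_det_mul_det (LinearMap.ker p) e₂ hc]
  congr 1
  · let E : M₁ ≃ₗ[k] LinearMap.ker p :=
      (LinearEquiv.ofInjective i hi).trans (LinearEquiv.ofEq _ _ hker.symm)
    rw [← LinearMap.det_conj e₁ E]
    congr 1
    ext x
    obtain ⟨y, rfl⟩ := E.surjective x
    have : ∀ z, ((E z : LinearMap.ker p) : M₂) = i z := fun z => rfl
    simp only [LinearMap.comp_apply, LinearEquiv.coe_coe, LinearEquiv.symm_apply_apply, this,
      LinearMap.restrict_apply]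
    exact (h₁ y).symm
  · let E : (M₂ ⧸ LinearMap.ker p) ≃ₗ[k] M₃ := p.quotKerEquivOfSurjective hp
    rw [← LinearMap.det_conj _ E]
    congr 1
    ext x
    obtain ⟨y, rfl⟩ := hp x
    have : E.symm (p y) = Submodule.Quotient.mk y := by
      rw [LinearEquiv.symm_apply_eq]; rfl
    simp only [LinearMap.comp_apply, LinearEquiv.coe_coe, this]
    exact h₂ y

section Dedekind
variable {k B : Type*} [Field k] [CommRing B] [Algebra k B]

variable (k) in
/-- The norm of `b` on `B ⧸ I`, i.e. the determinant over `k` of the multiplication by `b`. -/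
noncomputable def quotientNorm (b : B) (I : Ideal B) : k :=
  Algebra.norm k (Ideal.Quotient.mk I b)

theorem quotientNorm_top (b : B) : quotientNorm k b ⊤ = 1 := by
  have : Subsingleton (B ⧸ (⊤ : Ideal B)) := Ideal.Quotient.subsingleton_iff.2 rfl
  rw [quotientNorm, Algebra.norm_apply]
  exact LinearMap.det_eq_one_of_subsingleton _

variable [IsDedekindDomain B]

/-- `I / pI` is a one-dimensional vector space over `B ⧸ p`, so that `B ⧸ p` is isomorphic to the
kernel of `B ⧸ pI → B ⧸ I`. -/
theorem quotientNorm_mul (b : B) (p I : Ideal B) [p.IsMaximal] (hI : I ≠ ⊥)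
    [Module.Finite k (B ⧸ (p * I))] :
    quotientNorm k b (p * I) = quotientNorm k b p * quotientNorm k b I := by
  have hp : p ≠ ⊤ := Ideal.IsPrime.ne_top'
  -- a generator of `I` modulo `p * I`
  obtain ⟨a, haI, hap⟩ : ∃ a ∈ I, a ∉ p * I := by
    by_contra! h
    have h1 : p * I = 1 * I := by rw [one_mul]; exact le_antisymm Ideal.mul_le_right h
    exact hp (by simpa using mul_right_cancel₀ hI h1)
  have hgen : ∀ x ∈ I, ∃ c : B, x - c * a ∈ p * I := by
    have hle : p * I ≤ Ideal.span {a} ⊔ p * I := le_sup_right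
    have hle2 : Ideal.span {a} ⊔ p * I ≤ I :=
      sup_le ((Ideal.span_singleton_le_iff_mem _).2 haI) Ideal.mul_le_right
    obtain ⟨J, hJ⟩ := Ideal.dvd_iff_le.2 hle2
    have hpJ : p ≤ J := by
      have : I * J ∣ I * p := Ideal.dvd_iff_le.2 (by rw [← hJ, mul_comm]; exact hle)
      exact Ideal.dvd_iff_le.1 ((mul_dvd_mul_iff_left hI).1 this)
    have hJtop : J = ⊤ := by
      rcases (Ideal.isMaximal_def.1 ‹p.IsMaximal›).le_iff.1 hpJ with h | h
      · exact h
      · exfalso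
        apply hap
        rw [mul_comm, ← h, ← hJ]
        exact Ideal.mem_sup_left (Ideal.mem_span_singleton_self a)
    intro x hx
    have : x ∈ Ideal.span {a} ⊔ p * I := by rw [hJ, hJtop, Ideal.mul_top]; exact hx
    obtain ⟨y, hy, z, hz, rfl⟩ := Submodule.mem_sup.1 this
    obtain ⟨c, rfl⟩ := Ideal.mem_span_singleton'.1 hy
    exact ⟨c, by simpa using hz⟩
  have hpa : ∀ c : B, c * a ∈ p * I ↔ c ∈ p := by
    intro c
    refine ⟨fun h => ?_, fun h => Ideal.mul_mem_mul h haI⟩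
    by_contra hc
    obtain ⟨d, hd⟩ := Ideal.IsMaximal.exists_inv ‹p.IsMaximal› hc
    obtain ⟨q, hq, hdq⟩ := hd
    apply hap
    have : a = d * (c * a) + q * a := by rw [← mul_assoc, ← add_mul, hdq, one_mul]
    rw [this]
    exact add_mem (Ideal.mul_mem_left _ _ h) (Ideal.mul_mem_mul hq haI)
  let i : (B ⧸ p) →ₗ[k] (B ⧸ (p * I)) :=
    (Submodule.mapQ p (p * I) (LinearMap.toSpanSingleton B B a) (fun c hc => by
      simpa using (hpa c).2 hc)).restrictScalars k
  let q : (B ⧸ (p * I)) →ₗ[k] (B ⧸ I) := (Ideal.Quotient.factorₐ k Ideal.mul_le_right).toLinearMap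
  have hi : ∀ c : B, i (Ideal.Quotient.mk p c) = Ideal.Quotient.mk (p * I) (c * a) := fun c => rfl
  have hq : ∀ c : B, q (Ideal.Quotient.mk _ c) = Ideal.Quotient.mk I c := fun c => rfl
  simp only [quotientNorm, Algebra.norm_apply]
  refine det_of_exact i q ?_ ?_ ?_ _ _ _ ?_ ?_
  · refine (injective_iff_map_eq_zero i).2 fun x hx => ?_
    obtain ⟨c, rfl⟩ := Ideal.Quotient.mk_surjective x
    rw [hi, Ideal.Quotient.eq_zero_iff_mem, hpa] at hx
    exact Ideal.Quotient.eq_zero_iff_mem.2 hx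
  · intro x
    obtain ⟨c, rfl⟩ := Ideal.Quotient.mk_surjective x
    exact ⟨Ideal.Quotient.mk _ c, hq c⟩
  · intro x
    obtain ⟨c, rfl⟩ := Ideal.Quotient.mk_surjective x
    rw [hq, Ideal.Quotient.eq_zero_iff_mem]
    constructor
    · intro hc
      obtain ⟨d, hd⟩ := hgen c hc
      exact ⟨Ideal.Quotient.mk p d, by rw [hi]; exact ((Ideal.Quotient.eq).2 hd).symm⟩
    · rintro ⟨y, hy⟩
      obtain ⟨d, rfl⟩ := Ideal.Quotient.mk_surjective y
      rw [hi, Ideal.Quotient.eq] at hy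
      have := Ideal.mul_le_right hy
      simpa using sub_mem (I.mul_mem_left d haI) this
  · intro x
    obtain ⟨c, rfl⟩ := Ideal.Quotient.mk_surjective x
    change i (Ideal.Quotient.mk p b * Ideal.Quotient.mk p c) = Ideal.Quotient.mk _ b * i _
    rw [← map_mul, hi, hi, ← map_mul, mul_assoc]
  · intro x
    obtain ⟨c, rfl⟩ := Ideal.Quotient.mk_surjective x
    change q (Ideal.Quotient.mk _ b * Ideal.Quotient.mk _ c) = Ideal.Quotient.mk _ b * q _
    rw [← map_mul, hq, hq, ← map_mul]

open IsDedekindDomain in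
/-- The norm of an element on a quotient of a Dedekind domain by a nonzero ideal is the product of
its norms on the residue fields, with multiplicities. -/
theorem quotientNorm_eq_prod (b : B) (hfin : ∀ J : Ideal B, J ≠ ⊥ → Module.Finite k (B ⧸ J))
    (I : Ideal B) (hI : I ≠ ⊥) (S : Finset (HeightOneSpectrum B))
    (hS : ∀ v : HeightOneSpectrum B, I ≤ v.asIdeal → v ∈ S) :
    quotientNorm k b I = ∏ v ∈ S, quotientNorm k b v.asIdeal ^
      (Associates.mk v.asIdeal).count (Associates.mk I).factors := by
  classical
  have key : ∀ T : Finset (HeightOneSpectrum B), ∀ n : HeightOneSpectrum B → ℕ,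
      (∏ v ∈ T, v.asIdeal ^ n v) ≠ ⊥ ∧
      quotientNorm k b (∏ v ∈ T, v.asIdeal ^ n v) = ∏ v ∈ T, quotientNorm k b v.asIdeal ^ n v := by
    intro T n
    induction T using Finset.induction_on with
    | empty =>
      simp only [Finset.prod_empty]
      exact ⟨one_ne_zero, by rw [Ideal.one_eq_top, quotientNorm_top]⟩
    | insert w T hw ih =>
      rw [Finset.prod_insert hw, Finset.prod_insert hw]
      generalize n w = m
      induction m with
      | zero => rw [pow_zero, one_mul, pow_zero, one_mul]; exact ih
      | succ m ih2 =>
        have hne : w.asIdeal * (w.asIdeal ^ m * ∏ v ∈ T, v.asIdeal ^ n v) ≠ ⊥ :=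
          mul_ne_zero w.ne_bot ih2.1
        have := hfin _ hne
        have := w.isMaximal
        rw [pow_succ', mul_assoc, pow_succ', mul_assoc]
        exact ⟨hne, by rw [quotientNorm_mul b _ _ ih2.1, ih2.2]⟩
  have hprod : I = ∏ v ∈ S,
      v.asIdeal ^ (Associates.mk v.asIdeal).count (Associates.mk I).factors := by
    conv_lhs => rw [← Ideal.finprod_heightOneSpectrum_factorization hI]
    refine finprod_eq_prod_of_mulSupport_subset _ fun v hv => hS v ?_
    by_contra hvI
    apply hv
    simp only [HeightOneSpectrum.maxPowDividing]
    have : (Associates.mk v.asIdeal).count (Associates.mk I).factors = 0 := by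
      by_contra h0
      exact hvI (Ideal.dvd_iff_le.1 ((Associates.count_ne_zero_iff_dvd hI v.irreducible).1 h0))
    rw [this, pow_zero]
  conv_lhs => rw [hprod]
  exact (key S _).2

end Dedekind

/-! ### Places of a function field -/

/-- A place of a field `F` over a subfield `k`: a discrete valuation ring of `F` containing `k`. -/
structure Place (k F : Type u) [Field k] [Field F] [Algebra k F] where
  /-- the valuation ring -/
  ring : ValuationSubring F
  isDiscreteValuationRing : IsDiscreteValuationRing ring
  algebraMap_mem : ∀ c : k, algebraMap k F c ∈ ring

namespace Place

attribute [instance] Place.isDiscreteValuationRing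

variable {k F : Type u} [Field k] [Field F] [Algebra k F]

theorem ext {A A' : Place k F} (h : A.ring = A'.ring) : A = A' := by
  cases A; cases A'; cases h; rfl

/-- The residue field of a place as an extension of `k`. -/
noncomputable def residueMap (A : Place k F) : k →+* IsLocalRing.ResidueField A.ring :=
  (IsLocalRing.residue A.ring).comp
    ((algebraMap k F).codRestrict A.ring.toSubring A.algebraMap_mem)

/-- The norm to `k` of the tame symbol at a place. (The norm is the intended one when the residue
field is finite over `k`.) -/
noncomputable def symbol (A : Place k F) (f g : Fˣ) : kˣ :=
  unitsNorm A.residueMap (tameSymbol A.ring f g)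

theorem symbol_swap (A : Place k F) (f g : Fˣ) : A.symbol g f = (A.symbol f g)⁻¹ := by
  rw [symbol, tameSymbol_swap, map_inv]; rfl

theorem symbol_mul_right (A : Place k F) (f g h : Fˣ) :
    A.symbol f (g * h) = A.symbol f g * A.symbol f h := by
  rw [symbol, tameSymbol_mul_right, map_mul]; rfl

theorem symbol_inv_left (A : Place k F) (f g : Fˣ) : A.symbol f⁻¹ g = (A.symbol f g)⁻¹ := by
  rw [symbol, tameSymbol_inv_left, map_inv]; rfl

theorem symbol_eq_one (A : Place k F) {f g : Fˣ} (hf : ord A.ring f = 0) (hg : ord A.ring g = 0) :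
    A.symbol f g = 1 := by
  rw [symbol, tameSymbol_eq_one _ hf hg, map_one]

theorem ring_ne_top (A : Place k F) : A.ring ≠ ⊤ := by
  obtain ⟨p, hp⟩ := exists_ord_eq_one A.ring
  intro h
  have h1 : ((p⁻¹ : Fˣ) : F) ∈ A.ring := by rw [h]; trivial
  rw [← ord_nonneg_iff, ord_inv, hp] at h1
  omega

end Place

section AtPrime
open IsDedekindDomain
variable {k B F : Type u} [Field k] [CommRing B] [IsDedekindDomain B] [Algebra k B]
  [Field F] [Algebra B F] [IsFractionRing B F] [Algebra k F] [IsScalarTower k B F]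

instance (v : HeightOneSpectrum B) :
    IsDiscreteValuationRing (HeightOneSpectrum.valuationSubringAtPrime F v) :=
  have : IsLocalization.AtPrime (HeightOneSpectrum.valuationSubringAtPrime F v) v.asIdeal :=
    inferInstanceAs (IsLocalization v.asIdeal.primeCompl _)
  IsLocalization.AtPrime.isDiscreteValuationRing_of_dedekind_domain B v.ne_bot _

theorem mem_valuationSubringAtPrime (v : HeightOneSpectrum B) {x : F} :
    x ∈ HeightOneSpectrum.valuationSubringAtPrime F v ↔ v.valuation F x ≤ 1 := by
  rw [HeightOneSpectrum.valuationSubringAtPrime_eq_valuationSubring]; rfl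

theorem algebraMap_mem_valuationSubringAtPrime (v : HeightOneSpectrum B) (b : B) :
    algebraMap B F b ∈ HeightOneSpectrum.valuationSubringAtPrime F v :=
  (mem_valuationSubringAtPrime v).2 (v.valuation_le_one b)

variable (k F) in
/-- The place of `F` at a nonzero prime of a Dedekind domain with field of fractions `F`. -/
noncomputable def placeAtPrime (v : HeightOneSpectrum B) : Place k F where
  ring := HeightOneSpectrum.valuationSubringAtPrime F v
  isDiscreteValuationRing := inferInstance
  algebraMap_mem c := by
    rw [IsScalarTower.algebraMap_apply k B F]
    exact algebraMap_mem_valuationSubringAtPrime v _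

theorem mem_placeAtPrime (v : HeightOneSpectrum B) {x : F} :
    x ∈ (placeAtPrime k F v).ring ↔ v.valuation F x ≤ 1 :=
  mem_valuationSubringAtPrime v

theorem ord_placeAtPrime (v : HeightOneSpectrum B) (f : Fˣ) :
    ord (placeAtPrime k F v).ring f = - WithZero.log (v.valuation F (f : F)) := by
  set A := (placeAtPrime k F v).ring with hA
  have hnn : ∀ g : Fˣ, 0 ≤ ord A g ↔ v.valuation F (g : F) ≤ 1 := fun g => by
    rw [ord_nonneg_iff, hA, mem_placeAtPrime]
  have h0 : ∀ g : Fˣ, v.valuation F (g : F) = 1 → ord A g = 0 := by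
    intro g hg
    have h1 := (hnn g).2 hg.le
    have h2 := (hnn g⁻¹).2 (by simp [hg])
    rw [ord_inv] at h2
    omega
  obtain ⟨x, hx⟩ := v.valuation_exists_uniformizer F
  have hx0 : x ≠ 0 := by
    rintro rfl
    rw [map_zero] at hx
    exact WithZero.exp_ne_zero hx.symm
  set p : Fˣ := Units.mk0 x hx0 with hp
  have hpx : v.valuation F (p : F) = WithZero.exp (-1 : ℤ) := hx
  have hp1 : ord A p = 1 := by
    have h1 : 0 ≤ ord A p := (hnn p).2 (by rw [hpx, ← WithZero.exp_zero, WithZero.exp_le_exp]; simp)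
    have h2 : ¬ 0 ≤ ord A p⁻¹ := by
      rw [hnn]
      simp only [Units.val_inv_eq_inv_val, map_inv₀, hpx, not_le]
      rw [← WithZero.exp_neg, ← WithZero.exp_zero, WithZero.exp_lt_exp]; simp
    rw [ord_inv] at h2
    obtain ⟨q, hq⟩ := exists_ord_eq_one A
    have h3 : ¬ 0 ≤ ord A q⁻¹ := by rw [ord_inv, hq]; simp
    have h4 : v.valuation F (q : F) ≤ v.valuation F (p : F) := by
      rw [hnn] at h3
      have hq0 : v.valuation F (q : F) ≠ 0 := by simp
      simp only [Units.val_inv_eq_inv_val, map_inv₀, not_le] at h3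
      rw [hpx, ← WithZero.exp_log hq0, WithZero.exp_le_exp]
      rw [← WithZero.exp_log hq0, ← WithZero.exp_neg, ← WithZero.exp_zero,
        WithZero.exp_lt_exp] at h3
      omega
    have h5 : 0 ≤ ord A (q / p) := by
      rw [hnn]
      simp only [Units.val_div_eq_div_val, map_div₀]
      exact div_le_one_of_le₀ h4 zero_le
    rw [ord_div, hq] at h5
    omega
  set n := WithZero.log (v.valuation F (f : F)) with hn
  have hf : v.valuation F (f : F) ≠ 0 := by simp
  have : ord A (f * p ^ n) = 0 := by
    apply h0
    simp only [Units.val_mul, Units.val_zpow_eq_zpow_val, map_mul, map_zpow₀, hpx]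
    rw [← WithZero.exp_log hf, ← hn, ← WithZero.exp_zsmul, ← WithZero.exp_add]
    simp
  rw [ord_mul, ord_zpow, hp1] at this
  change ord A f = _
  omega

theorem ord_placeAtPrime_of_algebraMap (v : HeightOneSpectrum B) (f : Fˣ) (b : B)
    (hf : (f : F) = algebraMap B F b) : ord (placeAtPrime k F v).ring f =
      (Associates.mk v.asIdeal).count (Associates.mk (Ideal.span {b})).factors := by
  have hb : b ≠ 0 := by rintro rfl; simp at hf
  rw [ord_placeAtPrime, hf, v.valuation_of_algebraMap, v.intValuation_if_neg hb]
  simp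

theorem placeAtPrime_injective : Function.Injective (placeAtPrime (B := B) k F) := by
  intro v w h
  apply HeightOneSpectrum.eq_of_valuation_isEquiv_valuation (K := F)
  rw [Valuation.isEquiv_iff_valuationSubring]
  have := congrArg Place.ring h
  simp only [placeAtPrime] at this
  rwa [HeightOneSpectrum.valuationSubringAtPrime_eq_valuationSubring,
    HeightOneSpectrum.valuationSubringAtPrime_eq_valuationSubring] at this

/-- A place whose ring contains `B` is the localization of `B` at the prime under its maximal
ideal: discrete valuation rings of `F` are maximal proper subrings. -/
theorem exists_placeAtPrime_eq (A : Place k F) (h : ∀ b : B, algebraMap B F b ∈ A.ring) :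
    ∃ v : HeightOneSpectrum B, placeAtPrime k F v = A := by
  let φ : B →+* A.ring := (algebraMap B F).codRestrict A.ring.toSubring h
  let P : Ideal B := (IsLocalRing.maximalIdeal A.ring).comap φ
  have hunit : ∀ s : B, s ∉ P → (algebraMap B F s)⁻¹ ∈ A.ring := by
    intro s hs
    have h1 : IsUnit (φ s) := by
      by_contra hc
      exact hs ((IsLocalRing.mem_maximalIdeal _).2 hc)
    have h2 := (A.ring.valuation_eq_one_iff (φ s)).1 h1
    rw [← A.ring.valuation_le_one_iff, map_inv₀]
    exact (inv_eq_one.2 h2).le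
  have hP : P ≠ ⊥ := by
    intro hP
    apply A.ring_ne_top
    refine eq_top_iff.2 fun x _ => ?_
    obtain ⟨a, s, hs, rfl⟩ := IsFractionRing.div_surjective (A := B) x
    rw [div_eq_mul_inv]
    refine mul_mem (h a) (hunit s ?_)
    rw [hP]
    simpa using nonZeroDivisors.ne_zero hs
  have hPp : P.IsPrime := Ideal.comap_isPrime _ _
  refine ⟨⟨P, hPp, hP⟩, Place.ext ?_⟩
  refine ValuationSubring.eq_of_le_of_ne_top _ ?_ A.ring_ne_top
  rintro x ⟨a, s, hs, rfl⟩
  exact mul_mem (h a) (hunit s hs)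

theorem residueMap_placeAtPrime_finite (v : HeightOneSpectrum B) [Module.Finite k (B ⧸ v.asIdeal)] :
    (placeAtPrime k F v).residueMap.Finite := by
  have : IsLocalization.AtPrime (HeightOneSpectrum.valuationSubringAtPrime F v) v.asIdeal :=
    inferInstanceAs (IsLocalization v.asIdeal.primeCompl _)
  have := v.isMaximal
  let e : (B ⧸ v.asIdeal) ≃+* IsLocalRing.ResidueField (placeAtPrime k F v).ring :=
    IsLocalization.AtPrime.equivQuotMaximalIdeal v.asIdeal
      (HeightOneSpectrum.valuationSubringAtPrime F v)
  have h : (placeAtPrime k F v).residueMap =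
      (e : B ⧸ v.asIdeal →+* _).comp (algebraMap k (B ⧸ v.asIdeal)) := by
    ext c
    refine Eq.trans ?_ (IsLocalization.AtPrime.equivQuotMaximalIdeal_apply_mk v.asIdeal
      (HeightOneSpectrum.valuationSubringAtPrime F v) (algebraMap k B c)).symm
    refine congrArg (IsLocalRing.residue (placeAtPrime k F v).ring) (Subtype.ext ?_)
    exact IsScalarTower.algebraMap_apply k B F c
  rw [h]
  exact (RingHom.Finite.of_surjective _ e.surjective).comp
    (RingHom.finite_algebraMap.2 inferInstance)

/-- The residue field at `v` is `B ⧸ v`, so that the norm of the residue of an element of `B` prime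
to `v` is its norm on `B ⧸ v`. -/
theorem unitsNorm_residue_placeAtPrime (v : HeightOneSpectrum B) (f : Fˣ) (b : B)
    (hf : (f : F) = algebraMap B F b) (hu : f ∈ (placeAtPrime k F v).ring.unitGroup) :
    (unitsNorm (placeAtPrime k F v).residueMap
      ((placeAtPrime k F v).ring.unitGroupToResidueFieldUnits ⟨f, hu⟩) : k) =
      quotientNorm k b v.asIdeal := by
  have : IsLocalization.AtPrime (HeightOneSpectrum.valuationSubringAtPrime F v) v.asIdeal :=
    inferInstanceAs (IsLocalization v.asIdeal.primeCompl _)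
  have := v.isMaximal
  let e := IsLocalization.AtPrime.equivQuotMaximalIdeal v.asIdeal
    (HeightOneSpectrum.valuationSubringAtPrime F v)
  let _ := (placeAtPrime k F v).residueMap.toAlgebra
  let e' : (B ⧸ v.asIdeal) ≃ₐ[k] IsLocalRing.ResidueField (placeAtPrime k F v).ring :=
    AlgEquiv.ofRingEquiv (f := e) (fun c => by
      change e (Ideal.Quotient.mk _ (algebraMap k B c)) = _
      rw [IsLocalization.AtPrime.equivQuotMaximalIdeal_apply_mk]
      refine congrArg (IsLocalRing.residue (placeAtPrime k F v).ring) (Subtype.ext ?_)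
      exact (IsScalarTower.algebraMap_apply k B F c).symm)
  rw [quotientNorm, ← Algebra.norm_eq_of_algEquiv e']
  change Algebra.norm k _ = _
  congr 1
  rw [ValuationSubring.coe_unitGroupToResidueFieldUnits_apply]
  change _ = e (Ideal.Quotient.mk _ b)
  rw [IsLocalization.AtPrime.equivQuotMaximalIdeal_apply_mk]
  exact congrArg (IsLocalRing.residue (placeAtPrime k F v).ring) (Subtype.ext hf)

end AtPrime

section AtPrime
open IsDedekindDomain

namespace Place
variable {k F : Type u} [Field k] [Field F] [Algebra k F]

theorem symbol_of_mem_unitGroup (A : Place k F) {f : Fˣ} (hf : f ∈ A.ring.unitGroup) (g : Fˣ) :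
    A.symbol f g =
      unitsNorm A.residueMap (A.ring.unitGroupToResidueFieldUnits ⟨f, hf⟩) ^ ord A.ring g := by
  rw [symbol, ← map_zpow, ← map_zpow]
  congr 1
  refine tameSymbol_of_eq _ (zpow_mem hf _) ?_
  simp [tameElement, ord_eq_zero_of_mem_unitGroup A.ring hf]

end Place

variable {k B F : Type u} [Field k] [CommRing B] [IsDedekindDomain B] [Algebra k B]
  [Field F] [Algebra B F] [IsFractionRing B F] [Algebra k F] [IsScalarTower k B F]

variable (k B F) in
/-- The places whose ring contains a given ring `B`. -/
def placesOver (B : Type u) [CommRing B] [Algebra B F] : Set (Place k F) :=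
  {A | ∀ b : B, algebraMap B F b ∈ A.ring}

theorem placeAtPrime_mem_placesOver (v : HeightOneSpectrum B) :
    placeAtPrime k F v ∈ placesOver k F B :=
  algebraMap_mem_valuationSubringAtPrime v

theorem finite_dvd {a : B} (ha : a ≠ 0) :
    {v : HeightOneSpectrum B | Ideal.span {a} ≤ v.asIdeal}.Finite := by
  have : Ideal.span {a} ≠ 0 := by simpa using ha
  simpa only [Ideal.dvd_iff_le] using Ideal.finite_factors this

theorem ord_placeAtPrime_ne_zero_iff (v : HeightOneSpectrum B) (f : Fˣ) (b : B)
    (hf : (f : F) = algebraMap B F b) :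
    ord (placeAtPrime k F v).ring f ≠ 0 ↔ Ideal.span {b} ≤ v.asIdeal := by
  have hb : b ≠ 0 := by rintro rfl; simp at hf
  rw [ord_placeAtPrime_of_algebraMap v f b hf, ← Ideal.dvd_iff_le]
  rw [Nat.cast_ne_zero]
  exact Associates.count_ne_zero_iff_dvd (by simpa using hb) v.irreducible

theorem setOf_ord_ne_zero_eq_image (f : Fˣ) (b : B) (hf : (f : F) = algebraMap B F b) :
    {A ∈ placesOver k F B | ord A.ring f ≠ 0} =
      placeAtPrime k F '' {v : HeightOneSpectrum B | Ideal.span {b} ≤ v.asIdeal} := by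
  ext A
  constructor
  · rintro ⟨hA, hAf⟩
    obtain ⟨v, rfl⟩ := exists_placeAtPrime_eq A hA
    exact ⟨v, (ord_placeAtPrime_ne_zero_iff v f b hf).1 hAf, rfl⟩
  · rintro ⟨v, hv, rfl⟩
    exact ⟨placeAtPrime_mem_placesOver v, (ord_placeAtPrime_ne_zero_iff v f b hf).2 hv⟩

variable (B) in
theorem finite_setOf_ord_ne_zero_placesOver (f : Fˣ) :
    {A ∈ placesOver k F B | ord A.ring f ≠ 0}.Finite := by
  obtain ⟨a, s, hs, hfs⟩ := IsFractionRing.div_surjective (A := B) (f : F)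
  have hs0 : s ≠ 0 := nonZeroDivisors.ne_zero hs
  have ha0 : a ≠ 0 := by
    rintro rfl
    rw [map_zero, zero_div] at hfs
    exact f.ne_zero hfs.symm
  have hinj := FaithfulSMul.algebraMap_injective B F
  set α : Fˣ := Units.mk0 (algebraMap B F a) (by simpa using ha0)
  set σ : Fˣ := Units.mk0 (algebraMap B F s) (by simpa using hs0)
  have hf : f = α / σ := Units.ext (by simp [α, σ, hfs])
  have h1 := (finite_dvd ha0).image (placeAtPrime k F)
  have h2 := (finite_dvd hs0).image (placeAtPrime k F)
  rw [← setOf_ord_ne_zero_eq_image α a rfl] at h1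
  rw [← setOf_ord_ne_zero_eq_image σ s rfl] at h2
  refine (h1.union h2).subset ?_
  rintro A ⟨hA, hAf⟩
  by_contra hc
  simp only [Set.mem_union, Set.mem_ofPred_eq, not_or, not_and, not_not] at hc
  apply hAf
  rw [hf, ord_div, hc.1 hA, hc.2 hA, sub_zero]

/-- The norm of `b` on `B ⧸ (a)` is a product of symbols over the places at which `b` is a unit. -/
theorem finprod_symbol_eq_quotientNorm
    (hfin : ∀ J : Ideal B, J ≠ ⊥ → Module.Finite k (B ⧸ J)) (a b : B) (α β : Fˣ)
    (hα : (α : F) = algebraMap B F a) (hβ : (β : F) = algebraMap B F b)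
    (hab : ∀ A ∈ placesOver k F B, ord A.ring α ≠ 0 → ord A.ring β = 0) :
    ((∏ᶠ A ∈ {A ∈ placesOver k F B | ord A.ring β = 0}, A.symbol β α : kˣ) : k) =
      quotientNorm k b (Ideal.span {a}) := by
  classical
  have ha : a ≠ 0 := by rintro rfl; simp at hα
  have hT := finite_dvd ha
  have himg := setOf_ord_ne_zero_eq_image (k := k) α a hα
  rw [quotientNorm_eq_prod b hfin _ (by simpa using ha) hT.toFinset (by simp)]
  rw [finprod_mem_eq_prod_of_subset (t := hT.toFinset.image (placeAtPrime k F))]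
  · rw [Finset.prod_image fun v _ w _ h => placeAtPrime_injective h, Units.coe_prod]
    refine Finset.prod_congr rfl fun v hv => ?_
    have hmem : placeAtPrime k F v ∈ {A ∈ placesOver k F B | ord A.ring α ≠ 0} := by
      rw [himg]; exact ⟨v, by simpa using hv, rfl⟩
    have hu := mem_unitGroup_of_ord_eq_zero _ (hab _ hmem.1 hmem.2)
    rw [Place.symbol_of_mem_unitGroup _ hu, ord_placeAtPrime_of_algebraMap v α a hα,
      zpow_natCast, Units.val_pow_eq_pow_val, unitsNorm_residue_placeAtPrime v β b hβ hu]
  · rintro A ⟨⟨hA, hAb⟩, hAs⟩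
    have : A ∈ {A ∈ placesOver k F B | ord A.ring α ≠ 0} :=
      ⟨hA, fun h => hAs (A.symbol_eq_one hAb h)⟩
    rw [himg] at this
    simpa using this
  · intro A hA
    have : A ∈ {A ∈ placesOver k F B | ord A.ring α ≠ 0} := by
      rw [himg]; simpa using hA
    exact ⟨this.1, hab _ this.1 this.2⟩

end AtPrime

/-! ### Reduction of bases and determinants -/

section Reduction
variable {k R M N : Type*} [Field k] [CommRing R] [AddCommGroup M] [Module R M]
  [AddCommGroup N] [Module k N] {ρ : R →+* k} (p : M →ₛₗ[ρ] N)
  {ι : Type*} [Fintype ι] [DecidableEq ι]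

omit [DecidableEq ι] in
/-- The image of a basis under reduction modulo the kernel of `ρ` is a basis. -/
theorem exists_basis_reduction (hρ : Function.Surjective ρ) (hp : Function.Surjective p)
    (hker : ∀ x, p x = 0 → x ∈ RingHom.ker ρ • (⊤ : Submodule R M)) (b : Module.Basis ι R M) :
    ∃ b' : Module.Basis ι k N, ∀ i, b' i = p (b i) := by
  have hli : LinearIndependent k fun i => p (b i) := by
    rw [Fintype.linearIndependent_iff]
    intro g hg i
    choose r hr using fun i => hρ (g i)
    have h1 : p (∑ i, r i • b i) = 0 := by
      rw [map_sum, ← hg]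
      exact Finset.sum_congr rfl fun i _ => by rw [p.map_smulₛₗ, hr]
    have h2 : b.repr (∑ i, r i • b i) i ∈ RingHom.ker ρ := by
      have h3 : ∀ x ∈ RingHom.ker ρ • (⊤ : Submodule R M), b.repr x i ∈ RingHom.ker ρ := by
        intro x hx
        refine Submodule.smul_induction_on hx ?_ ?_
        · intro s hs y _
          simpa using (RingHom.ker ρ).mul_mem_right _ hs
        · intro x y hx hy
          simpa using add_mem hx hy
      exact h3 _ (hker _ h1)
    rw [Module.Basis.repr_sum_self] at h2
    rw [← hr]; exact h2
  have hsp : ⊤ ≤ Submodule.span k (Set.range fun i => p (b i)) := by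
    intro y _
    obtain ⟨x, rfl⟩ := hp y
    rw [← b.sum_repr x, map_sum]
    refine sum_mem fun i _ => ?_
    rw [p.map_smulₛₗ]
    exact Submodule.smul_mem _ _ (Submodule.subset_span ⟨i, rfl⟩)
  exact ⟨Module.Basis.mk hli hsp, fun i => by simp⟩

theorem repr_reduction (b : Module.Basis ι R M) (b' : Module.Basis ι k N)
    (hb : ∀ i, b' i = p (b i)) (x : M) (i : ι) : b'.repr (p x) i = ρ (b.repr x i) := by
  conv_lhs => rw [← b.sum_repr x]
  simp only [map_sum, p.map_smulₛₗ, ← hb, map_smul]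
  simp [Finsupp.single_apply]

/-- The determinant of an endomorphism reduces to the determinant of the reduced endomorphism. -/
theorem map_det_reduction (b : Module.Basis ι R M) (b' : Module.Basis ι k N)
    (hb : ∀ i, b' i = p (b i)) (φ : M →ₗ[R] M) (ψ : N →ₗ[k] N) (h : ∀ i, p (φ (b i)) = ψ (b' i)) :
    ρ (LinearMap.det φ) = LinearMap.det ψ := by
  rw [← LinearMap.det_toMatrix b, ← LinearMap.det_toMatrix b', RingHom.map_det]
  congr 1
  ext i j
  rw [RingHom.mapMatrix_apply, Matrix.map_apply, LinearMap.toMatrix_apply, LinearMap.toMatrix_apply,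
    ← h, repr_reduction p b b' hb]

/-- A lift of a basis of the reduction is a basis when `R` is local with residue field `k`: the
determinant with respect to any basis is a unit. -/
theorem exists_basis_lift [Module.Free R M] [Module.Finite R M] [IsDomain R]
    (hρ : Function.Surjective ρ) (hunit : ∀ r, ρ r ≠ 0 → IsUnit r) (hp : Function.Surjective p)
    (hker : ∀ x, p x = 0 → x ∈ RingHom.ker ρ • (⊤ : Submodule R M))
    (b' : Module.Basis ι k N) (v : ι → M) (hv : ∀ i, p (v i) = b' i) :
    ∃ b : Module.Basis ι R M, ∀ i, b i = v i := by
  obtain ⟨e'', he''⟩ := exists_basis_reduction p hρ hp hker (Module.Free.chooseBasis R M)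
  let e : Module.Basis ι R M := (Module.Free.chooseBasis R M).reindex (e''.indexEquiv b')
  obtain ⟨e', he'⟩ := exists_basis_reduction p hρ hp hker e
  have hdet : IsUnit (e.det v) := by
    apply hunit
    have : ρ (e.det v) = e'.det b' := by
      rw [Module.Basis.det_apply, Module.Basis.det_apply, RingHom.map_det]
      congr 1
      ext i j
      rw [RingHom.mapMatrix_apply, Matrix.map_apply, Module.Basis.toMatrix_apply,
        Module.Basis.toMatrix_apply, ← hv, repr_reduction p e e' he']
    rw [this]
    exact (e'.isUnit_det b').ne_zero
  obtain ⟨hli, hsp⟩ := (Module.Basis.is_basis_iff_det e).2 hdet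
  exact ⟨Module.Basis.mk hli hsp.ge, fun i => by simp⟩

end Reduction

/-! ### Quotients by products of elements -/

section Quotient
variable {k B : Type*} [Field k] [CommRing B] [Algebra k B]

variable (k) in
/-- Multiplication by `a` as a map from `B ⧸ (b)` to `B ⧸ (a * b)`. -/
noncomputable def mulQuotient {a b d : B} (h : d = a * b) :
    (B ⧸ Ideal.span {b}) →ₗ[k] (B ⧸ Ideal.span {d}) :=
  (Submodule.mapQ (Ideal.span {b}) (Ideal.span {d}) (LinearMap.toSpanSingleton B B a)
    (fun c hc => by
      obtain ⟨e, rfl⟩ := Ideal.mem_span_singleton.1 hc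
      exact Ideal.mem_span_singleton.2 ⟨e, by simp [h]; ring⟩)).restrictScalars k

theorem mulQuotient_mk {a b d : B} (h : d = a * b) (x : B) :
    mulQuotient k h (Ideal.Quotient.mk _ x) = Ideal.Quotient.mk _ (a * x) :=
  congrArg (Ideal.Quotient.mk _) (mul_comm x a)

variable (k) in
/-- The projection from `B ⧸ (a * b)` to `B ⧸ (a)`. -/
noncomputable def projQuotient {a b d : B} (h : d = a * b) :
    (B ⧸ Ideal.span {d}) →ₗ[k] (B ⧸ Ideal.span {a}) :=
  (Ideal.Quotient.factorₐ k (Ideal.span_singleton_le_span_singleton.2 ⟨b, h⟩)).toLinearMap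

theorem projQuotient_mk {a b d : B} (h : d = a * b) (x : B) :
    projQuotient k h (Ideal.Quotient.mk _ x) = Ideal.Quotient.mk _ x := rfl

theorem mulQuotient_injective [IsDomain B] {a b d : B} (h : d = a * b) (ha : a ≠ 0) :
    Function.Injective (mulQuotient k h) := by
  refine (injective_iff_map_eq_zero _).2 fun x hx => ?_
  obtain ⟨c, rfl⟩ := Ideal.Quotient.mk_surjective x
  rw [mulQuotient_mk, Ideal.Quotient.eq_zero_iff_mem, Ideal.mem_span_singleton, h,
    mul_dvd_mul_iff_left ha, ← Ideal.mem_span_singleton] at hx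
  exact Ideal.Quotient.eq_zero_iff_mem.2 hx

theorem projQuotient_surjective {a b d : B} (h : d = a * b) :
    Function.Surjective (projQuotient k h) := by
  intro x
  obtain ⟨c, rfl⟩ := Ideal.Quotient.mk_surjective x
  exact ⟨Ideal.Quotient.mk _ c, rfl⟩

theorem mulQuotient_exact {a b d : B} (h : d = a * b) :
    Function.Exact (mulQuotient k h) (projQuotient k h) := by
  intro x
  obtain ⟨c, rfl⟩ := Ideal.Quotient.mk_surjective x
  rw [projQuotient_mk, Ideal.Quotient.eq_zero_iff_mem, Ideal.mem_span_singleton]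
  constructor
  · rintro ⟨e, rfl⟩
    exact ⟨Ideal.Quotient.mk _ e, mulQuotient_mk _ _⟩
  · rintro ⟨y, hy⟩
    obtain ⟨e, rfl⟩ := Ideal.Quotient.mk_surjective y
    rw [mulQuotient_mk, Ideal.Quotient.eq, Ideal.mem_span_singleton, h] at hy
    have h1 : a ∣ a * e - c := (dvd_mul_right a b).trans hy
    exact (dvd_sub_right (dvd_mul_right a e)).1 h1

theorem finite_quotient_mul (a b : B) [Module.Finite k (B ⧸ Ideal.span {a})]
    [Module.Finite k (B ⧸ Ideal.span {b})] : Module.Finite k (B ⧸ Ideal.span {a * b}) :=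
  Module.Finite.of_exact (mulQuotient_exact (k := k) (a := a) (b := b) rfl)
    (projQuotient_surjective rfl)

theorem finrank_quotient_mul [IsDomain B] {a : B} (ha : a ≠ 0) (b : B)
    [Module.Finite k (B ⧸ Ideal.span {a})]
    [Module.Finite k (B ⧸ Ideal.span {b})] :
    Module.finrank k (B ⧸ Ideal.span {a * b}) =
      Module.finrank k (B ⧸ Ideal.span {a}) + Module.finrank k (B ⧸ Ideal.span {b}) := by
  have := finite_quotient_mul (k := k) a b
  have h1 := (projQuotient k (a := a) (b := b) rfl).finrank_range_add_finrank_ker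
  rw [LinearMap.range_eq_top.2 (projQuotient_surjective rfl), finrank_top,
    (mulQuotient_exact (k := k) rfl).linearMap_ker_eq,
    LinearMap.finrank_range_of_inj (mulQuotient_injective rfl ha)] at h1
  exact h1.symm

theorem finite_quotient_pow (a : B) [Module.Finite k (B ⧸ Ideal.span {a})] (n : ℕ) :
    Module.Finite k (B ⧸ Ideal.span {a ^ n}) := by
  induction n with
  | zero =>
    have : Subsingleton (B ⧸ Ideal.span {a ^ 0}) := Ideal.Quotient.subsingleton_iff.2 (by simp)
    infer_instance
  | succ n ih => rw [pow_succ']; exact finite_quotient_mul _ _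

theorem finrank_quotient_pow [IsDomain B] {a : B} (ha : a ≠ 0)
    [Module.Finite k (B ⧸ Ideal.span {a})] (n : ℕ) :
    Module.finrank k (B ⧸ Ideal.span {a ^ n}) = n * Module.finrank k (B ⧸ Ideal.span {a}) := by
  induction n with
  | zero =>
    have : Subsingleton (B ⧸ Ideal.span {a ^ 0}) := Ideal.Quotient.subsingleton_iff.2 (by simp)
    simp [Module.finrank_zero_of_subsingleton]
  | succ n ih =>
    have := finite_quotient_pow (k := k) a n
    rw [pow_succ', finrank_quotient_mul ha, ih]; ring

end Quotient

section Filtration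
variable {k B : Type*} [Field k] [CommRing B] [Algebra k B]
  {ι κ : Type*}

/-- The generators of `B ⧸ (π ^ n * c)` built from generators `x` of `B ⧸ (π)` and `y` of
`B ⧸ (c)`. -/
def chainFamily (π : B) (x : ι → B) (y : κ → B) (n : ℕ) : (Fin n × ι) ⊕ κ → B
  | Sum.inl (i, j) => π ^ (i : ℕ) * x j
  | Sum.inr l => π ^ n * y l

/-- Expand a residue modulo `π ^ n * c` in powers of `π`: the first `n` digits are combinations of
the `x`, the remainder is a combination of the `y`. -/
theorem exists_span_chainFamily (π c : B) (x : ι → B) (y : κ → B)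
    (hx : ∀ b, ∃ s ∈ Submodule.span k (Set.range x), π ∣ b - s)
    (hy : ∀ b, ∃ s ∈ Submodule.span k (Set.range y), c ∣ b - s) (n : ℕ) (b : B) :
    ∃ s ∈ Submodule.span k (Set.range (chainFamily π x y n)), π ^ n * c ∣ b - s := by
  induction n generalizing b with
  | zero =>
    obtain ⟨s, hs, h⟩ := hy b
    refine ⟨s, Submodule.span_mono ?_ hs, by simpa using h⟩
    rintro _ ⟨l, rfl⟩
    exact ⟨Sum.inr l, by simp [chainFamily]⟩
  | succ n ih =>
    obtain ⟨s, hs, d, hd⟩ := hx b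
    obtain ⟨r, hr, e, he⟩ := ih d
    refine ⟨s + π * r, add_mem (Submodule.span_mono ?_ hs) ?_, e, ?_⟩
    · rintro _ ⟨j, rfl⟩
      exact ⟨Sum.inl (0, j), by simp [chainFamily]⟩
    · have : ∀ r ∈ Submodule.span k (Set.range (chainFamily π x y n)),
          π * r ∈ Submodule.span k (Set.range (chainFamily π x y (n + 1))) := by
        intro r hr
        induction hr using Submodule.span_induction with
        | mem r hr =>
          obtain ⟨(⟨i, j⟩ | l), rfl⟩ := hr
          · exact Submodule.subset_span ⟨Sum.inl (i.succ, j), by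
              simp [chainFamily, pow_succ', mul_assoc]⟩
          · exact Submodule.subset_span ⟨Sum.inr l, by simp [chainFamily, pow_succ', mul_assoc]⟩
        | zero => simp
        | add a b _ _ ha hb => rw [mul_add]; exact add_mem ha hb
        | smul a b _ hb => rw [mul_smul_comm]; exact Submodule.smul_mem _ _ hb
      exact this r hr
    · have h1 : b - (s + π * r) = (b - s) - π * r := by ring
      rw [h1, hd, ← mul_sub, he]; ring

end Filtration

/-! ### The norm of a prime element -/

section PrimeNorm
variable {k R B : Type*} [Field k] [CommRing R] [Algebra k R]
  [CommRing B] [Algebra R B] [Algebra k B] [IsScalarTower k R B]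

/-- Reduction modulo `t` is semilinear with respect to the reduction `R → k`. -/
noncomputable def reduction (ρ : R →ₐ[k] k) (t : R) (hρ : RingHom.ker ρ = Ideal.span {t}) :
    B →ₛₗ[(ρ : R →+* k)] (B ⧸ Ideal.span {algebraMap R B t}) where
  toFun := Ideal.Quotient.mk _
  map_add' := map_add _
  map_smul' r x := by
    have h1 : r - algebraMap k R (ρ r) ∈ RingHom.ker ρ := by
      rw [RingHom.mem_ker, map_sub, AlgHom.commutes]; simp
    rw [hρ] at h1
    obtain ⟨d, hd⟩ := Ideal.mem_span_singleton.1 h1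
    have h2 : Ideal.Quotient.mk (Ideal.span {algebraMap R B t}) (r • x) =
        Ideal.Quotient.mk _ ((ρ r) • x) := by
      rw [Ideal.Quotient.eq, Ideal.mem_span_singleton]
      refine ⟨algebraMap R B d * x, ?_⟩
      rw [Algebra.smul_def, Algebra.smul_def, IsScalarTower.algebraMap_apply k R B, ← sub_mul,
        ← map_sub, hd, map_mul]; ring
    exact h2

theorem reduction_apply (ρ : R →ₐ[k] k) (t : R) (hρ : RingHom.ker ρ = Ideal.span {t}) (b : B) :
    reduction ρ t hρ b = Ideal.Quotient.mk _ b := rfl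

theorem reduction_surjective (ρ : R →ₐ[k] k) (t : R) (hρ : RingHom.ker ρ = Ideal.span {t}) :
    Function.Surjective (reduction (B := B) ρ t hρ) := Ideal.Quotient.mk_surjective

theorem mem_smul_of_reduction_eq_zero (ρ : R →ₐ[k] k) (t : R)
    (hρ : RingHom.ker ρ = Ideal.span {t}) (x : B) (hx : reduction ρ t hρ x = 0) :
    x ∈ RingHom.ker (ρ : R →+* k) • (⊤ : Submodule R B) := by
  rw [reduction_apply, Ideal.Quotient.eq_zero_iff_mem, Ideal.mem_span_singleton] at hx
  obtain ⟨d, rfl⟩ := hx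
  rw [← Algebra.smul_def]
  refine Submodule.smul_mem_smul ?_ trivial
  have : t ∈ RingHom.ker ρ := by rw [hρ]; exact Ideal.mem_span_singleton_self t
  exact this

theorem map_norm_eq_quotientNorm [Module.Free R B] [Module.Finite R B] (ρ : R →ₐ[k] k) (t : R)
    (hρ : RingHom.ker ρ = Ideal.span {t}) (b : B) :
    ρ (Algebra.norm R b) = quotientNorm k b (Ideal.span {algebraMap R B t}) := by
  classical
  have hs : Function.Surjective (ρ : R →+* k) := fun c => ⟨algebraMap k R c, ρ.commutes c⟩
  obtain ⟨b', hb'⟩ := exists_basis_reduction (reduction (B := B) ρ t hρ) hs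
    (reduction_surjective ρ t hρ) (mem_smul_of_reduction_eq_zero ρ t hρ)
    (Module.Free.chooseBasis R B)
  refine map_det_reduction (reduction (B := B) ρ t hρ) (Module.Free.chooseBasis R B) b' hb' _ _ ?_
  intro i
  rw [hb', reduction_apply, reduction_apply]
  exact map_mul _ _ _

/-- The norm of a prime element `π` with `t = π ^ (n + 1) * c`: its order at `t` and its leading
coefficient. The multiplication by `π` is written in an `R`-basis `π ^ i * x j` (`i ≤ n`),
`π ^ (n + 1) * y l`, where `x` lifts a basis of `B ⧸ (π)` and `y` one of `B ⧸ (c)`. -/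
theorem norm_prime [IsDomain R] [IsDomain B] [Module.Free R B] [Module.Finite R B]
    (ρ : R →ₐ[k] k) (t : R) (hρ : RingHom.ker ρ = Ideal.span {t}) (hunit : ∀ r, ρ r ≠ 0 → IsUnit r)
    (π c : B) (n : ℕ) (ht : algebraMap R B t = π ^ (n + 1) * c) (hπ0 : π ≠ 0)
    (hcop : IsCoprime π c)
    [Module.Finite k (B ⧸ Ideal.span {π})] [Module.Finite k (B ⧸ Ideal.span {c})] :
    ∃ h : R, Algebra.norm R π = t ^ Module.finrank k (B ⧸ Ideal.span {π}) * h ∧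
      ρ h * quotientNorm k c (Ideal.span {π}) =
        (-1) ^ (n * Module.finrank k (B ⧸ Ideal.span {π})) * quotientNorm k π (Ideal.span {c}) := by
  classical
  set m := Module.finrank k (B ⧸ Ideal.span {π}) with hm
  -- `u` is an inverse of `c` modulo `π`
  obtain ⟨w, u, hu⟩ := hcop
  have huc : Ideal.Quotient.mk (Ideal.span {π}) (u * c) = 1 := by
    rw [← map_one (Ideal.Quotient.mk (Ideal.span {π})), Ideal.Quotient.eq,
      Ideal.mem_span_singleton]
    exact ⟨-w, by linear_combination hu⟩
  let ex := Module.finBasis k (B ⧸ Ideal.span {π})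
  let ey := Module.finBasis k (B ⧸ Ideal.span {c})
  choose x' hx' using fun j => Ideal.Quotient.mk_surjective (ex j)
  choose y hy using fun l => Ideal.Quotient.mk_surjective (ey l)
  -- the lifts `x` of the basis of `B ⧸ (π)` are multiples `c * z j`, so that
  -- `π * (π ^ n * x j) = t * z j`
  let z : Fin m → B := fun j => u * x' j
  let x : Fin m → B := fun j => c * z j
  have hx : ∀ j, Ideal.Quotient.mk (Ideal.span {π}) (x j) = ex j := by
    intro j
    rw [← hx', ← one_mul (Ideal.Quotient.mk _ (x' j)), ← huc, ← map_mul]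
    congr 1
    simp only [x, z]; ring
  have hgen : ∀ (a : B) {ι : Type} [Fintype ι] (e : Module.Basis ι k (B ⧸ Ideal.span {a}))
      (v : ι → B), (∀ i, Ideal.Quotient.mk _ (v i) = e i) →
      ∀ b, ∃ s ∈ Submodule.span k (Set.range v), a ∣ b - s := by
    intro a ι _ e v hv b
    refine ⟨∑ i, e.repr (Ideal.Quotient.mk _ b) i • v i,
      sum_mem fun i _ => Submodule.smul_mem _ _ (Submodule.subset_span ⟨i, rfl⟩), ?_⟩
    rw [← Ideal.mem_span_singleton, ← Ideal.Quotient.eq]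
    conv_lhs => rw [← e.sum_repr (Ideal.Quotient.mk _ b)]
    rw [map_sum]
    refine Finset.sum_congr rfl fun i _ => ?_
    rw [← hv]; rfl
  have hspan := fun n b => exists_span_chainFamily (k := k) π c x y (hgen π ex x hx)
    (hgen c ey y hy) n b
  -- the basis of the reduction and its lift
  let I : Ideal B := Ideal.span {algebraMap R B t}
  let p := reduction (B := B) ρ t hρ
  have hs : Function.Surjective (ρ : R →+* k) := fun c => ⟨algebraMap k R c, ρ.commutes c⟩
  let v := chainFamily π x y (n + 1)
  let pk : B →ₗ[k] (B ⧸ I) := (Ideal.Quotient.mkₐ k I).toLinearMap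
  have hpk : ∀ b, p b = pk b := fun b => rfl
  have hpk0 : ∀ b, π ^ (n + 1) * c ∣ b → pk b = 0 := by
    intro b hb
    exact Ideal.Quotient.eq_zero_iff_mem.2 (Ideal.mem_span_singleton.2 (ht ▸ hb))
  have hfinpow := finite_quotient_pow (k := k) π (n + 1)
  have hI : I = Ideal.span {π ^ (n + 1) * c} := by simp only [I]; rw [ht]
  have hfinI : Module.Finite k (B ⧸ I) := by
    rw [hI]; exact finite_quotient_mul _ _
  have hsp : ⊤ ≤ Submodule.span k (Set.range (pk ∘ v)) := by
    intro q _
    obtain ⟨b, rfl⟩ := Ideal.Quotient.mk_surjective q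
    obtain ⟨s, hs, hd⟩ := hspan (n + 1) b
    have h1 : pk b = pk s := by
      rw [← sub_eq_zero, ← map_sub]; exact hpk0 _ hd
    change pk b ∈ _
    rw [h1, Set.range_comp, ← Submodule.map_span]
    exact Submodule.mem_map_of_mem hs
  have hcard : Fintype.card ((Fin (n + 1) × Fin m) ⊕
      Fin (Module.finrank k (B ⧸ Ideal.span {c}))) = Module.finrank k (B ⧸ I) := by
    rw [hI, finrank_quotient_mul (pow_ne_zero _ hπ0), finrank_quotient_pow hπ0]
    simp [hm]
  let b' := basisOfTopLeSpanOfCardEqFinrank (pk ∘ v) hsp hcard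
  have hb' : ∀ i, b' i = pk (v i) := fun i => by simp [b']
  obtain ⟨b, hb⟩ := exists_basis_lift p hs hunit (reduction_surjective ρ t hρ)
    (mem_smul_of_reduction_eq_zero ρ t hρ) b' v (fun i => (hb' i).symm)
  have hbl : ∀ i j, b (Sum.inl (i, j)) = π ^ (i : ℕ) * x j := fun i j => hb _
  have hbr : ∀ l, b (Sum.inr l) = π ^ (n + 1) * y l := fun l => hb _
  -- Multiplication by `π` sends `π ^ i * x j` to `π ^ (i + 1) * x j` for `i < n`, to `t * z j` for
  -- `i = n`, and `π ^ (n + 1) * y l` to `π * π ^ (n + 1) * y l`. It is the composite of the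
  -- diagonal map `Δ` with entries `t` at `i = n`, the cyclic shift `S` of the index `i`, and a
  -- map `U`.
  let d : (Fin (n + 1) × Fin m) ⊕ Fin (Module.finrank k (B ⧸ Ideal.span {c})) → R :=
    Sum.elim (fun a => if a.1 = Fin.last n then t else 1) (fun _ => 1)
  let Δ : B →ₗ[R] B := b.constr R fun i => d i • b i
  let σ : Equiv.Perm ((Fin (n + 1) × Fin m) ⊕ Fin (Module.finrank k (B ⧸ Ideal.span {c}))) :=
    Equiv.Perm.sumCongr (Equiv.prodCongrLeft fun _ => finRotate (n + 1)) 1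
  let S : B →ₗ[R] B := b.constr R fun i => b (σ i)
  let U : B →ₗ[R] B := b.constr R (Sum.elim
    (fun a => if a.1 = 0 then z a.2 else π ^ (a.1 : ℕ) * x a.2) (fun l => π * (π ^ (n + 1) * y l)))
  have hcomp : LinearMap.mulLeft R π = U ∘ₗ S ∘ₗ Δ := by
    refine b.ext ?_
    have h1 : ∀ i, (U ∘ₗ S ∘ₗ Δ) (b i) = d i • U (b (σ i)) := fun i => by
      simp only [LinearMap.comp_apply, Δ, S, b.constr_basis, map_smul]
    rintro (⟨i, j⟩ | l)
    · rw [h1, LinearMap.mulLeft_apply, hbl]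
      have h2 : σ (Sum.inl (i, j)) = Sum.inl (i + 1, j) := by
        simp [σ]
      rw [h2]
      simp only [U, b.constr_basis, Sum.elim_inl, d]
      induction i using Fin.lastCases with
      | last =>
        simp only [Fin.last_add_one, if_true, Fin.val_last, Algebra.smul_def, ht, x]
        ring
      | cast i =>
        rw [if_neg (Fin.castSucc_lt_last i).ne, Fin.coeSucc_eq_succ, if_neg (Fin.succ_ne_zero i),
          one_smul, Fin.val_succ, Fin.val_castSucc]
        ring
    · rw [h1, LinearMap.mulLeft_apply, hbr]
      simp [σ, d, U, b.constr_basis]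
  have hdetb : ∀ φ : B →ₗ[R] B, LinearMap.det φ = b.det (φ ∘ b) := fun φ => by
    rw [Module.Basis.det_comp, b.det_self, mul_one]
  have hΔ : LinearMap.det Δ = t ^ m := by
    have h1 : Δ ∘ b = fun i => d i • b i := funext fun i => b.constr_basis _ _ i
    rw [hdetb, h1, AlternatingMap.map_smul_univ, b.det_self, smul_eq_mul, mul_one,
      Fintype.prod_sum_type, Fintype.prod_prod_type]
    have h2 : ∀ i, ∏ j, d (Sum.inl (i, j)) = if i = Fin.last n then t ^ m else 1 := by
      intro i
      by_cases hi : i = Fin.last n <;> simp [d, hi]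
    have h3 : ∀ l, d (Sum.inr l) = 1 := fun l => rfl
    simp [h2, h3]
  have hS : LinearMap.det S = (-1) ^ (n * m) := by
    have h1 : S ∘ b = b ∘ σ := funext fun i => b.constr_basis _ _ i
    rw [hdetb, h1, AlternatingMap.map_perm, b.det_self]
    simp [σ, Equiv.Perm.sign_sumCongr, Equiv.Perm.sign_prodCongrLeft, sign_finRotate, pow_mul,
      Units.smul_def]
  -- The reduction of `U` is the composite of `U₁`, which replaces `x j` by `z j` at `i = 0`, and
  -- `U₂`, which multiplies `π ^ (n + 1) * y l` by `π`. Each preserves a two-step filtration.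
  let U₁ : (B ⧸ I) →ₗ[k] (B ⧸ I) := b'.constr k (Sum.elim
    (fun a => pk (if a.1 = 0 then z a.2 else π ^ (a.1 : ℕ) * x a.2))
    (fun l => pk (π ^ (n + 1) * y l)))
  let U₂ : (B ⧸ I) →ₗ[k] (B ⧸ I) := b'.constr k (Sum.elim
    (fun a => pk (π ^ (a.1 : ℕ) * x a.2)) (fun l => pk (π * (π ^ (n + 1) * y l))))
  have hU₁l : ∀ i j, U₁ (b' (Sum.inl (i, j))) = pk (if i = 0 then z j else π ^ (i : ℕ) * x j) :=
    fun i j => b'.constr_basis _ _ _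
  have hU₁r : ∀ l, U₁ (b' (Sum.inr l)) = pk (π ^ (n + 1) * y l) := fun l => b'.constr_basis _ _ _
  have hU₂l : ∀ i j, U₂ (b' (Sum.inl (i, j))) = pk (π ^ (i : ℕ) * x j) :=
    fun i j => b'.constr_basis _ _ _
  have hU₂r : ∀ l, U₂ (b' (Sum.inr l)) = pk (π * (π ^ (n + 1) * y l)) :=
    fun l => b'.constr_basis _ _ _
  have hbl' : ∀ i j, b' (Sum.inl (i, j)) = pk (π ^ (i : ℕ) * x j) := fun i j => hb' _
  have hbr' : ∀ l, b' (Sum.inr l) = pk (π ^ (n + 1) * y l) := fun l => hb' _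
  have hU₁π : ∀ q : B, U₁ (pk (π * q)) = pk (π * q) := by
    intro q
    obtain ⟨s, hs, e, he⟩ := hspan n q
    have h1 : pk (π * q) = pk (π * s) := by
      rw [← sub_eq_zero, ← map_sub]
      exact hpk0 _ ⟨e, by rw [← mul_sub, he]; ring⟩
    rw [h1]
    clear h1 he
    induction hs using Submodule.span_induction with
    | mem s hs =>
      obtain ⟨(⟨i, j⟩ | l), rfl⟩ := hs
      · have h2 : π * chainFamily π x y n (Sum.inl (i, j)) = π ^ (i.succ : ℕ) * x j := by
          simp only [chainFamily, Fin.val_succ]; ring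
        rw [h2, ← hbl', hU₁l, if_neg (Fin.succ_ne_zero i), hbl']
      · have h2 : π * chainFamily π x y n (Sum.inr l) = π ^ (n + 1) * y l := by
          simp only [chainFamily]; ring
        rw [h2, ← hbr', hU₁r, hbr']
    | zero => simp
    | add a b _ _ ha hb => rw [mul_add, map_add, map_add, ha, hb]
    | smul a b _ hb => rw [mul_smul_comm, map_smul, map_smul, hb]
  have hU : ρ (LinearMap.det U) = LinearMap.det (U₁ ∘ₗ U₂) := by
    refine map_det_reduction p b b' (fun i => by rw [hb', hb, hpk]) _ _ ?_
    rintro (⟨i, j⟩ | l)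
    · rw [LinearMap.comp_apply, hU₂l, ← hbl', hU₁l, hpk]
      exact congrArg pk (b.constr_basis _ _ _)
    · rw [LinearMap.comp_apply, hU₂r, hU₁π, hpk]
      exact congrArg pk (b.constr_basis _ _ _)
  have hmkπ : ∀ a b : B, Ideal.Quotient.mk (Ideal.span {a}) (a * b) = 0 := fun a b =>
    Ideal.Quotient.eq_zero_iff_mem.2 (Ideal.mem_span_singleton.2 ⟨b, rfl⟩)
  have hdet₁ : LinearMap.det U₁ * quotientNorm k c (Ideal.span {π}) = 1 := by
    have h : algebraMap R B t = π * (π ^ n * c) := by rw [ht]; ring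
    have h2 : projQuotient k h ∘ₗ U₁ =
        LinearMap.mulLeft k (Ideal.Quotient.mk (Ideal.span {π}) u) ∘ₗ projQuotient k h := by
      refine b'.ext ?_
      rintro (⟨i, j⟩ | l)
      · rw [LinearMap.comp_apply, hU₁l, LinearMap.comp_apply, hbl']
        change Ideal.Quotient.mk (Ideal.span {π}) _ =
          Ideal.Quotient.mk (Ideal.span {π}) u * Ideal.Quotient.mk (Ideal.span {π}) _
        split_ifs with hi
        · rw [← map_mul, ← one_mul (Ideal.Quotient.mk (Ideal.span {π}) (z j)), ← huc, ← map_mul]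
          congr 1
          simp only [hi, x]; simp; ring
        · obtain ⟨i, rfl⟩ := Fin.exists_succ_eq.2 hi
          rw [Fin.val_succ, pow_succ', mul_assoc, hmkπ, mul_zero]
      · rw [LinearMap.comp_apply, hU₁r, LinearMap.comp_apply, hbr']
        change Ideal.Quotient.mk (Ideal.span {π}) _ =
          Ideal.Quotient.mk (Ideal.span {π}) u * Ideal.Quotient.mk (Ideal.span {π}) _
        rw [pow_succ', mul_assoc, hmkπ, mul_zero]
    have := det_of_exact (mulQuotient k h) (projQuotient k h) (mulQuotient_injective h hπ0)
      (projQuotient_surjective h) (mulQuotient_exact h) LinearMap.id U₁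
      (LinearMap.mulLeft k (Ideal.Quotient.mk (Ideal.span {π}) u)) ?_
      (fun y => LinearMap.congr_fun h2 y)
    · rw [this, LinearMap.det_id, one_mul]
      change Algebra.norm k _ * Algebra.norm k _ = 1
      rw [← map_mul, ← map_mul, huc, map_one]
    · intro q
      obtain ⟨q, rfl⟩ := Ideal.Quotient.mk_surjective q
      rw [LinearMap.id_apply, mulQuotient_mk]
      exact (hU₁π q).symm
  have hdet₂ : LinearMap.det U₂ = quotientNorm k π (Ideal.span {c}) := by
    have h1 : mulQuotient k ht ∘ₗ LinearMap.mulLeft k (Ideal.Quotient.mk (Ideal.span {c}) π) =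
        U₂ ∘ₗ mulQuotient k ht := by
      refine ey.ext fun l => ?_
      rw [LinearMap.comp_apply, LinearMap.comp_apply, ← hy, LinearMap.mulLeft_apply, ← map_mul,
        mulQuotient_mk, mulQuotient_mk]
      change _ = U₂ (pk _)
      rw [← hbr', hU₂r]
      exact congrArg pk (by ring)
    have h2 : projQuotient k ht ∘ₗ U₂ = projQuotient k ht := by
      refine b'.ext ?_
      rintro (⟨i, j⟩ | l)
      · rw [LinearMap.comp_apply, hU₂l, hbl']
      · rw [LinearMap.comp_apply, hU₂r, hbr']
        change Ideal.Quotient.mk (Ideal.span {π ^ (n + 1)}) _ =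
          Ideal.Quotient.mk (Ideal.span {π ^ (n + 1)}) _
        rw [mul_left_comm, hmkπ, hmkπ]
    have := det_of_exact (mulQuotient k ht) (projQuotient k ht)
      (mulQuotient_injective ht (pow_ne_zero _ hπ0))
      (projQuotient_surjective ht) (mulQuotient_exact ht)
      (LinearMap.mulLeft k (Ideal.Quotient.mk (Ideal.span {c}) π)) U₂ LinearMap.id
      (fun y => LinearMap.congr_fun h1 y) (fun y => LinearMap.congr_fun h2 y)
    rw [this, LinearMap.det_id, mul_one]
    rfl
  refine ⟨(-1) ^ (n * m) * LinearMap.det U, ?_, ?_⟩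
  · have : Algebra.norm R π = LinearMap.det (LinearMap.mulLeft R π) := rfl
    rw [this, hcomp, LinearMap.det_comp, LinearMap.det_comp, hΔ, hS]; ring
  · have h1 : (ρ (LinearMap.det U) : k) = LinearMap.det U₁ * LinearMap.det U₂ := by
      rw [hU, LinearMap.det_comp]
    rw [map_mul, h1, hdet₂]
    simp only [map_pow, map_neg, map_one]
    linear_combination ((-1) ^ (n * m) * quotientNorm k π (Ideal.span {c})) * hdet₁

end PrimeNorm

/-! ### The places over a discrete valuation ring -/

section Local
open IsDedekindDomain
variable {k R B F : Type u} [Field k] [CommRing R] [IsDomain R] [Algebra k R]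
  [CommRing B] [IsDedekindDomain B] [Algebra R B] [Algebra k B] [IsScalarTower k R B]
  [Field F] [Algebra B F] [IsFractionRing B F] [Algebra k F] [IsScalarTower k B F]

theorem finite_mulSupport_symbol (f g : Fˣ) :
    ({A ∈ placesOver k F B | A.symbol f g ≠ 1}).Finite := by
  refine ((finite_setOf_ord_ne_zero_placesOver B f).union
    (finite_setOf_ord_ne_zero_placesOver B g)).subset ?_
  rintro A ⟨hA, hs⟩
  by_contra hc
  simp only [Set.mem_union, Set.mem_ofPred_eq, not_or, not_and, not_not] at hc
  exact hs (A.symbol_eq_one (hc.1 hA) (hc.2 hA))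

theorem finite_inter_mulSupport (f g : Fˣ) :
    (placesOver k F B ∩ Function.mulSupport fun A : Place k F => A.symbol f g).Finite :=
  (finite_mulSupport_symbol (B := B) f g).subset fun _ h => h

theorem finprod_symbol_mul (f g h : Fˣ) :
    ∏ᶠ A ∈ placesOver k F B, A.symbol f (g * h) =
      (∏ᶠ A ∈ placesOver k F B, A.symbol f g) * ∏ᶠ A ∈ placesOver k F B, A.symbol f h := by
  have h1 := finprod_mem_mul_distrib' (s := placesOver k F B)
    (f := fun A : Place k F => A.symbol f g)
    (g := fun A : Place k F => A.symbol f h) (finite_inter_mulSupport f g)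
    (finite_inter_mulSupport f h)
  rw [← h1]
  exact finprod_mem_congr rfl fun A _ => A.symbol_mul_right f g h

/-- The places over a ring, in terms of a prime element: the place of the prime, and the places at
which it is a unit. -/
theorem ord_placesOver_prime (π : B) (ϖ : Fˣ) (hϖ : (ϖ : F) = algebraMap B F π)
    (v : HeightOneSpectrum B) (hv : v.asIdeal = Ideal.span {π}) :
    ord (placeAtPrime k F v).ring ϖ = 1 ∧
    placesOver k F B \ {placeAtPrime k F v} = {A ∈ placesOver k F B | ord A.ring ϖ = 0} := by
  have h1 : ord (placeAtPrime k F v).ring ϖ = 1 := by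
    rw [ord_placeAtPrime_of_algebraMap v ϖ π hϖ, ← hv, Associates.count_self]
    · simp
    · exact v.associates_irreducible
  refine ⟨h1, ?_⟩
  ext A
  constructor
  · rintro ⟨hA, hne⟩
    refine ⟨hA, ?_⟩
    by_contra h0
    obtain ⟨w, rfl⟩ := exists_placeAtPrime_eq A hA
    rw [← ne_eq, ord_placeAtPrime_ne_zero_iff w ϖ π hϖ, ← hv] at h0
    exact hne (congrArg _ (HeightOneSpectrum.ext (v.isMaximal.eq_of_le w.isPrime.ne_top h0).symm))
  · rintro ⟨hA, h0⟩
    refine ⟨hA, ?_⟩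
    rintro rfl
    omega

omit [IsDedekindDomain B] in
theorem quotientNorm_neg_one_pow_mul (n : ℕ) (c : B) (I : Ideal B) :
    quotientNorm k ((-1) ^ n * c) I =
      (-1) ^ (n * Module.finrank k (B ⧸ I)) * quotientNorm k c I := by
  have h : Ideal.Quotient.mk I ((-1) ^ n) = algebraMap k (B ⧸ I) ((-1) ^ n) := by simp
  rw [quotientNorm, quotientNorm, map_mul, map_mul, h, Algebra.norm_algebraMap, pow_mul]

/-- The case of a prime element `π` of `finprod_symbol_uniformizer`. With `t = π ^ (n + 1) * c` and
`c` prime to `π`, the place of `π` contributes the norm of `c` on `B ⧸ (π)` up to sign, and the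
other places contribute the inverse of the norm of `π` on `B ⧸ (c)`; by `norm_prime` these are the
two factors of the leading coefficient of the norm of `π`. -/
theorem finprod_symbol_uniformizer_prime [Module.Free R B] [Module.Finite R B]
    [IsPrincipalIdealRing B]
    (ρ : R →ₐ[k] k) (t : R) (hρ : RingHom.ker ρ = Ideal.span {t})
    (hunit : ∀ r, ρ r ≠ 0 → IsUnit r) (hfin : ∀ J : Ideal B, J ≠ ⊥ → Module.Finite k (B ⧸ J))
    (τ : Fˣ) (hτ : (τ : F) = algebraMap B F (algebraMap R B t)) (π : B) (hπ : Prime π)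
    (ϖ : Fˣ) (hϖ : (ϖ : F) = algebraMap B F π) : ∃ (m : ℕ) (h : R) (c : kˣ),
      Algebra.norm R π = t ^ m * h ∧ ρ h = c ∧
        ∏ᶠ A ∈ placesOver k F B, A.symbol τ ϖ = (-1) ^ m * c⁻¹ := by
  have hπI : Ideal.span {π} ≠ ⊥ := by simpa using hπ.ne_zero
  have hprime : (Ideal.span {π}).IsPrime := (Ideal.span_singleton_prime hπ.ne_zero).2 hπ
  have hmax : (Ideal.span {π}).IsMaximal := hprime.isMaximal hπI
  let v : HeightOneSpectrum B := ⟨Ideal.span {π}, hprime, hπI⟩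
  -- every prime of `B` lies over `t`
  have hdvd : π ∣ algebraMap R B t := by
    have h1 := Ideal.isMaximal_comap_of_isIntegral_of_isMaximal (R := R) (Ideal.span {π})
    have h2 : (Ideal.span {π}).comap (algebraMap R B) ≤ RingHom.ker ρ := by
      intro r hr
      by_contra h0
      exact h1.ne_top (Ideal.eq_top_of_isUnit_mem _ hr (hunit r h0))
    have h3 := h1.eq_of_le (RingHom.ker_ne_top ρ) h2
    have h4 : t ∈ RingHom.ker ρ := by rw [hρ]; exact Ideal.mem_span_singleton_self t
    rw [← h3] at h4
    exact Ideal.mem_span_singleton.1 h4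
  have ht0 : algebraMap R B t ≠ 0 := by
    intro h0
    rw [h0, map_zero] at hτ
    exact τ.ne_zero hτ
  obtain ⟨e, c, hc, he⟩ := WfDvdMonoid.max_power_factor ht0 hπ.irreducible
  obtain ⟨n, rfl⟩ : ∃ n, e = n + 1 := by
    refine Nat.exists_eq_succ_of_ne_zero ?_
    rintro rfl
    rw [pow_zero, one_mul] at he
    exact hc (he ▸ hdvd)
  have hcop : IsCoprime π c := (hπ.irreducible.coprime_iff_not_dvd).2 hc
  have hc0 : c ≠ 0 := by rintro rfl; simp at hc
  have := hfin _ hπI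
  have := hfin (Ideal.span {c}) (by simpa using hc0)
  obtain ⟨h, hN, hh⟩ := norm_prime ρ t hρ hunit π c n he hπ.ne_zero hcop
  set m := Module.finrank k (B ⧸ Ideal.span {π}) with hm
  obtain ⟨hord, hplaces⟩ := ord_placesOver_prime (k := k) π ϖ hϖ v rfl
  set w := placeAtPrime k F v with hw
  set κ : Fˣ := Units.mk0 (algebraMap B F c) (by
    simpa using hc0) with hκ
  have hτκ : τ = ϖ ^ (n + 1) * κ := Units.ext (by rw [hτ, he, map_mul, map_pow, ← hϖ]; rfl)
  have hκw : ord w.ring κ = 0 := by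
    by_contra h0
    rw [← ne_eq, ord_placeAtPrime_ne_zero_iff v κ c rfl] at h0
    exact hc (Ideal.span_singleton_le_span_singleton.1 h0)
  have hκu := mem_unitGroup_of_ord_eq_zero _ hκw
  -- the contribution of the place of `π`
  set Y := unitsNorm w.residueMap (w.ring.unitGroupToResidueFieldUnits ⟨κ, hκu⟩) with hY
  have hYn : (Y : k) = quotientNorm k c (Ideal.span {π}) :=
    unitsNorm_residue_placeAtPrime v κ c rfl hκu
  have hτw : ord w.ring τ = n + 1 := by
    rw [hτκ, ord_mul, ord_pow, hord, hκw]; push_cast; ring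
  have hsw : w.symbol τ ϖ = (-1) ^ ((n + 1) * m) * Y := by
    have h1 : tameElement w.ring τ ϖ = (-1) ^ (n + 1) * κ := by
      rw [tameElement, hord, hτw, mul_one, zpow_one, hτκ]
      rw [show ((n : ℤ) + 1) = ((n + 1 : ℕ) : ℤ) by push_cast; ring, zpow_natCast, zpow_natCast]
      simp
    have hu : (-1) ^ (n + 1) * κ ∈ w.ring.unitGroup := h1 ▸ tameElement_mem_unitGroup _ _ _
    apply Units.ext
    rw [Place.symbol, tameSymbol_of_eq _ hu h1,
      unitsNorm_residue_placeAtPrime v _ ((-1) ^ (n + 1) * c) (by simp [hκ]) hu]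
    rw [quotientNorm_neg_one_pow_mul, Units.val_mul, hYn]
    simp [hm, v]
  -- the contribution of the other places
  set X := ∏ᶠ A ∈ {A ∈ placesOver k F B | ord A.ring ϖ = 0}, A.symbol ϖ κ with hX
  have hXn : (X : k) = quotientNorm k π (Ideal.span {c}) := by
    refine finprod_symbol_eq_quotientNorm hfin c π κ ϖ rfl hϖ fun A hA h0 => ?_
    by_contra h1
    have h2 : A ∉ {A ∈ placesOver k F B | ord A.ring ϖ = 0} := fun h => h1 h.2
    rw [← hplaces] at h2
    have h3 : A = w := by
      by_contra hne
      exact h2 ⟨hA, hne⟩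
    rw [h3] at h0
    exact h0 hκw
  have hso : ∏ᶠ A ∈ {A ∈ placesOver k F B | ord A.ring ϖ = 0}, A.symbol τ ϖ = X⁻¹ := by
    rw [hX]
    simp only [← finprod_inv_distrib]
    refine finprod_mem_congr rfl fun A hA => ?_
    rw [A.symbol_swap ϖ τ, hτκ, A.symbol_mul_right,
      A.symbol_eq_one hA.2 (by rw [ord_pow, hA.2, mul_zero]), one_mul]
  refine ⟨m, h, (-1) ^ (n * m) * X * Y⁻¹, hN, ?_, ?_⟩
  · rw [← hYn, ← hXn] at hh
    have hY0 : (Y : k) ≠ 0 := Y.ne_zero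
    push_cast
    rw [eq_mul_inv_iff_mul_eq₀ hY0, hh]
  · rw [← finprod_mem_mul_sdiff' (s := {w}) (by
        rw [Set.singleton_subset_iff]; exact placeAtPrime_mem_placesOver v)
      (finite_inter_mulSupport (B := B) τ ϖ), finprod_mem_singleton, hplaces, hso, hsw]
    have h1 : ∀ j : ℕ, ((-1 : kˣ) ^ j)⁻¹ = (-1) ^ j := fun j => by rw [← inv_pow]; simp
    rw [mul_inv, mul_inv, inv_inv, h1, add_mul, one_mul, pow_add]
    clear_value X Y
    generalize (-1 : kˣ) ^ (n * m) = a
    generalize (-1 : kˣ) ^ m = b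
    ac_rfl

/-- Over a discrete valuation ring `R` with uniformizer `t` and residue field `k`, the product of
the symbols `{t, g}` over the places over `B` is determined by the order `m` and the leading
coefficient `c` of the norm of `g`. Both sides are multiplicative in `g`, which reduces the assertion
to units and prime elements. -/
theorem finprod_symbol_uniformizer [Module.Free R B] [Module.Finite R B] [IsPrincipalIdealRing B]
    (ρ : R →ₐ[k] k) (t : R) (hρ : RingHom.ker ρ = Ideal.span {t})
    (hunit : ∀ r, ρ r ≠ 0 → IsUnit r) (hfin : ∀ J : Ideal B, J ≠ ⊥ → Module.Finite k (B ⧸ J))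
    (τ : Fˣ) (hτ : (τ : F) = algebraMap B F (algebraMap R B t)) (g : B) :
    ∀ γ : Fˣ, (γ : F) = algebraMap B F g → ∃ (m : ℕ) (h : R) (c : kˣ),
      Algebra.norm R g = t ^ m * h ∧ ρ h = c ∧
        ∏ᶠ A ∈ placesOver k F B, A.symbol τ γ = (-1) ^ m * c⁻¹ := by
  induction g using UniqueFactorizationMonoid.induction_on_prime with
  | h₁ => intro γ hγ; simp at hγ
  | h₂ g hg =>
    intro γ hγ
    have hN : ρ (Algebra.norm R g) ≠ 0 := ((hg.map (Algebra.norm R)).map ρ).ne_zero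
    refine ⟨0, Algebra.norm R g, Units.mk0 _ hN, by simp, rfl, ?_⟩
    have hu : ∀ A ∈ placesOver k F B, ord A.ring γ = 0 := by
      intro A hA
      obtain ⟨w, rfl⟩ := exists_placeAtPrime_eq A hA
      by_contra h0
      rw [← ne_eq, ord_placeAtPrime_ne_zero_iff w γ g hγ, Ideal.span_singleton_eq_top.2 hg] at h0
      exact w.isPrime.ne_top (top_le_iff.1 h0)
    have h1 := finprod_symbol_eq_quotientNorm hfin (algebraMap R B t) g τ γ hτ hγ
      (fun A hA _ => hu A hA)
    have h2 : {A ∈ placesOver k F B | ord A.ring γ = 0} = placesOver k F B :=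
      Set.ext fun A => ⟨fun h => h.1, fun h => ⟨h, hu A h⟩⟩
    rw [h2, ← map_norm_eq_quotientNorm ρ t hρ] at h1
    have h3 : ∏ᶠ A ∈ placesOver k F B, A.symbol τ γ =
        (∏ᶠ A ∈ placesOver k F B, A.symbol γ τ)⁻¹ := by
      simp only [← finprod_inv_distrib]
      exact finprod_mem_congr rfl fun A _ => A.symbol_swap γ τ
    rw [h3, pow_zero, one_mul]
    congr 1
    exact Units.ext h1
  | h₃ a π ha hπ ih =>
    intro γ hγ
    have hinj := FaithfulSMul.algebraMap_injective B F
    set α : Fˣ := Units.mk0 (algebraMap B F a) (by simpa using ha)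
    set ϖ : Fˣ := Units.mk0 (algebraMap B F π) (by simpa using hπ.ne_zero)
    have hγ' : γ = ϖ * α := Units.ext (by rw [hγ, map_mul]; rfl)
    obtain ⟨m, h, c, h1, h2, h3⟩ := ih α rfl
    obtain ⟨m', h', c', h1', h2', h3'⟩ :=
      finprod_symbol_uniformizer_prime ρ t hρ hunit hfin τ hτ π hπ ϖ rfl
    refine ⟨m' + m, h' * h, c' * c, ?_, ?_, ?_⟩
    · rw [map_mul, h1, h1']; ring
    · rw [map_mul, h2, h2', Units.val_mul]
    · rw [hγ', finprod_symbol_mul, h3, h3', pow_add, mul_inv]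
      ac_rfl

end Local

/-! ### Norms and elementary divisors -/

section DetPi
variable {k ι : Type*} [Field k] [Fintype ι] {M : ι → Type*} [∀ i, AddCommGroup (M i)]
  [∀ i, Module k (M i)] [∀ i, Module.Finite k (M i)]

open Classical in
/-- The endomorphism of a product that is `f` on the factor `i` and the identity on the others has
determinant `det f`. -/
theorem det_pi_single (i : ι) (f : M i →ₗ[k] M i) :
    LinearMap.det (LinearMap.pi fun j => if h : j = i then h ▸ (f ∘ₗ LinearMap.proj i)
      else (LinearMap.proj j : (∀ j, M j) →ₗ[k] M j)) = LinearMap.det f := by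
  let p : (∀ j, M j) →ₗ[k] ∀ j : {j // j ≠ i}, M j := LinearMap.pi fun j => LinearMap.proj j.1
  have h := det_of_exact (LinearMap.single k M i) p (Pi.single_injective i) ?_ ?_ f
    (LinearMap.pi fun j => if h : j = i then h ▸ (f ∘ₗ LinearMap.proj i)
      else (LinearMap.proj j : (∀ j, M j) →ₗ[k] M j)) LinearMap.id ?_ ?_
  · rw [h, LinearMap.det_id, mul_one]
  · intro y
    refine ⟨fun j => if h : j = i then 0 else y ⟨j, h⟩, ?_⟩
    ext j
    simp [p, j.2]
  · intro y
    constructor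
    · intro hy
      refine ⟨y i, ?_⟩
      ext j
      by_cases hj : j = i
      · subst hj; simp
      · have := congrFun hy ⟨j, hj⟩
        simp [Pi.single_eq_of_ne hj]
        exact this.symm
    · rintro ⟨x, rfl⟩
      ext j
      simp [p, Pi.single_eq_of_ne j.2]
  · intro x
    ext j
    by_cases hj : j = i
    · subst hj; simp
    · simp [hj]
  · intro y
    ext j
    simp [p, j.2]

theorem det_pi_map (f : ∀ i, M i →ₗ[k] M i) :
    LinearMap.det (LinearMap.pi fun i => f i ∘ₗ LinearMap.proj i) = ∏ i, LinearMap.det (f i) := by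
  classical
  have key : ∀ s : Finset ι, LinearMap.det (LinearMap.pi fun i =>
      if i ∈ s then f i ∘ₗ LinearMap.proj i else (LinearMap.proj i : (∀ j, M j) →ₗ[k] M i)) =
      ∏ i ∈ s, LinearMap.det (f i) := by
    intro s
    induction s using Finset.induction_on with
    | empty =>
      simp only [Finset.notMem_empty, if_false, Finset.prod_empty]
      exact LinearMap.det_id
    | insert i s hi ih =>
      rw [Finset.prod_insert hi, ← ih, ← det_pi_single i (f i), ← LinearMap.det_comp]
      congr 1
      refine LinearMap.ext fun x => funext fun j => ?_
      by_cases hj : j = i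
      · subst hj; simp [hi]
      · simp [hj]
  simpa using key Finset.univ

end DetPi

section NormQuotient
variable {k R B : Type*} [Field k] [CommRing R] [IsDomain R] [Algebra k R]

theorem quotientNorm_span_mul (r : R) {a b : R} (ha : a ≠ 0)
    [Module.Finite k (R ⧸ Ideal.span {a})] [Module.Finite k (R ⧸ Ideal.span {b})] :
    quotientNorm k r (Ideal.span {a * b}) =
      quotientNorm k r (Ideal.span {a}) * quotientNorm k r (Ideal.span {b}) := by
  have := finite_quotient_mul (k := k) a b
  simp only [quotientNorm, Algebra.norm_apply]
  rw [mul_comm (LinearMap.det _)]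
  refine det_of_exact (mulQuotient k (a := a) (b := b) rfl) (projQuotient k (a := a) (b := b) rfl)
    (mulQuotient_injective rfl ha) (projQuotient_surjective rfl) (mulQuotient_exact rfl)
    _ _ _ ?_ ?_
  · intro x
    obtain ⟨c, rfl⟩ := Ideal.Quotient.mk_surjective x
    change mulQuotient k _ (Ideal.Quotient.mk _ r * Ideal.Quotient.mk _ c) =
      Ideal.Quotient.mk _ r * mulQuotient k _ (Ideal.Quotient.mk _ c)
    rw [← map_mul, mulQuotient_mk, mulQuotient_mk, ← map_mul, mul_left_comm]
  · intro x
    obtain ⟨c, rfl⟩ := Ideal.Quotient.mk_surjective x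
    rfl

theorem quotientNorm_span_prod {ι : Type*} (s : Finset ι) (r : R) (a : ι → R)
    (ha : ∀ i, a i ≠ 0) (hfin : ∀ a : R, a ≠ 0 → Module.Finite k (R ⧸ Ideal.span {a})) :
    quotientNorm k r (Ideal.span {∏ i ∈ s, a i}) =
      ∏ i ∈ s, quotientNorm k r (Ideal.span {a i}) := by
  classical
  induction s using Finset.induction_on with
  | empty => simp [quotientNorm_top]
  | insert i s hi ih =>
    have := hfin _ (ha i)
    have := hfin _ (Finset.prod_ne_zero_iff.2 fun j (_ : j ∈ s) => ha j)
    rw [Finset.prod_insert hi, Finset.prod_insert hi, quotientNorm_span_mul r (ha i), ih]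

/-- The norm of an element `r` of the base ring on `B ⧸ (g)` is its norm on `R ⧸ (N g)`: the two
modules have the same elementary divisors. -/
theorem quotientNorm_algebraMap [IsPrincipalIdealRing R] [CommRing B] [IsDomain B] [Algebra R B]
    [Algebra k B] [IsScalarTower k R B] [Module.Free R B] [Module.Finite R B]
    (hfin : ∀ a : R, a ≠ 0 → Module.Finite k (R ⧸ Ideal.span {a})) (r : R) {g : B} (hg : g ≠ 0) :
    quotientNorm k (algebraMap R B r) (Ideal.span {g}) =
      quotientNorm k r (Ideal.span {Algebra.norm R g}) := by
  classical
  let b := Module.Free.chooseBasis R B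
  have hI : Ideal.span {g} ≠ ⊥ := Ideal.span_singleton_eq_bot.not.2 hg
  set a := (Ideal.span {g}).smithCoeffs b hI with ha
  have hass : Associated (Algebra.norm R g) (∏ i, a i) := associated_norm_prod_smith b hg
  have ha0 : ∀ i, a i ≠ 0 := by
    intro i h0
    have : Algebra.norm R g = 0 := by
      rw [hass.eq_zero_iff]; exact Finset.prod_eq_zero (Finset.mem_univ i) h0
    exact hg ((Algebra.norm_eq_zero_iff_of_basis b).1 this)
  rw [Ideal.span_singleton_eq_span_singleton.2 hass, quotientNorm_span_prod _ _ _ ha0 hfin]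
  let e : (B ⧸ Ideal.span {g}) ≃ₗ[R] ∀ i, R ⧸ Ideal.span {a i} :=
    (Ideal.span {g}).quotientEquivPiSpan b hI
  let e' := e.restrictScalars k
  have hf : ∀ i, Module.Finite k (R ⧸ Ideal.span {a i}) := fun i => hfin _ (ha0 i)
  simp only [quotientNorm, Algebra.norm_apply]
  rw [← LinearMap.det_conj _ e', ← det_pi_map]
  congr 1
  refine LinearMap.ext fun x => ?_
  obtain ⟨y, rfl⟩ := e'.surjective x
  have h1 : e' (Ideal.Quotient.mk _ (algebraMap R B r) * y) = r • e' y := by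
    change e _ = r • e y
    rw [← map_smul, Algebra.smul_def]; rfl
  simp only [LinearMap.comp_apply, LinearEquiv.coe_coe, LinearEquiv.symm_apply_apply]
  refine h1.trans (funext fun i => ?_)
  exact Algebra.smul_def r _

end NormQuotient

section Poly
open Polynomial
variable {k R : Type*} [Field k] [CommRing R] [Algebra k R] [Algebra k[X] R]
  [IsScalarTower k k[X] R]

/-- The quotients of a localization of `k[X]` by nonzero elements are finite over `k`: the
image of `k[X]` in such a quotient is Artinian, so the denominators are already invertible there. -/
theorem finite_quotient_of_isLocalization (M : Submonoid k[X]) [IsLocalization M R] {r : R}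
    (hr : r ≠ 0) : Module.Finite k (R ⧸ Ideal.span {r}) := by
  obtain ⟨⟨p, m⟩, hp⟩ := IsLocalization.surj M r
  dsimp only at hp
  have hp0 : p ≠ 0 := by
    rintro rfl
    rw [map_zero, (IsLocalization.map_units R m).mul_left_eq_zero] at hp
    exact hr hp
  have hpr : algebraMap k[X] R p ∈ Ideal.span {r} := Ideal.mem_span_singleton.2 ⟨_, hp.symm⟩
  let φ : k[X] →ₐ[k] R ⧸ Ideal.span {r} :=
    (Ideal.Quotient.mkₐ k (Ideal.span {r})).comp (IsScalarTower.toAlgHom k k[X] R)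
  let ψ : AdjoinRoot p →ₐ[k] R ⧸ Ideal.span {r} :=
    Ideal.Quotient.liftₐ _ φ fun a ha => by
      obtain ⟨c, rfl⟩ := Ideal.mem_span_singleton.1 ha
      rw [map_mul]
      have : φ p = 0 := Ideal.Quotient.eq_zero_iff_mem.2 hpr
      rw [this, zero_mul]
  have : Module.Finite k (AdjoinRoot p) := (AdjoinRoot.powerBasis hp0).finite
  have : Module.Finite k ψ.range := Module.Finite.range ψ.toLinearMap
  have : IsArtinianRing ψ.range := IsArtinianRing.of_finite k _
  have hs : Function.Surjective ψ := by
    intro x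
    obtain ⟨y, rfl⟩ := Ideal.Quotient.mk_surjective x
    obtain ⟨⟨q, s⟩, hq⟩ := IsLocalization.surj M y
    dsimp only at hq
    let s' : ψ.range := ⟨φ s, ⟨AdjoinRoot.mk p s, rfl⟩⟩
    have hsu : IsUnit (φ (s : k[X])) :=
      (IsLocalization.map_units R s).map (Ideal.Quotient.mkₐ k (Ideal.span {r}))
    have hs' : IsUnit s' := by
      refine IsArtinianRing.isUnit_of_mem_nonZeroDivisors ?_
      rw [mem_nonZeroDivisors_iff_right]
      intro z hz
      apply Subtype.ext
      have := congrArg Subtype.val hz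
      exact hsu.mul_left_eq_zero.1 this
    obtain ⟨v, hv⟩ := hs'.exists_right_inv
    have h1 : Ideal.Quotient.mk (Ideal.span {r}) y = φ q * (v : R ⧸ Ideal.span {r}) := by
      have h2 : φ s * (v : R ⧸ Ideal.span {r}) = 1 := congrArg Subtype.val hv
      have h3 : Ideal.Quotient.mk (Ideal.span {r}) y * φ s = φ q :=
        congrArg (Ideal.Quotient.mk (Ideal.span {r})) hq
      rw [← h3, mul_assoc, h2, mul_one]
    rw [h1]
    exact ψ.range.mul_mem ⟨AdjoinRoot.mk p q, rfl⟩ v.2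
  exact Module.Finite.of_surjective ψ.toLinearMap hs

/-- The norm of `X` on the quotient of the ring of Laurent polynomials by a polynomial `h` with
nonzero constant term. -/
theorem quotientNorm_X [IsLocalization.Away (X : k[X]) R] (h : k[X]) (h0 : h.coeff 0 ≠ 0) :
    quotientNorm k (algebraMap k[X] R X) (Ideal.span {algebraMap k[X] R h}) =
      (-1) ^ h.natDegree * (h.coeff 0 / h.leadingCoeff) := by
  have hh : h ≠ 0 := by rintro rfl; simp at h0
  have hX : IsUnit (AdjoinRoot.mk h X) := by
    obtain ⟨q, hq⟩ : (X : k[X]) ∣ h - C (h.coeff 0) := X_dvd_iff.2 (by simp)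
    have h1 : AdjoinRoot.mk h X * AdjoinRoot.mk h q = AdjoinRoot.mk h (C (- h.coeff 0)) := by
      rw [← map_mul, ← hq, map_sub, AdjoinRoot.mk_self, zero_sub, map_neg, map_neg]
    have h2 : IsUnit (AdjoinRoot.mk h (C (- h.coeff 0))) :=
      (isUnit_C.2 (neg_ne_zero.2 h0).isUnit).map _
    rw [← h1] at h2
    exact isUnit_of_mul_isUnit_left h2
  let ψ : R →+* AdjoinRoot h := IsLocalization.Away.lift (X : k[X]) hX
  have hψ : ∀ p, ψ (algebraMap k[X] R p) = AdjoinRoot.mk h p :=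
    fun p => IsLocalization.Away.lift_eq (X : k[X]) hX p
  let ψ' : R →ₐ[k] AdjoinRoot h := { ψ with
    commutes' := fun c => by
      change ψ (algebraMap k R c) = _
      rw [IsScalarTower.algebraMap_apply k k[X] R, hψ]; rfl }
  have hsurj : Function.Surjective ψ' := fun x => by
    obtain ⟨p, rfl⟩ := AdjoinRoot.mk_surjective x
    exact ⟨_, hψ p⟩
  have hker : RingHom.ker ψ' = Ideal.span {algebraMap k[X] R h} := by
    ext r
    obtain ⟨⟨p, m⟩, hp⟩ := IsLocalization.surj (Submonoid.powers (X : k[X])) r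
    dsimp only at hp
    have hm := IsLocalization.map_units R m
    rw [Ideal.mem_span_singleton, RingHom.mem_ker]
    constructor
    · intro hr
      have h1 : AdjoinRoot.mk h p = 0 := by
        rw [← hψ p, ← hp, map_mul, show ψ r = 0 from hr, zero_mul]
      rw [← hm.dvd_mul_right, hp]
      exact map_dvd _ (AdjoinRoot.mk_eq_zero.1 h1)
    · rintro ⟨y, rfl⟩
      rw [map_mul, show ψ' (algebraMap k[X] R h) = AdjoinRoot.mk h h from hψ h, AdjoinRoot.mk_self,
        zero_mul]
  have h1 : quotientNorm k (algebraMap k[X] R X) (Ideal.span {algebraMap k[X] R h}) =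
      Algebra.norm k (AdjoinRoot.root h) := by
    rw [← hker, quotientNorm]
    rw [← Algebra.norm_eq_of_algEquiv (Ideal.quotientKerAlgEquivOfSurjective hsurj)]
    congr 1
    exact hψ X
  have h2 := Algebra.PowerBasis.norm_gen_eq_coeff_zero_minpoly (AdjoinRoot.powerBasis hh)
  rw [h1, ← AdjoinRoot.powerBasis_gen hh, h2, AdjoinRoot.powerBasis_gen, AdjoinRoot.minpoly_root hh,
    coeff_mul_C, AdjoinRoot.powerBasis_dim, div_eq_mul_inv]

end Poly

/-! ### Finiteness of integral closures -/

section Finiteness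
open Polynomial

/-- A module that embeds semilinearly into a finite module, along a finite homomorphism out of a
Noetherian ring, is finite. -/
theorem finite_of_semilinear_injective {R S M N : Type*} [CommRing R] [CommRing S]
    [IsNoetherianRing R] [AddCommGroup M] [Module R M] [AddCommGroup N] [Module S N]
    [Module.Finite S N] {σ : R →+* S} (hσ : σ.Finite) (f : M →ₛₗ[σ] N)
    (hf : Function.Injective f) : Module.Finite R M := by
  let _ := σ.toAlgebra
  let _ : Module R N := Module.compHom N σ
  have : IsScalarTower R S N := ⟨fun r s n => mul_smul (σ r) s n⟩
  have : Module.Finite R S := hσ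
  have : Module.Finite R N := Module.Finite.trans S N
  let f' : M →ₗ[R] N :=
    { toFun := f, map_add' := f.map_add, map_smul' := fun r m => f.map_smulₛₗ r m }
  exact Module.Finite.of_injective f' hf

theorem finite_of_closure_eq_top {A S : Type*} [CommRing A] [CommRing S] (σ : A →+* S) (x : S)
    {n : ℕ} (hn : 0 < n) (hx : x ^ n ∈ σ.range) (h : Subring.closure (σ.range ∪ {x}) = ⊤) :
    σ.Finite := by
  let _ := σ.toAlgebra
  obtain ⟨a, ha⟩ := hx
  have hint : IsIntegral A x :=
    IsIntegral.of_pow hn (by rw [← ha]; exact isIntegral_algebraMap (R := A))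
  have htop : Algebra.adjoin A {x} = ⊤ := by
    refine top_le_iff.1 fun q _ => ?_
    have hq : q ∈ Subring.closure (σ.range ∪ {x}) := by rw [h]; trivial
    refine (Subring.closure_le (t := (Algebra.adjoin A {x}).toSubring)).2 ?_ hq
    rintro y (⟨c, rfl⟩ | rfl)
    · exact (Algebra.adjoin A {x}).algebraMap_mem c
    · exact Algebra.subset_adjoin rfl
  have hfg := hint.fg_adjoin_singleton
  rw [htop] at hfg
  exact ⟨hfg⟩

/-- Over a perfect field every coefficient is a `p`-th power, hence `k[X]` is generated by `X` over
the image of an iterate of the Frobenius. -/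
theorem finite_iterateFrobenius {k : Type*} [Field k] [PerfectField k] (p : ℕ) [ExpChar k p]
    (n : ℕ) : (iterateFrobenius k[X] p n).Finite := by
  have := PerfectField.toPerfectRing (K := k) p
  refine finite_of_closure_eq_top _ X (n := p ^ n) (pow_pos (expChar_pos k p) n)
    ⟨X, iterateFrobenius_def p n X⟩ (top_le_iff.1 fun q _ => ?_)
  induction q using Polynomial.induction_on' with
  | add a b ha hb => exact add_mem (ha trivial) (hb trivial)
  | monomial m c =>
    obtain ⟨d, rfl⟩ := (bijective_iterateFrobenius k p n).2 c
    rw [← C_mul_X_pow_eq_monomial]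
    refine mul_mem (Subring.subset_closure (Or.inl ⟨C d, ?_⟩))
      (pow_mem (Subring.subset_closure (s := ((iterateFrobenius k[X] p n).range : Set k[X]) ∪ {X})
        (Or.inr (Set.mem_singleton X))) m)
    exact (iterateFrobenius_def p n (C d)).trans (by rw [iterateFrobenius_def, C_pow])

/-- The integral closure of a polynomial ring in one variable over a perfect field, in a finite
extension of its field of fractions, is finite. For a separable extension this is standard; in
general an iterate of the Frobenius embeds the integral closure in `F` into the one in the separable
closure, semilinearly along the Frobenius of `k[X]`, which is finite. -/
theorem finite_integralClosure_polynomial {k K F : Type*} [Field k] [PerfectField k] [Field K]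
    [Field F] [Algebra k[X] K] [IsFractionRing k[X] K] [Algebra K F] [Algebra k[X] F]
    [IsScalarTower k[X] K F] [FiniteDimensional K F] :
    Module.Finite k[X] (integralClosure k[X] F) := by
  obtain ⟨p, hp⟩ := ExpChar.exists k
  have hpK : ExpChar K p := expChar_of_injective_ringHom
    (f := (algebraMap k[X] K).comp (C : k →+* k[X])) (RingHom.injective _) p
  let L := separableClosure K F
  have : IsScalarTower k[X] L F := IsScalarTower.of_algebraMap_eq fun x => by
    rw [IsScalarTower.algebraMap_apply k[X] K F, IsScalarTower.algebraMap_apply k[X] K L]; rfl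
  have : FiniteDimensional L F := FiniteDimensional.right K L F
  have : Module.Finite k[X] (integralClosure k[X] L) := IsIntegralClosure.finite k[X] K L _
  have hpL : ExpChar L p := expChar_of_injective_algebraMap (algebraMap K L).injective p
  let φ := IsPurelyInseparable.iterateFrobenius L F p (le_refl (IsPurelyInseparable.exponent L F))
  set n := IsPurelyInseparable.exponent L F
  have hφ : ∀ x, algebraMap L F (φ x) = x ^ p ^ n :=
    IsPurelyInseparable.algebraMap_iterateFrobenius L p (le_refl n)
  have hint : ∀ x ∈ integralClosure k[X] F, φ x ∈ integralClosure k[X] L := by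
    intro x hx
    have h1 : IsIntegral k[X] (algebraMap L F (φ x)) := by
      rw [hφ]; exact IsIntegral.pow hx _
    exact (isIntegral_algebraMap_iff (algebraMap L F).injective).1 h1
  let f : integralClosure k[X] F →ₛₗ[iterateFrobenius k[X] p n] integralClosure k[X] L :=
    { toFun := fun x => ⟨φ x, hint x x.2⟩
      map_add' := fun x y => Subtype.ext (map_add φ _ _)
      map_smul' := fun r x => Subtype.ext <| (algebraMap L F).injective <| by
        change algebraMap L F (φ (r • (x : F))) = algebraMap L F (_ • φ x)
        rw [hφ, Algebra.smul_def, Algebra.smul_def, map_mul, hφ, mul_pow,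
          ← IsScalarTower.algebraMap_apply, iterateFrobenius_def, map_pow] }
  refine finite_of_semilinear_injective (finite_iterateFrobenius p n) f fun x y h => ?_
  exact Subtype.ext (φ.injective (congrArg Subtype.val h))

/-- Finiteness of the integral closure passes to localizations of the base ring. -/
theorem finite_integralClosure_of_isLocalization {A R F : Type*} [CommRing A] [CommRing R]
    [Field F] [Algebra A R] [Algebra A F] [Algebra R F] [IsScalarTower A R F]
    [Module.Finite A (integralClosure A F)] [IsNoetherianRing R] (M : Submonoid A)
    [IsLocalization M R] : Module.Finite R (integralClosure R F) := by
  obtain ⟨s, hs⟩ := Module.Finite.fg_top (R := A) (M := integralClosure A F)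
  let N : Submodule R F := Submodule.span R ((fun x : integralClosure A F => (x : F)) '' s)
  have hN : Module.Finite R N :=
    Module.Finite.span_of_finite R (s.finite_toSet.image _)
  have hmem : ∀ x : integralClosure A F, (x : F) ∈ N := by
    intro x
    have hx : x ∈ Submodule.span A (s : Set (integralClosure A F)) := by rw [hs]; trivial
    induction hx using Submodule.span_induction with
    | mem x hx => exact Submodule.subset_span ⟨x, hx, rfl⟩
    | zero => exact N.zero_mem
    | add x y _ _ hx hy => exact N.add_mem hx hy
    | smul a x _ hx =>
      have : ((a • x : integralClosure A F) : F) = algebraMap A R a • (x : F) := by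
        rw [algebraMap_smul]; rfl
      rw [this]
      exact N.smul_mem _ hx
  have hle : Subalgebra.toSubmodule (integralClosure R F) ≤ N := by
    intro y hy
    obtain ⟨m, hm⟩ := IsIntegral.exists_multiple_integral_of_isLocalization M y hy
    have h1 : (m • y : F) ∈ N := hmem ⟨_, hm⟩
    obtain ⟨v, hv⟩ := (IsLocalization.map_units R m).exists_left_inv
    have h2 : y = v • (m • y : F) := by
      rw [Submonoid.smul_def, ← algebraMap_smul R (m : A) y, smul_smul, hv, one_smul]
    rw [h2]
    exact N.smul_mem v h1
  exact Module.Finite.of_injective (Submodule.inclusion hle) (Submodule.inclusion_injective hle)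

end Finiteness

/-! ### Product formulas in a finite extension -/

theorem isPrincipalIdealRing_of_isLocalization {A R : Type*} [CommRing A] [CommRing R]
    [IsPrincipalIdealRing A] [Algebra A R] (M : Submonoid A) [IsLocalization M R] :
    IsPrincipalIdealRing R := ⟨fun J => by
  obtain ⟨a, ha⟩ := (IsPrincipalIdealRing.principal (J.comap (algebraMap A R))).principal
  refine ⟨algebraMap A R a, ?_⟩
  change Ideal.under A J = _ at ha
  rw [← IsLocalization.map_under M R J, ha]
  exact Ideal.map_span _ _ |>.trans (by simp)⟩

section Generic
variable {k K F R : Type u} [Field k] [Field K] [Field F] [CommRing R] [Algebra R K]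
  [IsFractionRing R K] [Algebra R F] [Algebra k F]

theorem mem_placesOver_integralClosure {A : Place k F} (h : ∀ r : R, algebraMap R F r ∈ A.ring) :
    A ∈ placesOver k F (integralClosure R F) := by
  intro b
  let _ : Algebra R A.ring := ((algebraMap R F).codRestrict A.ring.toSubring h).toAlgebra
  have : IsScalarTower R A.ring F := IsScalarTower.of_algebraMap_eq fun _ => rfl
  obtain ⟨x, hx⟩ := IsIntegrallyClosed.isIntegral_iff.1
    (IsIntegral.tower_top (A := A.ring) (show IsIntegral R (b : F) from b.2))
  rw [show algebraMap (integralClosure R F) F b = b from rfl, ← hx]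
  exact x.2

variable [Algebra k R] (ρ : R →ₐ[k] k) {t : R} (hρ : RingHom.ker ρ = Ideal.span {t})
include hρ

theorem mem_of_isMaximal (hunit : ∀ r, ρ r ≠ 0 → IsUnit r) (m : Ideal R) [hm : m.IsMaximal] :
    t ∈ m := by
  by_contra h
  obtain ⟨a, b, hb, hab⟩ := hm.exists_inv h
  have ht : ρ t = 0 := by
    rw [← RingHom.mem_ker, hρ]; exact Ideal.mem_span_singleton_self t
  have h1 : ρ b = 1 := by
    have := congrArg ρ hab
    simpa [ht] using this
  exact hm.ne_top (Ideal.eq_top_of_isUnit_mem _ hb (hunit b (by rw [h1]; exact one_ne_zero)))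

/-- Uniqueness of the order and the unit part of an element with respect to the uniformizer `t`. -/
theorem pow_mul_unique (ht : t ≠ 0) {i j : ℤ} {u v : R} (hu : ρ u ≠ 0) (hv : ρ v ≠ 0)
    (h : (algebraMap R K t) ^ i * algebraMap R K u = (algebraMap R K t) ^ j * algebraMap R K v) :
    i = j ∧ u = v := by
  have hinj := IsFractionRing.injective R K
  have ht' : algebraMap R K t ≠ 0 := by simpa using ht
  have hρt : ρ t = 0 := by
    rw [← RingHom.mem_ker, hρ]; exact Ideal.mem_span_singleton_self t
  have key : ∀ {i j : ℤ} {u v : R}, ρ u ≠ 0 →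
      (algebraMap R K t) ^ i * algebraMap R K u = (algebraMap R K t) ^ j * algebraMap R K v →
      j ≤ i := by
    intro i j u v hu h
    by_contra! hij
    obtain ⟨n, hn⟩ := Int.eq_ofNat_of_zero_le (show 0 ≤ j - i - 1 by omega)
    have h1 : u = t ^ (n + 1) * v := by
      apply hinj
      rw [map_mul, map_pow, ← zpow_natCast, show ((n + 1 : ℕ) : ℤ) = j - i by push_cast; omega,
        zpow_sub₀ ht']
      field_simp
      rw [← h]; ring
    exact hu (by rw [h1, map_mul, map_pow, hρt]; simp)
  have hij : i = j := le_antisymm (key hv h.symm) (key hu h)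
  subst hij
  exact ⟨rfl, hinj (mul_left_cancel₀ (zpow_ne_zero i ht') h)⟩

end Generic

section Extension
open IsDedekindDomain
variable {k K F R : Type u} [Field k] [Field K] [Field F] [CommRing R] [IsDomain R]
  [Algebra R K] [IsFractionRing R K] [Algebra K F] [FiniteDimensional K F]
  [Algebra R F] [IsScalarTower R K F]

section
variable (K)
include K

theorem isFractionRing_integralClosure : IsFractionRing (integralClosure R F) F :=
  integralClosure.isFractionRing_of_finite_extension K F

variable [IsPrincipalIdealRing R] [Module.Finite R (integralClosure R F)]

theorem isDedekindDomain_integralClosure : IsDedekindDomain (integralClosure R F) :=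
  { IsNoetherianRing.of_finite R (integralClosure R F),
    Ring.DimensionLEOne.of_isIntegral R (integralClosure R F),
    (integralClosure.isIntegrallyClosedOfFiniteExtension K :
      IsIntegrallyClosed (integralClosure R F)) with }

theorem free_integralClosure : Module.Free R (integralClosure R F) := by
  have : Module.IsTorsionFree R F := .trans_faithfulSMul R K F
  have : Module.IsTorsionFree R (integralClosure R F) := IsIntegralClosure.isTorsionFree R F
  infer_instance

theorem algebraMap_norm_integralClosure (b : integralClosure R F) :
    algebraMap R K (Algebra.norm R b) = Algebra.norm K (b : F) := by
  have := free_integralClosure K (R := R) (F := F)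
  have := IsIntegralClosure.isLocalization R K F (integralClosure R F)
  exact (Algebra.norm_localization (Rₘ := K) (Sₘ := F) R (nonZeroDivisors R) b).symm

end

variable [IsPrincipalIdealRing R] [Algebra k R] [Algebra k F] [IsScalarTower k R F]

theorem finite_quotient_of_finite {B : Type*} [CommRing B] [IsDomain B] [Algebra R B] [Algebra k B]
    [IsScalarTower k R B] [Module.Finite R B] [FaithfulSMul R B]
    (hfin : ∀ a : R, a ≠ 0 → Module.Finite k (R ⧸ Ideal.span {a})) (J : Ideal B) (hJ : J ≠ ⊥) :
    Module.Finite k (B ⧸ J) := by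
  have h0 : J.under R ≠ ⊥ := by
    obtain ⟨x, hx, hx0⟩ := Submodule.exists_mem_ne_zero_of_ne_bot hJ
    exact Ideal.comap_ne_bot_of_integral_mem hx0 hx (Algebra.IsIntegral.isIntegral x)
  obtain ⟨a, ha⟩ := (IsPrincipalIdealRing.principal (J.under R)).principal
  have ha' : J.under R = Ideal.span {a} := ha
  have ha0 : a ≠ 0 := by rintro rfl; simp [ha'] at h0
  have := hfin a ha0
  rw [← ha'] at this
  have : Module.Finite (R ⧸ J.under R) (B ⧸ J) := inferInstance
  exact Module.Finite.trans (R ⧸ J.under R) (B ⧸ J)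

variable [Module.Finite R (integralClosure R F)]
  (hfin : ∀ a : R, a ≠ 0 → Module.Finite k (R ⧸ Ideal.span {a}))
include K hfin

/-- If `t` is a unit of `R`, the product of the symbols `{t, g}` over the places over `R` is the
norm of `t` on the quotient of `R` by the norm of `g`. -/
theorem finprod_symbol_unit (t : R) (τ : Fˣ) (hτ : (τ : F) = algebraMap R F t) (htu : IsUnit t)
    (g : integralClosure R F) (γ : Fˣ) (hγ : (γ : F) = g) :
    ((∏ᶠ A ∈ placesOver k F (integralClosure R F), A.symbol τ γ : kˣ) : k) =
      quotientNorm k t (Ideal.span {Algebra.norm R g}) := by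
  have := isFractionRing_integralClosure K (R := R) (F := F)
  have := isDedekindDomain_integralClosure K (R := R) (F := F)
  have := free_integralClosure K (R := R) (F := F)
  have hg : g ≠ 0 := by rintro rfl; simp at hγ
  have hord : ∀ A ∈ placesOver k F (integralClosure R F), ord A.ring τ = 0 := by
    intro A hA
    obtain ⟨s, hs⟩ := htu.exists_right_inv
    have h1 : 0 ≤ ord A.ring τ := by
      rw [ord_nonneg_iff, hτ]; exact hA (algebraMap R _ t)
    have h2 : 0 ≤ ord A.ring τ⁻¹ := by
      have h3 : ((τ⁻¹ : Fˣ) : F) = algebraMap R F s := by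
        rw [Units.val_inv_eq_inv_val, hτ, inv_eq_iff_eq_inv, eq_comm]
        exact inv_eq_of_mul_eq_one_left (by rw [← map_mul, hs, map_one])
      rw [ord_nonneg_iff, h3]; exact hA (algebraMap R _ s)
    rw [ord_inv] at h2
    omega
  rw [← quotientNorm_algebraMap hfin t hg]
  rw [← finprod_symbol_eq_quotientNorm (F := F) (finite_quotient_of_finite hfin) g
    (algebraMap R _ t) γ τ hγ hτ fun A hA _ => hord A hA]
  refine congrArg _ (finprod_mem_congr ?_ fun _ _ => rfl)
  exact Set.ext fun A => ⟨fun h => ⟨h, hord A h⟩, fun h => h.1⟩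

variable (ρ : R →ₐ[k] k) {t : R} (hρ : RingHom.ker ρ = Ideal.span {t})
  (hunit : ∀ r, ρ r ≠ 0 → IsUnit r)
include hρ hunit

omit hfin in
theorem ord_pos_of_mem_placesOver (τ : Fˣ) (hτ : (τ : F) = algebraMap R F t) {A : Place k F}
    (hA : A ∈ placesOver k F (integralClosure R F)) : 0 < ord A.ring τ := by
  have := isFractionRing_integralClosure K (R := R) (F := F)
  have := isDedekindDomain_integralClosure K (R := R) (F := F)
  obtain ⟨w, rfl⟩ := exists_placeAtPrime_eq A hA
  have h1 : 0 ≤ ord (placeAtPrime k F w).ring τ := by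
    rw [ord_nonneg_iff, hτ]; exact hA (algebraMap R _ t)
  have hmax : w.asIdeal.IsMaximal := w.isMaximal
  have h2 : t ∈ w.asIdeal.comap (algebraMap R _) :=
    have := Ideal.isMaximal_comap_of_isIntegral_of_isMaximal (R := R) w.asIdeal
    mem_of_isMaximal ρ hρ hunit _
  have h3 := (ord_placeAtPrime_ne_zero_iff (k := k) w τ (algebraMap R _ t) hτ).2 (by
    rw [Ideal.span_singleton_le_iff_mem]; exact h2)
  omega

/-- For a discrete valuation ring `R` with uniformizer `t` and residue field `k`, the product of the
symbols `{t, γ}` over the places over `R` is determined by the order `m` and the leading coefficient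
`c` of the norm of `γ`. -/
theorem finprod_symbol_zeros (ht : t ≠ 0) (τ : Fˣ) (hτ : (τ : F) = algebraMap R F t) (γ : Fˣ)
    (m : ℤ) (h : R) (c : kˣ) (hN : Algebra.norm K (γ : F) = algebraMap R K t ^ m * algebraMap R K h)
    (hc : ρ h = c) :
    ∏ᶠ A ∈ placesOver k F (integralClosure R F), A.symbol τ γ = (-1) ^ m * c⁻¹ := by
  have := isFractionRing_integralClosure K (R := R) (F := F)
  have := isDedekindDomain_integralClosure K (R := R) (F := F)
  have := free_integralClosure K (R := R) (F := F)
  have ht0 : Ideal.span {t} ≠ (⊥ : Ideal R) := by simpa using ht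
  have htm : (Ideal.span {t}).IsMaximal := by
    rw [← hρ]; exact RingHom.ker_isMaximal_of_surjective ρ fun c => ⟨algebraMap k R c, ρ.commutes c⟩
  -- a Dedekind domain with finitely many primes is a principal ideal domain
  have : IsPrincipalIdealRing (integralClosure R F) := by
    refine IsPrincipalIdealRing.of_finite_maximals
      ((IsDedekindDomain.primesOver_finite (Ideal.span {t}) (integralClosure R F)).subset ?_)
    intro P (hP : P.IsMaximal)
    refine ⟨hP.isPrime, ⟨?_⟩⟩
    have hm := Ideal.isMaximal_comap_of_isIntegral_of_isMaximal (R := R) P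
    exact htm.eq_of_le hm.ne_top
      ((Ideal.span_singleton_le_iff_mem _).2 (mem_of_isMaximal ρ hρ hunit _))
  have hfinB := finite_quotient_of_finite (B := integralClosure R F) hfin
  obtain ⟨a, b, hb, hab⟩ := IsFractionRing.div_surjective (integralClosure R F) (γ : F)
  have hb0 : (b : F) ≠ 0 := by
    simpa using nonZeroDivisors.ne_zero hb
  have ha0 : (a : F) ≠ 0 := by
    intro h0
    have : (γ : F) = 0 := by rw [← hab]; exact (div_eq_zero_iff.2 (Or.inl h0))
    simp at this
  have hab' : (γ : F) = a / b := hab.symm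
  obtain ⟨m₁, h₁, c₁, hN₁, hc₁, hp₁⟩ := finprod_symbol_uniformizer (F := F) ρ t hρ hunit hfinB τ hτ
    a (Units.mk0 (a : F) ha0) rfl
  obtain ⟨m₂, h₂, c₂, hN₂, hc₂, hp₂⟩ := finprod_symbol_uniformizer (F := F) ρ t hρ hunit hfinB τ hτ
    b (Units.mk0 (b : F) hb0) rfl
  have hγ : Units.mk0 (a : F) ha0 = γ * Units.mk0 (b : F) hb0 :=
    Units.ext (by rw [Units.val_mul, hab']; exact (div_mul_cancel₀ _ hb0).symm)
  have htK : algebraMap R K t ≠ 0 := by simpa using ht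
  have h3 : algebraMap R K t ^ (m₁ : ℤ) * algebraMap R K h₁ =
      algebraMap R K t ^ (m + m₂ : ℤ) * algebraMap R K (h * h₂) := by
    have h4 : Algebra.norm K (a : F) = Algebra.norm K (γ : F) * Algebra.norm K (b : F) := by
      rw [← map_mul]; exact congrArg (Algebra.norm K) (congrArg Units.val hγ)
    rw [← algebraMap_norm_integralClosure, ← algebraMap_norm_integralClosure, hN₁, hN₂, hN] at h4
    rw [map_mul, map_mul, map_pow, map_pow] at h4
    rw [zpow_add₀ htK, zpow_natCast, zpow_natCast, h4, map_mul]
    ring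
  obtain ⟨h5, h6⟩ := pow_mul_unique ρ hρ ht (by rw [hc₁]; exact c₁.ne_zero)
    (by rw [map_mul, hc, hc₂]; exact (c * c₂).ne_zero) h3
  have h7 : c₁ = c * c₂ := Units.ext (by rw [← hc₁, h6, map_mul, hc, hc₂, Units.val_mul])
  rw [hγ, finprod_symbol_mul, hp₂, h7] at hp₁
  rw [← zpow_natCast, ← zpow_natCast, h5, zpow_add] at hp₁
  rw [← mul_left_inj ((-1) ^ (m₂ : ℤ) * c₂⁻¹), hp₁, mul_inv]
  ac_rfl

end Extension

/-! ### Zeros and units of the coordinate of the affine line -/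

section Polynomial
open Polynomial

section Base
variable {k R : Type*} [Field k] [CommRing R] [Algebra k[X] R] [Algebra k R]
  [IsScalarTower k k[X] R]

/-- Evaluation at the origin on the local ring of the affine line at the origin. -/
theorem exists_evalZero [IsLocalization ((nonZeroDivisors k).comap (constantCoeff (R := k))) R] :
    ∃ ρ : R →ₐ[k] k, (∀ p : k[X], ρ (algebraMap k[X] R p) = p.coeff 0) ∧
      RingHom.ker ρ = Ideal.span {algebraMap k[X] R X} ∧ ∀ r, ρ r ≠ 0 → IsUnit r := by
  set M := (nonZeroDivisors k).comap (constantCoeff (R := k)) with hM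
  have hu : ∀ m : M, IsUnit (constantCoeff (m : k[X])) := fun m =>
    (nonZeroDivisors.ne_zero m.2).isUnit
  let ρ₀ : R →+* k := IsLocalization.lift hu
  have h0 : ∀ p, ρ₀ (algebraMap k[X] R p) = p.coeff 0 := fun p => IsLocalization.lift_eq hu p
  let ρ : R →ₐ[k] k := { ρ₀ with
    commutes' := fun c => by
      change ρ₀ (algebraMap k R c) = c
      rw [IsScalarTower.algebraMap_apply k k[X] R, h0]; simp }
  have hρ : ∀ p, ρ (algebraMap k[X] R p) = p.coeff 0 := h0
  have hsurj : ∀ r : R, ∃ (p : k[X]) (m : M), r * algebraMap k[X] R m = algebraMap k[X] R p ∧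
      (ρ r = 0 ↔ p.coeff 0 = 0) := by
    intro r
    obtain ⟨⟨p, m⟩, hp⟩ := IsLocalization.surj M r
    refine ⟨p, m, hp, ?_⟩
    have := congrArg ρ hp
    rw [map_mul, hρ, hρ] at this
    rw [← this]
    have hm : (m : k[X]).coeff 0 ≠ 0 := nonZeroDivisors.ne_zero m.2
    simp [hm]
  refine ⟨ρ, hρ, ?_, ?_⟩
  · ext r
    obtain ⟨p, m, hp, hr⟩ := hsurj r
    rw [RingHom.mem_ker, Ideal.mem_span_singleton]
    constructor
    · intro h
      rw [← (IsLocalization.map_units R m).dvd_mul_right, hp]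
      exact map_dvd _ (X_dvd_iff.2 (hr.1 h))
    · rintro ⟨y, rfl⟩
      rw [map_mul, hρ]; simp
  · intro r h
    obtain ⟨p, m, hp, hr⟩ := hsurj r
    have hpM : p ∈ M := mem_nonZeroDivisors_of_ne_zero (fun h0 => h (hr.2 h0))
    have := IsLocalization.map_units R (⟨p, hpM⟩ : M)
    rw [← hp] at this
    exact isUnit_of_mul_isUnit_left this

end Base

variable {k K F R : Type u} [Field k] [Field K] [Field F] [Algebra k[X] F] [Algebra k F]
  [IsScalarTower k k[X] F] (τ : Fˣ) (hτ : (τ : F) = algebraMap k[X] F X)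
include hτ

theorem algebraMap_polynomial_mem {A : Place k F} (hA : 0 ≤ ord A.ring τ) (p : k[X]) :
    algebraMap k[X] F p ∈ A.ring := by
  rw [ord_nonneg_iff, hτ] at hA
  induction p using Polynomial.induction_on' with
  | add a b ha hb => rw [map_add]; exact add_mem ha hb
  | monomial m c =>
    rw [← C_mul_X_pow_eq_monomial, map_mul, map_pow]
    have hc := A.algebraMap_mem c
    rw [IsScalarTower.algebraMap_apply k k[X] F] at hc
    exact mul_mem hc (pow_mem hA m)

variable [PerfectField k] [Algebra k[X] K] [IsFractionRing k[X] K] [Algebra K F]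
  [FiniteDimensional K F] [IsScalarTower k[X] K F] [CommRing R] [IsDomain R] [Algebra k[X] R]
  [Algebra k R] [IsScalarTower k k[X] R]
  [Algebra R K] [IsFractionRing R K] [Algebra R F] [IsScalarTower R K F] [IsScalarTower k R F]
  [IsScalarTower k[X] R F]

include K in
/-- The places over the local ring of the affine line at the origin are the zeros of the
coordinate. -/
theorem placesOver_zeros [IsLocalization ((nonZeroDivisors k).comap (constantCoeff (R := k))) R] :
    placesOver k F (integralClosure R F) = {A : Place k F | 0 < ord A.ring τ} := by
  ext A
  constructor
  · intro hA
    have : IsPrincipalIdealRing R := isPrincipalIdealRing_of_isLocalization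
      ((nonZeroDivisors k).comap (constantCoeff (R := k)))
    have : Module.Finite k[X] (integralClosure k[X] F) :=
      finite_integralClosure_polynomial (K := K)
    have : Module.Finite R (integralClosure R F) :=
      finite_integralClosure_of_isLocalization (A := k[X])
        ((nonZeroDivisors k).comap (constantCoeff (R := k)))
    obtain ⟨ρ, -, hρ, hunit⟩ := exists_evalZero (k := k) (R := R)
    exact ord_pos_of_mem_placesOver (K := K) ρ hρ hunit τ
      (by rw [hτ, IsScalarTower.algebraMap_apply k[X] R F]) hA
  · intro (hA : 0 < ord A.ring τ)
    refine mem_placesOver_integralClosure fun r => ?_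
    obtain ⟨⟨p, m⟩, hp⟩ := IsLocalization.surj
      ((nonZeroDivisors k).comap (constantCoeff (R := k))) r
    dsimp only at hp
    have hp' : algebraMap R F r * algebraMap k[X] F m = algebraMap k[X] F p := by
      rw [IsScalarTower.algebraMap_apply k[X] R F, ← map_mul, hp,
        ← IsScalarTower.algebraMap_apply]
    have hm : A.ring.valuation (algebraMap k[X] F m) = 1 := by
      obtain ⟨q, hq⟩ : (X : k[X]) ∣ (m : k[X]) - C ((m : k[X]).coeff 0) := X_dvd_iff.2 (by simp)
      have h1 : algebraMap k[X] F m =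
          algebraMap k[X] F (C ((m : k[X]).coeff 0)) + τ * algebraMap k[X] F q := by
        rw [hτ, ← map_mul, ← map_add, ← hq]; congr 1; ring
      have hc : ∀ c : k, c ≠ 0 → A.ring.valuation (algebraMap k[X] F (C c)) = 1 := by
        intro c hc
        have h2 : ∀ c : k, A.ring.valuation (algebraMap k[X] F (C c)) ≤ 1 := fun c =>
          (A.ring.valuation_le_one_iff _).2 (algebraMap_polynomial_mem τ hτ hA.le _)
        refine le_antisymm (h2 c) ?_
        have h3 : A.ring.valuation (algebraMap k[X] F (C c)) *
            A.ring.valuation (algebraMap k[X] F (C c⁻¹)) = 1 := by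
          rw [← map_mul, ← map_mul, ← C_mul, mul_inv_cancel₀ hc]; simp
        rw [← h3]
        exact mul_le_of_le_one_right' (h2 _)
      have h2 : A.ring.valuation (τ * algebraMap k[X] F q) < 1 := by
        rw [map_mul]
        exact mul_lt_one_of_lt_of_le ((ord_pos_iff A.ring).1 hA)
          ((A.ring.valuation_le_one_iff _).2 (algebraMap_polynomial_mem τ hτ hA.le _))
      have hm0 : (m : k[X]).coeff 0 ≠ 0 := nonZeroDivisors.ne_zero m.2
      rw [h1, Valuation.map_add_eq_of_lt_left _ (by rw [hc _ hm0]; exact h2), hc _ hm0]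
    rw [← A.ring.valuation_le_one_iff]
    have := congrArg A.ring.valuation hp'
    rw [map_mul, hm, mul_one] at this
    rw [this]
    exact (A.ring.valuation_le_one_iff _).2 (algebraMap_polynomial_mem τ hτ hA.le _)

variable [IsScalarTower k[X] R K]

/-- The zeros of the coordinate `τ`: they are finite in number, they have finite residue fields,
and the product of the symbols `{τ, γ}` over them is read off the norm of `γ`, namely from its order
`m` and leading coefficient `c` at the origin. -/
theorem finprod_symbol_zeros_polynomial
    [IsLocalization ((nonZeroDivisors k).comap (constantCoeff (R := k))) R] (γ : Fˣ) (m : ℤ)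
    (h : k[X]) (c : kˣ) (hN : Algebra.norm K (γ : F) =
      algebraMap k[X] K X ^ m * algebraMap k[X] K h) (hc : h.coeff 0 = c) :
    {A : Place k F | 0 < ord A.ring τ}.Finite ∧
      (∀ A : Place k F, 0 < ord A.ring τ → A.residueMap.Finite) ∧
      ∏ᶠ A ∈ {A : Place k F | 0 < ord A.ring τ}, A.symbol τ γ = (-1) ^ m * c⁻¹ := by
  have : IsPrincipalIdealRing R := isPrincipalIdealRing_of_isLocalization
    ((nonZeroDivisors k).comap (constantCoeff (R := k)))
  have : Module.Finite k[X] (integralClosure k[X] F) :=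
    finite_integralClosure_polynomial (K := K)
  have : Module.Finite R (integralClosure R F) :=
    finite_integralClosure_of_isLocalization (A := k[X])
      ((nonZeroDivisors k).comap (constantCoeff (R := k)))
  obtain ⟨ρ, hρ0, hρ, hunit⟩ := exists_evalZero (k := k) (R := R)
  have hτ' : (τ : F) = algebraMap R F (algebraMap k[X] R X) := by
    rw [hτ, IsScalarTower.algebraMap_apply k[X] R F]
  have ht : algebraMap k[X] R X ≠ 0 := by
    intro h0
    rw [h0, map_zero] at hτ'
    exact τ.ne_zero hτ'
  have hset := placesOver_zeros (K := K) (R := R) τ hτ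
  constructor
  · have := isFractionRing_integralClosure K (R := R) (F := F)
    have := isDedekindDomain_integralClosure K (R := R) (F := F)
    refine (finite_setOf_ord_ne_zero_placesOver (k := k) (integralClosure R F) τ).subset ?_
    intro A hA
    exact ⟨by rw [hset]; exact hA, (show 0 < ord A.ring τ from hA).ne'⟩
  constructor
  · intro A hA
    have := isFractionRing_integralClosure K (R := R) (F := F)
    have := isDedekindDomain_integralClosure K (R := R) (F := F)
    have hA' : A ∈ placesOver k F (integralClosure R F) := by rw [hset]; exact hA
    obtain ⟨v, rfl⟩ := exists_placeAtPrime_eq A hA'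
    have : Module.IsTorsionFree R (integralClosure R F) :=
      have : Module.IsTorsionFree R F := .trans_faithfulSMul R K F
      IsIntegralClosure.isTorsionFree R F
    have := finite_quotient_of_finite (k := k) (R := R) (fun a ha =>
      finite_quotient_of_isLocalization ((nonZeroDivisors k).comap (constantCoeff (R := k))) ha)
      v.asIdeal v.ne_bot
    exact residueMap_placeAtPrime_finite v
  · rw [← hset]
    refine finprod_symbol_zeros (K := K) (fun a ha => finite_quotient_of_isLocalization
      ((nonZeroDivisors k).comap (constantCoeff (R := k))) ha) ρ hρ hunit ht τ hτ' γ m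
      (algebraMap k[X] R h) c ?_ (by rw [hρ0, hc])
    rw [hN, IsScalarTower.algebraMap_apply k[X] R K, IsScalarTower.algebraMap_apply k[X] R K]

/-- The places at which the coordinate `τ` is a unit lie over the ring of Laurent polynomials. The
product of the symbols `{τ, γ}` over them is the norm of `X` on its quotient by the norm of `γ`,
that is, the product of the nonzero roots of that norm. -/
theorem finprod_symbol_units_polynomial [IsLocalization.Away (X : k[X]) R] (γ : Fˣ)
    (hγ : IsIntegral k[X] (γ : F)) (m : ℕ) (h : k[X])
    (hN : Algebra.norm K (γ : F) = algebraMap k[X] K X ^ m * algebraMap k[X] K h)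
    (hc : h.coeff 0 ≠ 0) :
    {A : Place k F | ord A.ring τ = 0 ∧ A.symbol τ γ ≠ 1}.Finite ∧
      ((∏ᶠ A ∈ {A : Place k F | ord A.ring τ = 0}, A.symbol τ γ : kˣ) : k) =
        (-1) ^ h.natDegree * (h.coeff 0 / h.leadingCoeff) := by
  have : IsPrincipalIdealRing R := isPrincipalIdealRing_of_isLocalization
    (Submonoid.powers (X : k[X]))
  have : Module.Finite k[X] (integralClosure k[X] F) :=
    finite_integralClosure_polynomial (K := K)
  have : Module.Finite R (integralClosure R F) :=
    finite_integralClosure_of_isLocalization (A := k[X]) (Submonoid.powers (X : k[X]))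
  have hτ' : (τ : F) = algebraMap R F (algebraMap k[X] R X) := by
    rw [hτ, IsScalarTower.algebraMap_apply k[X] R F]
  have hu : IsUnit (algebraMap k[X] R X) := IsLocalization.Away.algebraMap_isUnit X
  obtain ⟨y, hy⟩ := hu.exists_right_inv
  have hτy : ((τ⁻¹ : Fˣ) : F) = algebraMap R F y := by
    rw [Units.val_inv_eq_inv_val, hτ', inv_eq_iff_eq_inv, eq_comm]
    exact inv_eq_of_mul_eq_one_left (by rw [← map_mul, hy, map_one])
  have hset : placesOver k F (integralClosure R F) = {A : Place k F | ord A.ring τ = 0} := by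
    ext A
    constructor
    · intro hA
      have h1 : 0 ≤ ord A.ring τ := by rw [ord_nonneg_iff, hτ']; exact hA (algebraMap R _ _)
      have h2 : 0 ≤ ord A.ring τ⁻¹ := by rw [ord_nonneg_iff, hτy]; exact hA (algebraMap R _ y)
      rw [ord_inv] at h2
      exact le_antisymm (by omega) h1
    · intro (hA : ord A.ring τ = 0)
      refine mem_placesOver_integralClosure fun r => ?_
      obtain ⟨n, p, hp⟩ := IsLocalization.Away.surj (X : k[X]) r
      have h1 : algebraMap R F r = (τ⁻¹ : Fˣ) ^ n * algebraMap k[X] F p := by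
        rw [IsScalarTower.algebraMap_apply k[X] R F, ← hp, map_mul, map_pow, ← hτ',
          Units.val_inv_eq_inv_val, inv_pow, mul_comm, mul_assoc, mul_inv_cancel₀, mul_one]
        exact pow_ne_zero _ τ.ne_zero
      rw [h1]
      refine mul_mem (pow_mem ?_ n) (algebraMap_polynomial_mem τ hτ hA.ge p)
      rw [← ord_nonneg_iff, ord_inv, hA, neg_zero]
  constructor
  · have := isFractionRing_integralClosure K (R := R) (F := F)
    have := isDedekindDomain_integralClosure K (R := R) (F := F)
    refine (finite_mulSupport_symbol (k := k) (B := integralClosure R F) τ γ).subset ?_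
    intro A hA
    exact ⟨by rw [hset]; exact hA.1, hA.2⟩
  · rw [← hset]
    rw [finprod_symbol_unit (K := K) (fun a ha => finite_quotient_of_isLocalization
      (Submonoid.powers (X : k[X])) ha) (algebraMap k[X] R X) τ hτ' hu ⟨γ, hγ.tower_top⟩ γ rfl]
    have h1 : Algebra.norm R (⟨γ, hγ.tower_top⟩ : integralClosure R F) =
        algebraMap k[X] R X ^ m * algebraMap k[X] R h := by
      apply IsFractionRing.injective R K
      rw [algebraMap_norm_integralClosure, hN, map_mul, map_pow,
        ← IsScalarTower.algebraMap_apply, ← IsScalarTower.algebraMap_apply]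
    rw [h1, Ideal.span_singleton_mul_left_unit (hu.pow m), quotientNorm_X h hc]

end Polynomial

/-! ### Reciprocity on a function field -/

section Reciprocity
open Polynomial

/-- `x` generates the field `K` over `k`, and is transcendental over `k`. -/
def IsGenerator (k : Type*) {K : Type*} [Field k] [Field K] [Algebra k K] (x : K) : Prop :=
  Transcendental k x ∧ ∀ z : K, ∃ p q : k[X], z = aeval x p / aeval x q

variable {k K F : Type u} [Field k] [PerfectField k] [Field K] [Field F] [Algebra k K]
  [Algebra K F] [Algebra k F] [IsScalarTower k K F] [FiniteDimensional K F]

theorem aeval_eq_pow_mul_aeval_reverse {k K : Type*} [Field k] [Field K] [Algebra k K] {x : K}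
    (hx : x ≠ 0) (p : k[X]) : aeval x p = x ^ p.natDegree * aeval x⁻¹ p.reverse := by
  have := invertibleOfNonzero hx
  have h := eval₂_reverse_mul_pow (algebraMap k K) x p
  rw [invOf_eq_inv] at h
  rw [aeval_def, aeval_def, ← h, mul_comm]

theorem IsGenerator.ne_zero {k K : Type*} [Field k] [Field K] [Algebra k K] {x : K}
    (hx : IsGenerator k x) : x ≠ 0 := by
  rintro rfl
  exact hx.1 (isAlgebraic_zero)

theorem IsGenerator.inv {k K : Type*} [Field k] [Field K] [Algebra k K] {x : K}
    (hx : IsGenerator k x) : IsGenerator k x⁻¹ := by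
  refine ⟨fun h => hx.1 (by simpa using h.inv), fun z => ?_⟩
  obtain ⟨p, q, rfl⟩ := hx.2 z
  refine ⟨p.reverse * X ^ q.natDegree, q.reverse * X ^ p.natDegree, ?_⟩
  have h0 := hx.ne_zero
  rw [aeval_eq_pow_mul_aeval_reverse h0 p, aeval_eq_pow_mul_aeval_reverse h0 q]
  simp only [map_mul, map_pow, aeval_X, inv_pow]
  by_cases hq : aeval x⁻¹ q.reverse = 0
  · simp [hq]
  field_simp

theorem IsGenerator.isFractionRing {k K : Type*} [Field k] [Field K] [Algebra k K] {x : K}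
    (hx : IsGenerator k x) : @IsFractionRing k[X] _ K _ (aeval x).toRingHom.toAlgebra := by
  let _ := (aeval (R := k) x).toRingHom.toAlgebra
  have : FaithfulSMul k[X] K := (faithfulSMul_iff_algebraMap_injective _ _).2
    (transcendental_iff_injective.1 hx.1)
  exact IsFractionRing.of_field k[X] K fun z => by
    obtain ⟨p, q, h⟩ := hx.2 z
    exact ⟨p, q, h⟩

/-- `finprod_symbol_zeros_polynomial` for a subfield `k(x)` of `F` with a chosen generator. It is
applied to `x` and to `x⁻¹`, whose zeros are the poles of `x`. -/
theorem finprod_symbol_zeros_of_isGenerator {x : K} (hx : IsGenerator k x) (τ : Fˣ)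
    (hτ : (τ : F) = algebraMap K F x) (γ : Fˣ) (m : ℤ) (h : k[X]) (c : kˣ)
    (hN : Algebra.norm K (γ : F) = x ^ m * aeval x h) (hc : h.coeff 0 = c) :
    {A : Place k F | 0 < ord A.ring τ}.Finite ∧
      (∀ A : Place k F, 0 < ord A.ring τ → A.residueMap.Finite) ∧
      ∏ᶠ A ∈ {A : Place k F | 0 < ord A.ring τ}, A.symbol τ γ = (-1) ^ m * c⁻¹ := by
  let _ := (aeval (R := k) x).toRingHom.toAlgebra
  let _ : Algebra k[X] F := ((algebraMap K F).comp (aeval (R := k) x).toRingHom).toAlgebra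
  have := hx.isFractionRing
  have : IsScalarTower k[X] K F := IsScalarTower.of_algebraMap_eq fun _ => rfl
  have : IsScalarTower k k[X] K := IsScalarTower.of_algebraMap_eq fun c => (aeval_C x c).symm
  have : IsScalarTower k k[X] F := IsScalarTower.of_algebraMap_eq fun c => by
    rw [IsScalarTower.algebraMap_apply k K F, IsScalarTower.algebraMap_apply k k[X] K]; rfl
  let M := (nonZeroDivisors k).comap (constantCoeff (R := k))
  have hM : M ≤ nonZeroDivisors k[X] := fun q hq => mem_nonZeroDivisors_of_ne_zero (by
    rintro rfl
    exact nonZeroDivisors.ne_zero hq (map_zero _))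
  let R := Localization.subalgebra.ofField K M hM
  have hxX : algebraMap k[X] K X = x := aeval_X x
  exact finprod_symbol_zeros_polynomial (K := K) (R := R) τ (by rw [hτ, ← hxX]; rfl) γ m h c
    (by rw [hxX, hN]; rfl) hc

/-- The reciprocity law for a transcendental `x` and a function `γ` that is integral over `k[x]`. -/
theorem finprod_symbol_of_isIntegral {x : K} (hx : IsGenerator k x) (τ : Fˣ)
    (hτ : (τ : F) = algebraMap K F x) (γ : Fˣ)
    (hγ : ((algebraMap K F).comp (aeval (R := k) x).toRingHom).IsIntegralElem (γ : F)) :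
    {A : Place k F | A.symbol τ γ ≠ 1}.Finite ∧ ∏ᶠ A : Place k F, A.symbol τ γ = 1 := by
  let _ := (aeval (R := k) x).toRingHom.toAlgebra
  let _ : Algebra k[X] F := ((algebraMap K F).comp (aeval (R := k) x).toRingHom).toAlgebra
  have := hx.isFractionRing
  have : IsScalarTower k[X] K F := IsScalarTower.of_algebraMap_eq fun _ => rfl
  have : IsScalarTower k k[X] K := IsScalarTower.of_algebraMap_eq fun c => (aeval_C x c).symm
  have : IsScalarTower k k[X] F := IsScalarTower.of_algebraMap_eq fun c => by
    rw [IsScalarTower.algebraMap_apply k K F, IsScalarTower.algebraMap_apply k k[X] K]; rfl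
  have hxX : algebraMap k[X] K X = x := aeval_X x
  have hinj := IsFractionRing.injective k[X] K
  have hx0 := hx.ne_zero
  -- the norm of `γ` is a polynomial in `x`, namely `x ^ m * h₁` with `h₁` prime to `x`
  have hint : IsIntegral k[X] (γ : F) := hγ
  obtain ⟨h, hh⟩ := IsIntegrallyClosed.isIntegral_iff.1 (Algebra.isIntegral_norm K hint)
  have hh0 : h ≠ 0 := by
    rintro rfl
    rw [map_zero, eq_comm, Algebra.norm_eq_zero_iff] at hh
    exact γ.ne_zero hh
  obtain ⟨h₁, hX, hm⟩ :=
    (FiniteMultiplicity.of_prime_left prime_X hh0).exists_eq_pow_mul_and_not_dvd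
  set m := multiplicity X h
  have ha : h₁.coeff 0 ≠ 0 := fun h0 => hm (X_dvd_iff.2 h0)
  have hl : h₁.leadingCoeff ≠ 0 := leadingCoeff_ne_zero.2 (by rintro rfl; simp at ha)
  have hN : Algebra.norm K (γ : F) = x ^ m * aeval x h₁ := by
    rw [← hh, hX, map_mul, map_pow, hxX]; rfl
  set e := h₁.natDegree with he
  obtain ⟨hf1, -, hp1⟩ := finprod_symbol_zeros_of_isGenerator hx τ hτ γ m h₁ (Units.mk0 _ ha)
    (by rw [hN, zpow_natCast]) rfl
  -- in terms of `x⁻¹` the norm is `(x⁻¹) ^ (-(m + e))` times the reversed polynomial of `h₁`, whose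
  -- constant term is the leading coefficient of `h₁`
  obtain ⟨hf2, -, hp2⟩ := finprod_symbol_zeros_of_isGenerator hx.inv τ⁻¹
    (by rw [Units.val_inv_eq_inv_val, hτ, map_inv₀]) γ (-(m + e : ℤ)) h₁.reverse (Units.mk0 _ hl)
    (by
      rw [hN, aeval_eq_pow_mul_aeval_reverse hx0, zpow_neg, inv_zpow, inv_inv, zpow_add₀ hx0,
        zpow_natCast, zpow_natCast, mul_assoc]) (by rw [coeff_zero_reverse]; rfl)
  have hX0 : Submonoid.powers (X : k[X]) ≤ nonZeroDivisors k[X] :=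
    Submonoid.powers_le.2 (mem_nonZeroDivisors_of_ne_zero X_ne_zero)
  let R := Localization.subalgebra.ofField K (Submonoid.powers (X : k[X])) hX0
  have : IsLocalization.Away (X : k[X]) R :=
    inferInstanceAs (IsLocalization (Submonoid.powers (X : k[X])) _)
  obtain ⟨hf0, hp0⟩ := finprod_symbol_units_polynomial (K := K) (R := R) τ
    (by rw [hτ, ← hxX]; rfl) γ hint m h₁ (by rw [hxX, hN]; rfl) ha
  have hp2' : ∏ᶠ A ∈ {A : Place k F | 0 < ord A.ring τ⁻¹}, A.symbol τ γ =
      (-1) ^ (m + e) * Units.mk0 _ hl := by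
    have h1 : ∏ᶠ A ∈ {A : Place k F | 0 < ord A.ring τ⁻¹}, A.symbol τ γ =
        (∏ᶠ A ∈ {A : Place k F | 0 < ord A.ring τ⁻¹}, A.symbol τ⁻¹ γ)⁻¹ := by
      simp only [← finprod_inv_distrib]
      exact finprod_mem_congr rfl fun A _ => by rw [A.symbol_inv_left, inv_inv]
    rw [h1, hp2, mul_inv, inv_inv, zpow_neg, inv_inv]
    norm_cast
  have hu : (Set.univ : Set (Place k F)) = {A | 0 < ord A.ring τ} ∪ {A | ord A.ring τ = 0} ∪
      {A | 0 < ord A.ring τ⁻¹} := by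
    ext A
    simp only [Set.mem_univ, Set.mem_union, Set.mem_ofPred_eq, ord_inv, true_iff]
    omega
  have hd1 : Disjoint {A : Place k F | 0 < ord A.ring τ} {A | ord A.ring τ = 0} :=
    Set.disjoint_left.2 fun A (h1 : 0 < ord A.ring τ) (h2 : ord A.ring τ = 0) => by omega
  have hd2 : Disjoint ({A : Place k F | 0 < ord A.ring τ} ∪ {A | ord A.ring τ = 0})
      {A | 0 < ord A.ring τ⁻¹} := by
    refine Set.disjoint_left.2 fun A h1 (h2 : 0 < ord A.ring τ⁻¹) => ?_
    rw [ord_inv] at h2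
    rcases h1 with (h1 : 0 < ord A.ring τ) | (h1 : ord A.ring τ = 0) <;> omega
  constructor
  · refine ((hf1.union hf0).union hf2).subset fun A hA => ?_
    have hAu : A ∈ (Set.univ : Set (Place k F)) := trivial
    rw [hu] at hAu
    rcases hAu with (h1 | h1) | h1
    · exact Or.inl (Or.inl h1)
    · exact Or.inl (Or.inr ⟨h1, hA⟩)
    · exact Or.inr h1
  · rw [← finprod_mem_univ, hu, finprod_mem_union' hd2 _ (hf2.inter_of_left _),
      finprod_mem_union' hd1 (hf1.inter_of_left _) (hf0.subset fun A hA => hA), hp1, hp2']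
    -- with `a` the constant and `l` the leading coefficient of `h₁`, the zeros contribute
    -- `(-1) ^ m / a`, the units `(-1) ^ e * a / l`, and the poles `(-1) ^ (m + e) * l`
    · apply Units.ext
      push_cast
      rw [hp0, ← he, zpow_natCast, pow_add, Units.val_mk0, Units.val_mk0]
      have h1 : ∀ n, ((-1 : k) ^ n) * (-1) ^ n = 1 := fun n => by rw [← mul_pow]; simp
      rw [show ∀ s r a l : k, s * a⁻¹ * (r * (a / l)) * (s * r * l) =
        (s * s) * (r * r) * (a⁻¹ * a) * (l⁻¹ * l) from fun s r a l => by ring, h1, h1,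
        inv_mul_cancel₀ ha, inv_mul_cancel₀ hl]
      simp
    · refine (hf1.union hf0).subset ?_
      rintro A ⟨h1 | h1, h2⟩
      · exact Or.inl h1
      · exact Or.inr ⟨h1, h2⟩

/-- The integrality of `γ` is removed by writing `γ` as a quotient of functions integral over
`k[x]`. -/
theorem finprod_symbol_of_isGenerator {x : K} (hx : IsGenerator k x) (τ : Fˣ)
    (hτ : (τ : F) = algebraMap K F x) (γ : Fˣ) :
    {A : Place k F | A.symbol τ γ ≠ 1}.Finite ∧ ∏ᶠ A : Place k F, A.symbol τ γ = 1 := by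
  let _ := (aeval (R := k) x).toRingHom.toAlgebra
  let _ : Algebra k[X] F := ((algebraMap K F).comp (aeval (R := k) x).toRingHom).toAlgebra
  have := hx.isFractionRing
  have : IsScalarTower k[X] K F := IsScalarTower.of_algebraMap_eq fun _ => rfl
  have := isFractionRing_integralClosure K (R := k[X]) (F := F)
  obtain ⟨a, b, hb, hab⟩ := IsFractionRing.div_surjective (integralClosure k[X] F) (γ : F)
  have hb0 : (b : F) ≠ 0 := by simpa using nonZeroDivisors.ne_zero hb
  have ha0 : (a : F) ≠ 0 := by
    intro h0
    have : (γ : F) = 0 := by rw [← hab]; exact (div_eq_zero_iff.2 (Or.inl h0))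
    simp at this
  have hγ : Units.mk0 (a : F) ha0 = γ * Units.mk0 (b : F) hb0 :=
    Units.ext (by rw [Units.val_mul, ← hab]; exact (div_mul_cancel₀ _ hb0).symm)
  obtain ⟨hfa, hpa⟩ := finprod_symbol_of_isIntegral hx τ hτ (Units.mk0 (a : F) ha0) a.2
  obtain ⟨hfb, hpb⟩ := finprod_symbol_of_isIntegral hx τ hτ (Units.mk0 (b : F) hb0) b.2
  have hmul : ∀ A : Place k F, A.symbol τ (Units.mk0 (a : F) ha0) =
      A.symbol τ γ * A.symbol τ (Units.mk0 (b : F) hb0) := fun A => by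
    rw [hγ, A.symbol_mul_right]
  have hf : {A : Place k F | A.symbol τ γ ≠ 1}.Finite := by
    refine (hfa.union hfb).subset fun A (hA : _ ≠ _) => ?_
    by_contra! h
    simp only [Set.mem_union, Set.mem_ofPred_eq, not_or, not_not] at h
    rw [hmul, h.2, mul_one] at h
    exact hA h.1
  refine ⟨hf, ?_⟩
  have := finprod_mul_distrib (f := fun A : Place k F => A.symbol τ γ)
    (g := fun A : Place k F => A.symbol τ (Units.mk0 (b : F) hb0)) hf hfb
  simp only [← hmul] at this
  rw [hpa, hpb, mul_one] at this
  exact this.symm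

open IntermediateField in
theorem isGenerator_gen {k F : Type*} [Field k] [Field F] [Algebra k F] {t : F}
    (ht : Transcendental k t) : IsGenerator k (AdjoinSimple.gen k t) := by
  refine ⟨fun h => ht ?_, fun z => ?_⟩
  · have := h.algebraMap (A := F)
    rwa [AdjoinSimple.algebraMap_gen] at this
  · obtain ⟨p, q, h⟩ := (mem_adjoin_simple_iff k (z : F)).1 z.2
    refine ⟨p, q, (algebraMap k⟮t⟯ F).injective ?_⟩
    rw [map_div₀, ← aeval_algebraMap_apply, ← aeval_algebraMap_apply, AdjoinSimple.algebraMap_gen]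
    exact h

/-- A valuation ring containing `k` is integrally closed, so that it contains every algebraic
element and its inverse. -/
theorem ord_eq_zero_of_isAlgebraic {k F : Type u} [Field k] [Field F] [Algebra k F] (A : Place k F)
    {f : Fˣ} (hf : IsAlgebraic k (f : F)) : ord A.ring f = 0 := by
  have key : ∀ g : Fˣ, IsAlgebraic k (g : F) → 0 ≤ ord A.ring g := by
    intro g hg
    let _ : Algebra k A.ring :=
      ((algebraMap k F).codRestrict A.ring.toSubring A.algebraMap_mem).toAlgebra
    have : IsScalarTower k A.ring F := IsScalarTower.of_algebraMap_eq fun _ => rfl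
    obtain ⟨x, hx⟩ := IsIntegrallyClosed.isIntegral_iff.1 (hg.isIntegral.tower_top (A := A.ring))
    rw [ord_nonneg_iff, ← hx]
    exact x.2
  have h1 := key f hf
  have h2 := key f⁻¹ (by rw [Units.val_inv_eq_inv_val]; exact hf.inv)
  rw [ord_inv] at h2
  omega

open IntermediateField in
/-- The reciprocity law for a field `F` that is finite over `k(t)` for every transcendental `t`,
with `k` perfect: the product over all places of the norms of the tame symbols is one. -/
theorem finprod_symbol {k F : Type u} [Field k] [PerfectField k] [Field F] [Algebra k F]
    (hF : ∀ t : F, Transcendental k t → FiniteDimensional k⟮t⟯ F) (f g : Fˣ) :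
    {A : Place k F | A.symbol f g ≠ 1}.Finite ∧ ∏ᶠ A : Place k F, A.symbol f g = 1 := by
  by_cases hf : Transcendental k (f : F)
  · have := hF f hf
    exact finprod_symbol_of_isGenerator (isGenerator_gen hf) f rfl g
  by_cases hg : Transcendental k (g : F)
  · have := hF g hg
    obtain ⟨h1, h2⟩ := finprod_symbol_of_isGenerator (isGenerator_gen hg) g rfl f
    have hsw : ∀ A : Place k F, A.symbol f g = (A.symbol g f)⁻¹ := fun A => A.symbol_swap g f
    simp only [hsw, ne_eq, inv_eq_one]
    exact ⟨h1, by rw [finprod_inv_distrib, h2, inv_one]⟩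
  · have h1 : ∀ A : Place k F, A.symbol f g = 1 := fun A =>
      A.symbol_eq_one (ord_eq_zero_of_isAlgebraic A (not_not.1 hf))
        (ord_eq_zero_of_isAlgebraic A (not_not.1 hg))
    simp [h1]

open IntermediateField in
theorem finite_zeros {k F : Type u} [Field k] [PerfectField k] [Field F] [Algebra k F]
    (t : Fˣ) (ht : Transcendental k (t : F)) [FiniteDimensional k⟮(t : F)⟯ F] :
    {A : Place k F | 0 < ord A.ring t}.Finite ∧
      ∀ A : Place k F, 0 < ord A.ring t → A.residueMap.Finite :=
  have h := finprod_symbol_zeros_of_isGenerator (isGenerator_gen ht) t rfl 1 0 1 1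
    (by simp) (by simp)
  ⟨h.1, h.2.1⟩

end Reciprocity

/-! ### Restriction of discrete valuations to dense subfields -/

section Comap
variable {K L : Type u} [Field K] [Field L] (φ : K →+* L) (V : ValuationSubring L)

/-- If `K` is dense in `L` for the valuation of `V`, in the sense that every nonzero `l` is
approximated by an element of `K` with error smaller than `l`, then `V` and its restriction to `K`
have the same residue field. -/
theorem exists_residueField_equiv
    (hφ : ∀ l : L, l ≠ 0 → ∃ f : K, V.valuation (φ f - l) < V.valuation l) :
    ∃ e : IsLocalRing.ResidueField (V.comap φ) ≃+* IsLocalRing.ResidueField V,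
      ∀ a : V.comap φ, e (IsLocalRing.residue _ a) = IsLocalRing.residue V ⟨φ a, a.2⟩ := by
  let ψ : V.comap φ →+* V := (φ.comp (V.comap φ).subtype).codRestrict V.toSubring fun a => a.2
  have : IsLocalHom ψ := ⟨fun a ha => by
    obtain ⟨y, hy⟩ := ha.exists_right_inv
    have h1 : φ a * (y : L) = 1 := congrArg Subtype.val hy
    have ha0 : (a : K) ≠ 0 := by
      intro h; rw [h] at h1; simp at h1
    have h2 : φ (a : K)⁻¹ = y := by
      rw [map_inv₀]; exact inv_eq_of_mul_eq_one_right h1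
    refine IsUnit.of_mul_eq_one ⟨(a : K)⁻¹, ?_⟩ (Subtype.ext (mul_inv_cancel₀ ha0))
    rw [ValuationSubring.mem_comap, h2]; exact y.2⟩
  refine ⟨RingEquiv.ofBijective (IsLocalRing.ResidueField.map ψ) ⟨RingHom.injective _, ?_⟩,
    fun a => rfl⟩
  intro x
  obtain ⟨y, rfl⟩ := IsLocalRing.residue_surjective x
  by_cases hy : IsUnit y
  · have hy1 := (V.valuation_eq_one_iff y).1 hy
    obtain ⟨f, hf⟩ := hφ (y : L) (by rintro h; rw [h, map_zero] at hy1; exact zero_ne_one hy1)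
    have hfV : φ f ∈ V := by
      have h1 : V.valuation (φ f) = V.valuation (y : L) := Valuation.map_eq_of_sub_lt _ hf
      rw [← V.valuation_le_one_iff, h1, hy1]
    refine ⟨IsLocalRing.residue _ ⟨f, hfV⟩, ?_⟩
    change IsLocalRing.residue V ⟨φ f, hfV⟩ = _
    rw [← sub_eq_zero, ← map_sub, IsLocalRing.residue_eq_zero_iff]
    rw [hy1] at hf
    exact (V.valuation_lt_one_iff _).2 hf
  · exact ⟨0, by
      rw [map_zero, eq_comm, IsLocalRing.residue_eq_zero_iff]
      exact (IsLocalRing.mem_maximalIdeal y).2 hy⟩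

variable [IsDiscreteValuationRing V]

/-- A normalized discrete valuation is determined by its valuation ring. -/
theorem ord_eq_ord_of_nonneg_iff {K : Type u} [Field K] (A : ValuationSubring K)
    [IsDiscreteValuationRing A] (w : Kˣ →* Multiplicative ℤ)
    (h : ∀ f : Kˣ, 0 ≤ ord A f ↔ 0 ≤ (w f).toAdd) (p : Kˣ) (hp : (w p).toAdd = 1) (f : Kˣ) :
    ord A f = (w f).toAdd := by
  have h0 : ∀ g : Kˣ, (w g).toAdd = 0 → ord A g = 0 := by
    intro g hg
    have h1 := (h g).2 hg.ge
    have h2 := (h g⁻¹).2 (by rw [map_inv, toAdd_inv, hg, neg_zero])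
    rw [ord_inv] at h2
    omega
  have h1 : ∀ g : Kˣ, ord A g = (w g).toAdd * ord A p := by
    intro g
    have := h0 (g * p ^ (-(w g).toAdd)) (by
      rw [map_mul, map_zpow, toAdd_mul, toAdd_zpow, hp]; simp)
    rw [ord_mul, ord_zpow] at this
    linarith
  obtain ⟨q, hq⟩ := exists_ord_eq_one A
  have h2 := h1 q
  rw [hq] at h2
  have h3 : 0 ≤ ord A p := (h p).2 (by rw [hp]; exact zero_le_one)
  have h4 : ord A p = 1 := Int.eq_one_of_dvd_one h3 ⟨_, by rw [h2]; ring⟩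
  rw [h1, h4, mul_one]

theorem mem_comap_iff (f : Kˣ) : (f : K) ∈ V.comap φ ↔ 0 ≤ ord V (Units.map φ f) := by
  rw [ord_nonneg_iff]; rfl

/-- The restriction of a discrete valuation to a subfield that contains a uniformizer `p` is
discrete. -/
theorem isDiscreteValuationRing_comap (p : Kˣ) (hp : ord V (Units.map φ p) = 1) :
    IsDiscreteValuationRing (V.comap φ) := by
  have hpm : (p : K) ∈ V.comap φ := (mem_comap_iff φ V p).2 (by omega)
  have hunit : ∀ x : V.comap φ, x ≠ 0 → ∃ n : ℕ, Associated ((⟨p, hpm⟩ : V.comap φ) ^ n) x := by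
    intro x hx
    have hx0 : (x : K) ≠ 0 := fun h => hx (Subtype.ext h)
    set f : Kˣ := Units.mk0 (x : K) hx0
    obtain ⟨n, hn⟩ := Int.eq_ofNat_of_zero_le ((mem_comap_iff φ V f).1 x.2)
    have h0 : ord V (Units.map φ (f * (p ^ n)⁻¹)) = 0 := by
      rw [map_mul, map_inv, map_pow, ord_mul, ord_inv, ord_pow, hp, hn]; simp
    refine ⟨n, ⟨⟨((f * (p ^ n)⁻¹ : Kˣ) : K), (mem_comap_iff φ V _).2 h0.ge⟩,
      ⟨(((f * (p ^ n)⁻¹)⁻¹ : Kˣ) : K),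
        (mem_comap_iff φ V _).2 (by rw [map_inv, ord_inv, h0, neg_zero])⟩,
      Subtype.ext (Units.mul_inv (f * (p ^ n)⁻¹)),
      Subtype.ext (Units.inv_mul (f * (p ^ n)⁻¹))⟩, Subtype.ext ?_⟩
    change (p : K) ^ n * ((f * (p ^ n)⁻¹ : Kˣ) : K) = f
    rw [← Units.val_pow_eq_pow_val, ← Units.val_mul]
    congr 1
    rw [mul_comm f, mul_inv_cancel_left]
  refine isDiscreteValuationRing_of_pow _ ⟨p, hpm⟩ (fun h => p.ne_zero (congrArg Subtype.val h)) ?_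
    hunit
  intro hu
  obtain ⟨y, hy⟩ := hu.exists_right_inv
  have h1 : ((p⁻¹ : Kˣ) : K) = y := by
    rw [Units.val_inv_eq_inv_val]
    exact inv_eq_of_mul_eq_one_right (congrArg Subtype.val hy)
  have h2 : ((p⁻¹ : Kˣ) : K) ∈ V.comap φ := by rw [h1]; exact y.2
  rw [mem_comap_iff, map_inv, ord_inv, hp] at h2
  omega

theorem ord_comap [IsDiscreteValuationRing (V.comap φ)] (p : Kˣ)
    (hp : ord V (Units.map φ p) = 1) (f : Kˣ) : ord (V.comap φ) f = ord V (Units.map φ f) := by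
  refine ord_eq_ord_of_nonneg_iff (V.comap φ) ((ordHom V).comp (Units.map φ)) (fun g => ?_) p hp f
  rw [ord_nonneg_iff, mem_comap_iff]; rfl

theorem tameSymbol_comap [IsDiscreteValuationRing (V.comap φ)] (p : Kˣ)
    (hp : ord V (Units.map φ p) = 1)
    (e : IsLocalRing.ResidueField (V.comap φ) →* IsLocalRing.ResidueField V)
    (he : ∀ a : V.comap φ, e (IsLocalRing.residue _ a) = IsLocalRing.residue V ⟨φ a, a.2⟩)
    (f g : Kˣ) : Units.map e (tameSymbol (V.comap φ) f g) =
      tameSymbol V (Units.map φ f) (Units.map φ g) := by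
  have h1 : Units.map (φ : K →* L) (tameElement (V.comap φ) f g) =
      tameElement V (Units.map φ f) (Units.map φ g) := by
    rw [tameElement, tameElement, ord_comap φ V p hp, ord_comap φ V p hp, map_mul, map_div,
      map_zpow, map_zpow, map_zpow]
    congr 2
    ext; simp
  apply Units.ext
  rw [Units.coe_map]
  change e (IsLocalRing.residue _ _) = IsLocalRing.residue _ _
  rw [he]
  congr 1
  exact Subtype.ext (congrArg Units.val h1)

/-- A dense subfield contains a uniformizer. -/
theorem exists_ord_map_eq_one
    (hφ : ∀ l : L, l ≠ 0 → ∃ f : K, V.valuation (φ f - l) < V.valuation l) :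
    ∃ p : Kˣ, ord V (Units.map φ p) = 1 := by
  obtain ⟨q, hq⟩ := exists_ord_eq_one V
  obtain ⟨f, hf⟩ := hφ q q.ne_zero
  have h1 : V.valuation (φ f) = V.valuation (q : L) := Valuation.map_eq_of_sub_lt _ hf
  have hf0 : f ≠ 0 := by
    rintro rfl
    rw [map_zero, map_zero, eq_comm, Valuation.zero_iff] at h1
    exact q.ne_zero h1
  refine ⟨Units.mk0 f hf0, ?_⟩
  rw [← hq]
  have h2 : ord V (Units.map φ (Units.mk0 f hf0) / q) = 0 := by
    rw [ord_eq_zero_iff, ValuationSubring.mem_unitGroup_iff]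
    rw [Units.val_div_eq_div_val, map_div₀]
    exact (div_eq_one_iff_eq ((Valuation.ne_zero_iff _).2 q.ne_zero)).2 h1
  rw [ord_div] at h2
  omega

end Comap

/-! ### The place of a branch -/

section BranchPlace
open IsLocalRing

variable {O : Type u} [CommRing O] [IsLocalRing O]

theorem exists_sub_algebraMap_mem [IsNoetherianRing O] (y : Completion O) (n : ℕ) :
    ∃ x : O, y - algebraMap O (Completion O) x ∈
      ((maximalIdeal O) ^ n).map (algebraMap O (Completion O)) := by
  obtain ⟨x, hx⟩ := Ideal.Quotient.mk_surjective (AdicCompletion.evalₐ (maximalIdeal O) n y)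
  refine ⟨x, ?_⟩
  have h1 := AdicCompletion.pow_smul_top_eq_ker_eval (I := maximalIdeal O) (M := O) (n := n)
    (maximalIdeal O).fg_of_isNoetherianRing
  have h2 : y - algebraMap O (Completion O) x ∈
      (AdicCompletion.eval (maximalIdeal O) O n).ker := by
    have h3 : AdicCompletion.evalₐ (maximalIdeal O) n (y - algebraMap O (Completion O) x) = 0 := by
      rw [map_sub, AlgHom.commutes, ← hx]; exact sub_self _
    have h4 := AdicCompletion.factor_evalₐ_eq_eval (maximalIdeal O)
      (y - algebraMap O (Completion O) x) (n := n) (by simp)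
    rw [LinearMap.mem_ker, ← h4, h3, map_zero]
  rw [← h1] at h2
  rwa [← Submodule.restrictScalars_mem O, ← Ideal.smul_top_eq_map]

namespace Branch
variable (b : Branch O)

/-- The map from the completed local ring to the ring of integers of a branch. -/
noncomputable def completionToIntegers : Completion O →+* b.integers :=
  (toFactor O b.ideal).codRestrict b.integers.toSubring b.mem_integers

theorem completionToIntegers_mem_pow {n : ℕ} {y : Completion O}
    (hy : y ∈ ((maximalIdeal O) ^ n).map (algebraMap O (Completion O))) :
    b.completionToIntegers y ∈ maximalIdeal b.integers ^ n := by
  have h1 : ((maximalIdeal O).map (algebraMap O (Completion O))).map b.completionToIntegers ≤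
      maximalIdeal b.integers := by
    rw [Ideal.map_map, Ideal.map_le_iff_le_comap]
    intro x hx
    exact (b.integers.valuation_lt_one_iff _).2 (b.valuation_lt_one x hx)
  rw [Ideal.map_pow] at hy
  have h2 := Ideal.mem_map_of_mem b.completionToIntegers hy
  rw [Ideal.map_pow] at h2
  exact Ideal.pow_right_mono h1 n h2

/-- Every `y` in the completion that does not vanish at a branch is approximated there, with error
smaller than `y`, by all elements of `O` that are close to `y` in the adic topology. -/
theorem exists_valuation_sub_lt (y : Completion O) (hy : toFactor O b.ideal y ≠ 0) :
    ∃ N : ℕ, ∀ n ≥ N, ∀ x : O, y - algebraMap O (Completion O) x ∈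
      ((maximalIdeal O) ^ n).map (algebraMap O (Completion O)) →
      b.integers.valuation (toFactor O b.ideal (algebraMap O (Completion O) x) -
        toFactor O b.ideal y) < b.integers.valuation (toFactor O b.ideal y) := by
  have h0 : b.completionToIntegers y ∉ (⨅ n : ℕ, maximalIdeal b.integers ^ n) := by
    rw [Ideal.iInf_pow_eq_bot_of_isLocalRing _ (maximalIdeal.isMaximal _).ne_top]
    exact fun h => hy (congrArg Subtype.val ((Submodule.mem_bot _).1 h))
  rw [Submodule.mem_iInf, not_forall] at h0
  obtain ⟨N, hN⟩ := h0
  refine ⟨N, fun n hn x hx => ?_⟩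
  by_contra! h
  have h1 := b.completionToIntegers_mem_pow hx
  obtain ⟨a, ha⟩ := (b.integers.valuation_le_iff _ _).1 h
  have h2 : b.completionToIntegers y =
      -a * b.completionToIntegers (y - algebraMap O (Completion O) x) := by
    apply Subtype.ext
    change toFactor O b.ideal y = -a * toFactor O b.ideal _
    rw [map_sub, neg_mul, ← mul_neg, neg_sub]
    exact ha.symm
  exact hN (Ideal.pow_le_pow_right hn (h2 ▸ Ideal.mul_mem_left _ _ h1))

variable {F : Type u} [Field F] [Algebra O F] [IsFractionRing O F]

/-- The embedding of the fraction field of `O` in the local field of a branch. -/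
noncomputable def fieldHom : F →+* b.ideal.asIdeal.ResidueField :=
  (algebraMap (LocalizedCompletion O) b.ideal.asIdeal.ResidueField).comp (fromFractionField O F)

theorem fieldHom_algebraMap (x : O) : b.fieldHom (algebraMap O F x) =
    toFactor O b.ideal (algebraMap O (Completion O) x) := by
  exact congrArg (algebraMap (LocalizedCompletion O) b.ideal.asIdeal.ResidueField)
    (IsLocalization.map_eq (M := nonZeroDivisors O)
      (T := Algebra.algebraMapSubmonoid (Completion O) (nonZeroDivisors O))
      (Q := LocalizedCompletion O) (Submonoid.le_comap_map (nonZeroDivisors O)) x)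

variable [IsDomain O]

theorem toFactor_algebraMap_ne_zero {s : O} (hs : s ≠ 0) :
    toFactor O b.ideal (algebraMap O (Completion O) s) ≠ 0 := by
  rw [← b.fieldHom_algebraMap (F := FractionRing O)]
  simpa using hs

theorem exists_eq_div (l : b.ideal.asIdeal.ResidueField) : ∃ (y : Completion O) (s : O), s ≠ 0 ∧
    l = toFactor O b.ideal y / toFactor O b.ideal (algebraMap O (Completion O) s) := by
  obtain ⟨q, rfl⟩ := (Ideal.bijective_algebraMap_quotient_residueField b.ideal.asIdeal).2 l
  obtain ⟨z, rfl⟩ := Ideal.Quotient.mk_surjective q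
  obtain ⟨⟨y, ⟨_, s, hs, rfl⟩⟩, h⟩ := IsLocalization.surj
    (Algebra.algebraMapSubmonoid (Completion O) (nonZeroDivisors O)) z
  refine ⟨y, s, nonZeroDivisors.ne_zero hs, ?_⟩
  rw [eq_div_iff (b.toFactor_algebraMap_ne_zero (nonZeroDivisors.ne_zero hs))]
  have := congrArg (algebraMap (LocalizedCompletion O) b.ideal.asIdeal.ResidueField) h
  rw [map_mul] at this
  exact this

variable [IsNoetherianRing O]

/-- The fraction field of `O` is dense in the local field of a branch. -/
theorem exists_fieldHom_sub_lt (l : b.ideal.asIdeal.ResidueField) (hl : l ≠ 0) :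
    ∃ f : F, b.integers.valuation (b.fieldHom f - l) < b.integers.valuation l := by
  obtain ⟨y, s, hs, rfl⟩ := b.exists_eq_div l
  have hy : toFactor O b.ideal y ≠ 0 := by
    intro h; rw [h, zero_div] at hl; exact hl rfl
  obtain ⟨N, hN⟩ := b.exists_valuation_sub_lt y hy
  obtain ⟨x, hx⟩ := exists_sub_algebraMap_mem y N
  have hs0 := b.toFactor_algebraMap_ne_zero hs
  refine ⟨algebraMap O F x / algebraMap O F s, ?_⟩
  rw [map_div₀, fieldHom_algebraMap, fieldHom_algebraMap, ← sub_div, map_div₀, map_div₀]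
  exact div_lt_div_of_pos_right (hN N le_rfl x hx) (zero_lt_iff.2 ((Valuation.ne_zero_iff _).2 hs0))

variable {k : Type u} [Field k] [Algebra k O] [Algebra k F] [IsScalarTower k O F]

/-- The restriction of the valuation of a branch to the fraction field, as a place. It is discrete
because the fraction field is dense in the local field. -/
noncomputable def place (k F : Type u) [Field k] [Algebra k O] [Field F] [Algebra O F]
    [IsFractionRing O F] [Algebra k F] [IsScalarTower k O F] : Place k F where
  ring := b.integers.comap b.fieldHom
  isDiscreteValuationRing :=
    isDiscreteValuationRing_comap _ _ _
      (exists_ord_map_eq_one b.fieldHom b.integers b.exists_fieldHom_sub_lt).choose_spec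
  algebraMap_mem c := by
    rw [IsScalarTower.algebraMap_apply k O F, ValuationSubring.mem_comap, fieldHom_algebraMap]
    exact b.mem_integers _

/-- A place dominates a local ring `O`: its valuation ring contains `O`, and its maximal ideal
contains that of `O`. -/
def _root_.WeilReciprocity.Place.Dominates (A : Place k F) (O : Type u) [CommRing O]
    [IsLocalRing O] [Algebra O F] : Prop :=
  (∀ x : O, algebraMap O F x ∈ A.ring) ∧
    ∀ x ∈ maximalIdeal O, A.ring.valuation (algebraMap O F x) < 1

theorem place_dominates : (b.place k F).Dominates O := by
  have hmem : ∀ x : O, algebraMap O F x ∈ (b.place k F).ring := fun x => by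
    change b.fieldHom (algebraMap O F x) ∈ b.integers
    rw [fieldHom_algebraMap]; exact b.mem_integers _
  refine ⟨hmem, fun x hx => ?_⟩
  obtain ⟨p, hp⟩ := exists_ord_map_eq_one (b.fieldHom (F := F)) b.integers b.exists_fieldHom_sub_lt
  by_cases hx0 : x = 0
  · simp [hx0]
  let f : Fˣ := Units.mk0 (algebraMap O F x) (by simpa using hx0)
  change (b.place k F).ring.valuation (f : F) < 1
  rw [← ord_pos_iff]
  have : IsDiscreteValuationRing (b.integers.comap (b.fieldHom (F := F))) :=
    (b.place k F).isDiscreteValuationRing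
  have h1 := ord_comap b.fieldHom b.integers p hp f
  change ord (b.integers.comap b.fieldHom) f > 0
  rw [h1, gt_iff_lt, ord_pos_iff]
  change b.integers.valuation (b.fieldHom (algebraMap O F x)) < 1
  rw [fieldHom_algebraMap]
  exact b.valuation_lt_one x hx

/-- A branch and its place have the same residue field and the same tame symbols. -/
theorem exists_residueField_equiv_place :
    ∃ e : ResidueField (b.place k F).ring ≃+* ResidueField b.integers,
      (∀ f g : Fˣ, Units.map (e : _ →* _) (tameSymbol (b.place k F).ring f g) =
        tameSymbol b.integers (b.fieldMap f) (b.fieldMap g)) ∧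
      (e : _ →+* _).comp (b.place k F).residueMap =
        b.residueMap.comp ((residue O).comp (algebraMap k O)) := by
  obtain ⟨p, hp⟩ := exists_ord_map_eq_one (b.fieldHom (F := F)) b.integers b.exists_fieldHom_sub_lt
  obtain ⟨e, he⟩ := exists_residueField_equiv (b.fieldHom (F := F)) b.integers
    b.exists_fieldHom_sub_lt
  have : IsDiscreteValuationRing (b.integers.comap (b.fieldHom (F := F))) :=
    (b.place k F).isDiscreteValuationRing
  refine ⟨e, tameSymbol_comap (b.fieldHom (F := F)) b.integers p hp (e : _ →* _) he, ?_⟩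
  ext c
  refine (he _).trans (congrArg (residue b.integers) (Subtype.ext ?_))
  change b.fieldHom (algebraMap k F c) = _
  rw [IsScalarTower.algebraMap_apply k O F, fieldHom_algebraMap]
  rfl

theorem unitsNorm_tameSymbol (f g : Fˣ) :
    unitsNorm ((residue O).comp (algebraMap k O)) (unitsNorm b.residueMap
      (tameSymbol b.integers (b.fieldMap f) (b.fieldMap g))) = (b.place k F).symbol f g := by
  obtain ⟨e, h1, h2⟩ := b.exists_residueField_equiv_place (k := k) (F := F)
  rw [unitsNorm_comp, Place.symbol, ← h1, ← h2, unitsNorm_equiv]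

theorem residueMap_finite (h : (b.place k F).residueMap.Finite) : b.residueMap.Finite := by
  obtain ⟨e, -, h2⟩ := b.exists_residueField_equiv_place (k := k) (F := F)
  have h3 : (b.residueMap.comp ((residue O).comp (algebraMap k O))).Finite := by
    rw [← h2]
    exact (RingHom.Finite.of_surjective (e : ResidueField (b.place k F).ring →+*
      ResidueField b.integers) e.surjective).comp h
  exact RingHom.Finite.of_comp_finite h3

end Branch

end BranchPlace

section BranchInjective
open IsLocalRing

theorem le_ord_of_mem_pow {K : Type u} [Field K] (V : ValuationSubring K)
    [IsDiscreteValuationRing V] {n : ℕ} {z : V} (hz : z ∈ maximalIdeal V ^ n) {f : Kˣ}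
    (hf : (f : K) = z) : n ≤ ord V f := by
  obtain ⟨p, hp⟩ := IsDiscreteValuationRing.exists_irreducible V
  have hp0 : (p : K) ≠ 0 := fun h => hp.ne_zero (Subtype.ext h)
  rw [hp.maximalIdeal_eq, Ideal.span_singleton_pow, Ideal.mem_span_singleton] at hz
  obtain ⟨a, rfl⟩ := hz
  have h1 := ord_irreducible V hp (f := Units.mk0 (p : K) hp0) rfl
  have h2 : 0 ≤ ord V (f * (Units.mk0 (p : K) hp0 ^ n)⁻¹) := by
    rw [ord_nonneg_iff]
    have : ((f * (Units.mk0 (p : K) hp0 ^ n)⁻¹ : Kˣ) : K) = a := by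
      rw [Units.val_mul, Units.val_inv_eq_inv_val, Units.val_pow_eq_pow_val, hf]
      change (p : K) ^ n * a * ((p : K) ^ n)⁻¹ = a
      field_simp
    rw [this]; exact a.2
  rw [ord_mul, ord_inv, ord_pow, h1] at h2
  omega

namespace Branch
variable {O : Type u} [CommRing O] [IsLocalRing O] [IsDomain O]
  {k F : Type u} [Field k] [Algebra k O] [Field F] [Algebra O F] [IsFractionRing O F] [Algebra k F]
  [IsScalarTower k O F]

theorem mem_ideal_iff (b : Branch O) (y : Completion O) {s : O} (hs : s ∈ nonZeroDivisors O)
    (z : LocalizedCompletion O) (hz : z * algebraMap (Completion O) (LocalizedCompletion O)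
      (algebraMap O (Completion O) s) = algebraMap _ _ y) :
    z ∈ b.ideal.asIdeal ↔ toFactor O b.ideal y = 0 := by
  have h1 : algebraMap _ b.ideal.asIdeal.ResidueField z *
      toFactor O b.ideal (algebraMap O (Completion O) s) = toFactor O b.ideal y := by
    have := congrArg (algebraMap _ b.ideal.asIdeal.ResidueField) hz
    rwa [map_mul] at this
  rw [← h1, mul_eq_zero, or_iff_left (b.toFactor_algebraMap_ne_zero (nonZeroDivisors.ne_zero hs)),
    Ideal.algebraMap_residueField_eq_zero]

variable [IsNoetherianRing O]

theorem ord_place (b : Branch O) (f : Fˣ) :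
    ord (b.place k F).ring f = ord b.integers (Units.map (b.fieldHom (F := F) : F →* _) f) := by
  obtain ⟨p, hp⟩ := exists_ord_map_eq_one (b.fieldHom (F := F)) b.integers b.exists_fieldHom_sub_lt
  have : IsDiscreteValuationRing (b.integers.comap (b.fieldHom (F := F))) :=
    (b.place k F).isDiscreteValuationRing
  exact ord_comap b.fieldHom b.integers p hp f

theorem ord_eq_of_valuation_eq {K : Type u} [Field K] (V : ValuationSubring K)
    [IsDiscreteValuationRing V] {f g : Kˣ} (h : V.valuation (f : K) = V.valuation (g : K)) :
    ord V f = ord V g := by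
  have h2 : ord V (f / g) = 0 := by
    rw [ord_eq_zero_iff, ValuationSubring.mem_unitGroup_iff, Units.val_div_eq_div_val, map_div₀]
    exact (div_eq_one_iff_eq ((Valuation.ne_zero_iff _).2 g.ne_zero)).2 h
  rw [ord_div] at h2
  omega

/-- The kernel of `Ô → K / m` is determined by the place. If `y` lies in the kernel at `b'` but not
at `b`, then the elements of `O` approximating `y` have unbounded order at `b'`, while at `b` their
order is eventually that of `y`. -/
theorem toFactor_eq_zero_of_place_eq {b b' : Branch O} (h : b.place k F = b'.place k F)
    {y : Completion O} (hy : toFactor O b'.ideal y = 0) : toFactor O b.ideal y = 0 := by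
  by_contra hy0
  obtain ⟨N, hN⟩ := b.exists_valuation_sub_lt y hy0
  set g := Units.mk0 _ hy0 with hg
  obtain ⟨M, hM⟩ : ∃ M : ℕ, ord b.integers g < M := ⟨(ord b.integers g).toNat + 1, by omega⟩
  obtain ⟨x, hx⟩ := exists_sub_algebraMap_mem y (max N M)
  have h1 := hN _ (le_max_left _ _) x hx
  have h2 := Valuation.map_eq_of_sub_lt _ h1
  have hx0 : x ≠ 0 := by
    rintro rfl
    rw [map_zero, map_zero, map_zero, eq_comm, Valuation.zero_iff] at h2
    exact hy0 h2
  set f : Fˣ := Units.mk0 (algebraMap O F x) (by simpa using hx0) with hf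
  have h3 : ord b.integers (Units.map (b.fieldHom (F := F) : F →* _) f) = ord b.integers g :=
    ord_eq_of_valuation_eq _ (
      (congrArg b.integers.valuation (b.fieldHom_algebraMap x)).trans h2)
  have h4 : ((max N M : ℕ) : ℤ) ≤
      ord b'.integers (Units.map (b'.fieldHom (F := F) : F →* _) f) := by
    have h5 := b'.completionToIntegers_mem_pow hx
    rw [map_sub, show b'.completionToIntegers y = 0 from Subtype.ext hy, zero_sub] at h5
    exact le_ord_of_mem_pow _ (neg_mem_iff.1 h5) (b'.fieldHom_algebraMap x)
  rw [← ord_place (k := k), ← h, ord_place, h3] at h4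
  have := le_max_right N M
  omega

/-- The ring of integers of a branch is determined by the place it induces: an element `y / s` of
the local field is integral if and only if `x / s` is so for all close approximations `x` of `y` in
`O`. -/
theorem mem_integers_iff (b : Branch O) (y : Completion O) {s : O}
    (l : b.ideal.asIdeal.ResidueField)
    (hl : l = toFactor O b.ideal y / toFactor O b.ideal (algebraMap O (Completion O) s)) :
    l ∈ b.integers ↔ toFactor O b.ideal y = 0 ∨ ∃ N : ℕ, ∀ n ≥ N, ∀ x : O,
      y - algebraMap O (Completion O) x ∈ ((maximalIdeal O) ^ n).map (algebraMap O (Completion O)) →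
        algebraMap O F x / algebraMap O F s ∈ (b.place k F).ring := by
  by_cases hy : toFactor O b.ideal y = 0
  · simp [hl, hy, b.integers.zero_mem]
  obtain ⟨N, hN⟩ := b.exists_valuation_sub_lt y hy
  have h1 : ∀ n ≥ N, ∀ x : O,
      y - algebraMap O (Completion O) x ∈ ((maximalIdeal O) ^ n).map (algebraMap O (Completion O)) →
        (algebraMap O F x / algebraMap O F s ∈ (b.place k F).ring ↔ l ∈ b.integers) := by
    intro n hn x hx
    change b.fieldHom (algebraMap O F x / algebraMap O F s) ∈ b.integers ↔ _
    rw [← ValuationSubring.valuation_le_one_iff, ← ValuationSubring.valuation_le_one_iff, hl,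
      map_div₀, map_div₀, map_div₀, fieldHom_algebraMap, fieldHom_algebraMap,
      Valuation.map_eq_of_sub_lt _ (hN n hn x hx)]
  simp only [hy, false_or]
  refine ⟨fun h => ⟨N, fun n hn x hx => (h1 n hn x hx).2 h⟩, fun ⟨M, hM⟩ => ?_⟩
  obtain ⟨x, hx⟩ := exists_sub_algebraMap_mem y (max N M)
  exact (h1 _ (le_max_left _ _) x hx).1 (hM _ (le_max_right _ _) x hx)

/-- A branch is determined by its place, since the place determines the ideal and the ring of
integers. -/
theorem place_injective : Function.Injective fun b : Branch O => b.place k F := by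
  intro b b' (h : b.place k F = b'.place k F)
  have hideal : b.ideal = b'.ideal := by
    refine MaximalSpectrum.ext (Ideal.ext fun z => ?_)
    obtain ⟨⟨y, ⟨_, s, hs, rfl⟩⟩, hz⟩ := IsLocalization.surj
      (Algebra.algebraMapSubmonoid (Completion O) (nonZeroDivisors O)) z
    rw [b.mem_ideal_iff y hs z hz, b'.mem_ideal_iff y hs z hz]
    exact ⟨toFactor_eq_zero_of_place_eq h.symm, toFactor_eq_zero_of_place_eq h⟩
  obtain ⟨I, V, hV, hV1, hV2⟩ := b
  obtain ⟨I', V', hV', hV1', hV2'⟩ := b'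
  obtain rfl : I = I' := hideal
  obtain rfl : V = V' := by
    ext l
    obtain ⟨y, s, -, hl⟩ := exists_eq_div ⟨I, V, hV, hV1, hV2⟩ l
    have h1 := mem_integers_iff (k := k) (F := F) ⟨I, V, hV, hV1, hV2⟩ y l hl
    have h2 := mem_integers_iff (k := k) (F := F) ⟨I, V', hV', hV1', hV2'⟩ y l hl
    rw [h] at h1
    exact h1.trans h2.symm
  rfl

end Branch

end BranchInjective

/-! ### The completion of a discrete valuation ring -/

section CompletionDVR
open IsLocalRing

variable {A : Type u} [CommRing A] [IsDomain A] [IsDiscreteValuationRing A]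

theorem algebraMap_completion_injective :
    Function.Injective (algebraMap A (Completion A)) := by
  have := AdicCompletion.of_injective (I := maximalIdeal A) (M := A)
  exact this

theorem maximalIdeal_completion_eq {p : A} (hp : Irreducible p) :
    maximalIdeal (Completion A) = Ideal.span {algebraMap A (Completion A) p} := by
  refine AdicCompletion.maximalIdeal_eq_map.trans ?_
  refine (congrArg (Ideal.map (algebraMap A (Completion A))) hp.maximalIdeal_eq).trans ?_
  rw [Ideal.map_span, Set.image_singleton]

theorem exists_associated_pow_completion {p : A} (hp : Irreducible p) {x : Completion A}
    (hx : x ≠ 0) : ∃ n : ℕ, Associated (algebraMap A (Completion A) p ^ n) x := by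
  have hmax := maximalIdeal_completion_eq hp
  have hex : ∃ n : ℕ, ¬ algebraMap A (Completion A) p ^ n ∣ x := by
    by_contra! h
    refine hx (IsHausdorff.haus (I := maximalIdeal (Completion A)) inferInstance x fun n => ?_)
    rw [SModEq.zero, hmax, Ideal.span_singleton_pow, smul_eq_mul, Ideal.mul_top,
      Ideal.mem_span_singleton]
    exact h n
  classical
  have h0 : Nat.find hex ≠ 0 := fun h => Nat.find_spec hex (by rw [h]; simp)
  obtain ⟨m, hm⟩ := Nat.exists_eq_succ_of_ne_zero h0
  have hdvd : algebraMap A (Completion A) p ^ m ∣ x := by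
    by_contra h
    have := Nat.find_min' hex h
    omega
  obtain ⟨u, hu⟩ := hdvd
  have hunit : IsUnit u := by
    by_contra h
    have h1 : u ∈ maximalIdeal (Completion A) := h
    rw [hmax, Ideal.mem_span_singleton] at h1
    obtain ⟨v, rfl⟩ := h1
    refine Nat.find_spec hex ?_
    rw [hm]
    exact ⟨v, by rw [hu, pow_succ, mul_assoc]⟩
  exact ⟨m, hunit.unit, hu.symm⟩

instance : IsDomain (Completion A) := by
  obtain ⟨p, hp⟩ := IsDiscreteValuationRing.exists_irreducible A
  have : NoZeroDivisors (Completion A) := ⟨fun {x y} hxy => by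
    by_contra! h
    obtain ⟨n, u, rfl⟩ := exists_associated_pow_completion hp h.1
    obtain ⟨m, v, rfl⟩ := exists_associated_pow_completion hp h.2
    have h1 : algebraMap A (Completion A) (p ^ (n + m)) * (u * v : (Completion A)ˣ) = 0 := by
      rw [← hxy, map_pow, Units.val_mul, pow_add, mul_mul_mul_comm]
    rw [Units.mul_left_eq_zero] at h1
    have h2 := algebraMap_completion_injective (h1.trans (map_zero _).symm)
    exact pow_ne_zero _ hp.ne_zero h2⟩
  exact NoZeroDivisors.to_isDomain _

instance : IsDiscreteValuationRing (Completion A) := by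
  obtain ⟨p, hp⟩ := IsDiscreteValuationRing.exists_irreducible A
  refine IsDiscreteValuationRing.ofHasUnitMulPowIrreducibleFactorization
    ⟨algebraMap A (Completion A) p, ?_, fun hx => exists_associated_pow_completion hp hx⟩
  have h0 : algebraMap A (Completion A) p ≠ 0 := fun h =>
    hp.ne_zero (algebraMap_completion_injective (h.trans (map_zero _).symm))
  refine ((Ideal.span_singleton_prime h0).1 ?_).irreducible
  rw [← maximalIdeal_completion_eq hp]
  infer_instance

variable {O : Type u} [CommRing O] [IsLocalRing O]

theorem factorPow_comp_quotientMap {A : Type u} [CommRing A] [IsLocalRing A] (φ : O →+* A)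
    [IsLocalHom φ] (h : ∀ n, maximalIdeal O ^ n ≤ (maximalIdeal A ^ n).comap φ) {m n : ℕ}
    (hle : m ≤ n) : (Ideal.Quotient.factorPow (maximalIdeal A) hle).comp
      ((Ideal.quotientMap (maximalIdeal A ^ n) φ (h n)).comp
        (AdicCompletion.evalₐ (maximalIdeal O) n : Completion O →+* _)) =
      (Ideal.quotientMap (maximalIdeal A ^ m) φ (h m)).comp
        (AdicCompletion.evalₐ (maximalIdeal O) m : Completion O →+* _) := by
  ext y
  obtain ⟨y, rfl⟩ := AdicCompletion.mk_surjective _ _ y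
  simp only [RingHom.comp_apply, RingHom.coe_coe, AdicCompletion.evalₐ_mk,
    Ideal.quotientMap_mk, Ideal.Quotient.factor_mk, Ideal.Quotient.factorPow]
  have h1 := AdicCompletion.Ideal.mk_eq_mk (maximalIdeal O) hle y
  rw [Ideal.Quotient.eq] at h1 ⊢
  rw [← map_sub]
  exact h m h1

theorem maximalIdeal_pow_le_comap {A : Type u} [CommRing A] [IsLocalRing A] (φ : O →+* A)
    [IsLocalHom φ] (n : ℕ) : maximalIdeal O ^ n ≤ (maximalIdeal A ^ n).comap φ := by
  rw [← Ideal.map_le_iff_le_comap, Ideal.map_pow]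
  exact Ideal.pow_right_mono (((local_hom_TFAE φ).out 0 2).1 ‹_›) n

/-- The map of completions induced by a local homomorphism of local rings. -/
noncomputable def completionMap {A : Type u} [CommRing A] [IsLocalRing A] (φ : O →+* A)
    [IsLocalHom φ] : Completion O →+* Completion A :=
  AdicCompletion.liftRingHom (maximalIdeal A)
    (fun n => (Ideal.quotientMap (maximalIdeal A ^ n) φ (maximalIdeal_pow_le_comap φ n)).comp
      (AdicCompletion.evalₐ (maximalIdeal O) n : Completion O →+* _))
    (factorPow_comp_quotientMap φ (maximalIdeal_pow_le_comap φ))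

theorem completionMap_algebraMap {A : Type u} [CommRing A] [IsLocalRing A] (φ : O →+* A)
    [IsLocalHom φ] (x : O) : completionMap φ (algebraMap O _ x) = algebraMap A _ (φ x) := by
  refine AdicCompletion.ext_evalₐ fun n => ?_
  refine (AdicCompletion.evalₐ_liftRingHom (maximalIdeal A) _
    (factorPow_comp_quotientMap φ (maximalIdeal_pow_le_comap φ)) n _).trans ?_
  simp

variable (φ : O →+* A) [IsLocalHom φ]

/-- Modulo the maximal ideal the completion is generated by finitely many elements. -/
theorem exists_fg_sub_mem_maximalIdeal (hfin : ((residue A).comp φ).Finite) :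
    letI := (completionMap φ).toAlgebra
    ∃ N : Submodule (Completion O) (Completion A), N.FG ∧
      ∀ x, ∃ y ∈ N, x - y ∈ maximalIdeal (Completion A) := by
  let _ := (completionMap φ).toAlgebra
  let _ := ((residue A).comp φ).toAlgebra
  obtain ⟨S, hS⟩ := (hfin : Module.Finite O (ResidueField A)).fg_top
  choose r hr using residue_surjective (R := A)
  refine ⟨Submodule.span _ ((fun z => algebraMap A (Completion A) (r z)) '' (S : Set _)),
    Submodule.fg_span ((S.finite_toSet).image _), fun x => ?_⟩
  have key : ∀ z : ResidueField A, z ∈ Submodule.span O (S : Set (ResidueField A)) → ∃ a : A,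
      residue A a = z ∧ algebraMap A (Completion A) a ∈ Submodule.span (Completion O)
        ((fun z => algebraMap A (Completion A) (r z)) '' (S : Set (ResidueField A))) := by
    intro z hz
    induction hz using Submodule.span_induction with
    | mem z hz => exact ⟨r z, hr z, Submodule.subset_span ⟨z, hz, rfl⟩⟩
    | zero => exact ⟨0, map_zero _, by rw [map_zero]; exact zero_mem _⟩
    | add z w _ _ hz hw =>
      obtain ⟨a, ha, ha'⟩ := hz
      obtain ⟨b, hb, hb'⟩ := hw
      exact ⟨a + b, by rw [map_add, ha, hb], by rw [map_add]; exact add_mem ha' hb'⟩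
    | smul c z _ hz =>
      obtain ⟨a, ha, ha'⟩ := hz
      refine ⟨φ c * a, by rw [map_mul, ha]; rfl, ?_⟩
      rw [map_mul, ← completionMap_algebraMap]
      exact Submodule.smul_mem _ (algebraMap O (Completion O) c) ha'
  obtain ⟨a, ha⟩ := exists_sub_algebraMap_mem x 1
  obtain ⟨b, hb, hb'⟩ := key (residue A a) (by rw [hS]; trivial)
  refine ⟨_, hb', ?_⟩
  have h1 : a - b ∈ maximalIdeal A := by
    rw [← residue_eq_zero_iff, map_sub, hb, sub_self]
  have h2 := Ideal.mem_map_of_mem (algebraMap A (Completion A)) h1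
  rw [pow_one] at ha
  rw [← AdicCompletion.maximalIdeal_eq_map] at h2 ha
  have := add_mem ha h2
  rw [map_sub] at this
  convert this using 1
  ring

/-- Modulo a power of the maximal ideal the completion is generated by finitely many elements. -/
theorem exists_fg_sub_mem_maximalIdeal_pow (hfin : ((residue A).comp φ).Finite) (e : ℕ) :
    letI := (completionMap φ).toAlgebra
    ∃ N : Submodule (Completion O) (Completion A), N.FG ∧
      ∀ x, ∃ y ∈ N, x - y ∈ maximalIdeal (Completion A) ^ e := by
  let _ := (completionMap φ).toAlgebra
  obtain ⟨p, hp⟩ := IsDiscreteValuationRing.exists_irreducible A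
  rw [maximalIdeal_completion_eq hp, Ideal.span_singleton_pow]
  obtain ⟨N₁, h₁, h₁'⟩ := exists_fg_sub_mem_maximalIdeal φ hfin
  rw [maximalIdeal_completion_eq hp] at h₁'
  induction e with
  | zero => exact ⟨⊥, Submodule.fg_bot, fun x => ⟨0, zero_mem _, by simp⟩⟩
  | succ e ih =>
    obtain ⟨N, hN, hN'⟩ := ih
    refine ⟨N ⊔ N₁.map (LinearMap.mulLeft _ (algebraMap A (Completion A) p ^ e)),
      hN.sup (h₁.map _), fun x => ?_⟩
    obtain ⟨y, hy, h⟩ := hN' x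
    obtain ⟨z, hz⟩ := Ideal.mem_span_singleton.1 h
    obtain ⟨w, hw, h'⟩ := h₁' z
    obtain ⟨v, hv⟩ := Ideal.mem_span_singleton.1 h'
    refine ⟨y + algebraMap A (Completion A) p ^ e * w, Submodule.add_mem_sup hy ⟨w, hw, rfl⟩,
      Ideal.mem_span_singleton.2 ⟨v, ?_⟩⟩
    rw [pow_succ, mul_assoc, ← hv, mul_sub, ← hz]
    ring

theorem isPrecomplete_pi {R : Type*} [CommRing R] (I : Ideal R) [IsPrecomplete I R] (n : ℕ) :
    IsPrecomplete I (Fin n → R) := by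
  have hmem : ∀ (m : ℕ) (v : Fin n → R), v ∈ (I ^ m • ⊤ : Submodule R (Fin n → R)) ↔
      ∀ i, v i ∈ I ^ m := by
    refine fun m v => ⟨fun h i => ?_, fun h => ?_⟩
    · have := Submodule.mem_map_of_mem (f := LinearMap.proj i) h
      rw [Submodule.map_smul''] at this
      simpa using Submodule.smul_mono le_rfl le_top this
    · rw [pi_eq_sum_univ' v]
      exact Submodule.sum_mem _ fun i _ => Submodule.smul_mem_smul (h i) trivial
  refine ⟨fun f hf => ?_⟩
  choose L hL using fun i => IsPrecomplete.prec (I := I) (M := R) inferInstance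
    (f := fun m => f m i) fun {m n} h => by
      have := hf h
      rw [SModEq.sub_mem, hmem] at this
      rw [SModEq.sub_mem]
      simpa using this i
  refine ⟨L, fun m => ?_⟩
  rw [SModEq.sub_mem, hmem]
  intro i
  have := hL i m
  rw [SModEq.sub_mem] at this
  simpa using this

/-- If a local homomorphism from `O` to a discrete valuation ring `A` has a finite residue field
extension and does not kill the maximal ideal, then the completion of `A` is finite over that of
`O`: finitely many generators modulo the maximal ideal of `Ô` generate, as `Ô` is complete. -/
theorem completionMap_finite [IsNoetherianRing O] (hfin : ((residue A).comp φ).Finite)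
    (h0 : (maximalIdeal O).map φ ≠ ⊥) : (completionMap φ).Finite := by
  obtain ⟨e, he⟩ : ∃ e : ℕ, (maximalIdeal O).map φ = maximalIdeal A ^ e := by
    obtain ⟨p, hp⟩ := IsDiscreteValuationRing.exists_irreducible A
    obtain ⟨e, he⟩ := IsDiscreteValuationRing.ideal_eq_span_pow_irreducible h0 hp
    exact ⟨e, by rw [he, hp.maximalIdeal_eq, Ideal.span_singleton_pow]⟩
  let _ := (completionMap φ).toAlgebra
  have hmap : (maximalIdeal (Completion O)).map (algebraMap (Completion O) (Completion A)) =
      maximalIdeal (Completion A) ^ e := by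
    rw [AdicCompletion.maximalIdeal_eq_map, AdicCompletion.maximalIdeal_eq_map, Ideal.map_map,
      ← Ideal.map_pow, ← he, Ideal.map_map]
    congr 1
  have he0 : e ≠ 0 := by
    rintro rfl
    have h1 : (maximalIdeal O).map φ ≤ maximalIdeal A := ((local_hom_TFAE φ).out 0 2).1 ‹_›
    rw [he, pow_zero, Ideal.one_eq_top, top_le_iff] at h1
    exact (maximalIdeal.isMaximal A).ne_top h1
  obtain ⟨N, hN, hN'⟩ := exists_fg_sub_mem_maximalIdeal_pow φ hfin e
  obtain ⟨n, g, hg⟩ := (Submodule.fg_iff_exists_fin_linearMap _ _).1 hN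
  have : IsHausdorff (maximalIdeal (Completion O)) (Completion A) := by
    refine IsHausdorff.of_map (J := maximalIdeal (Completion A)) ?_
    rw [hmap]
    exact Ideal.pow_le_self he0
  have := isPrecomplete_pi (maximalIdeal (Completion O)) n
  have hsurj : Function.Surjective g := by
    refine surjective_of_mkQ_comp_surjective (I := maximalIdeal (Completion O)) fun q => ?_
    obtain ⟨x, rfl⟩ := Submodule.Quotient.mk_surjective _ q
    obtain ⟨y, hy, hxy⟩ := hN' x
    rw [← hg] at hy
    obtain ⟨v, rfl⟩ := hy
    refine ⟨v, ?_⟩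
    refine ((Submodule.Quotient.eq _).2 ?_).symm
    rw [Ideal.smul_top_eq_map, Submodule.restrictScalars_mem, hmap]
    exact hxy
  exact Module.Finite.of_surjective g hsurj

end CompletionDVR

/-! ### The branch of a place -/

section BranchOfPlace
open IsLocalRing

variable {k F O : Type u} [CommRing O] [IsLocalRing O]
  [Field k] [Field F] [Algebra O F] [Algebra k F]
  {A : Place k F} (hA : A.Dominates O)

include hA in
theorem Place.Dominates.mem_maximalIdeal {x : O} (hx : x ∈ maximalIdeal O) :
    (⟨algebraMap O F x, hA.1 x⟩ : A.ring) ∈ maximalIdeal A.ring :=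
  (A.ring.valuation_lt_one_iff _).2 (hA.2 x hx)

/-- The local homomorphism from a local ring to the valuation ring of a place dominating it. -/
noncomputable def Place.Dominates.toRing : O →+* A.ring :=
  (algebraMap O F).codRestrict A.ring.toSubring hA.1

instance : IsLocalHom hA.toRing where
  map_nonunit x hx := by
    by_contra h
    exact (hA.mem_maximalIdeal ((mem_maximalIdeal x).2 h)) hx

variable [IsFractionRing O F]

theorem Place.Dominates.map_maximalIdeal_ne_bot (h0 : maximalIdeal O ≠ ⊥) :
    (maximalIdeal O).map hA.toRing ≠ ⊥ := by
  obtain ⟨x, hx, hx0⟩ := Submodule.exists_mem_ne_zero_of_ne_bot h0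
  intro h
  have h1 := Ideal.mem_map_of_mem hA.toRing hx
  rw [h, Ideal.mem_bot] at h1
  have h2 : algebraMap O F x = 0 := congrArg Subtype.val h1
  exact hx0 (by simpa using h2)

/-- The homomorphism from the localized completion to the completed field at the place. -/
noncomputable def Place.Dominates.toCompletedField [IsDomain O] :
    LocalizedCompletion O →+* FractionRing (Completion A.ring) :=
  IsLocalization.lift (M := Algebra.algebraMapSubmonoid (Completion O) (nonZeroDivisors O))
    (g := (algebraMap (Completion A.ring) (FractionRing (Completion A.ring))).comp
      (completionMap hA.toRing)) (by
    rintro ⟨_, s, hs, rfl⟩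
    rw [isUnit_iff_ne_zero]
    intro h
    change algebraMap (Completion A.ring) (FractionRing (Completion A.ring))
      (completionMap hA.toRing (algebraMap O (Completion O) s)) = 0 at h
    rw [FaithfulSMul.algebraMap_eq_zero_iff, completionMap_algebraMap] at h
    have h1 : algebraMap O F s = 0 := congrArg Subtype.val
      (algebraMap_completion_injective (h.trans (map_zero _).symm))
    exact nonZeroDivisors.ne_zero hs (by simpa using h1))

variable [IsDomain O]

theorem Place.Dominates.toCompletedField_algebraMap (y : Completion O) :
    hA.toCompletedField (algebraMap _ _ y) =
      algebraMap (Completion A.ring) (FractionRing (Completion A.ring))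
        (completionMap hA.toRing y) :=
  IsLocalization.lift_eq _ y

/-- On the valuation ring `A` the composite `F → K → Frac Â` is the canonical map, although the
map from `K` is defined through `Ô`. -/
theorem Place.Dominates.toCompletedField_fromFractionField {f : F} (hf : f ∈ A.ring) :
    hA.toCompletedField (fromFractionField O F f) =
      algebraMap (Completion A.ring) (FractionRing (Completion A.ring))
        (algebraMap A.ring (Completion A.ring) ⟨f, hf⟩) := by
  have key : ∀ x : O, hA.toCompletedField (fromFractionField O F (algebraMap O F x)) =
      algebraMap (Completion A.ring) (FractionRing (Completion A.ring))
        (algebraMap A.ring (Completion A.ring) (hA.toRing x)) := by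
    intro x
    rw [← completionMap_algebraMap, ← hA.toCompletedField_algebraMap]
    exact congrArg hA.toCompletedField (IsLocalization.map_eq (M := nonZeroDivisors O)
      (T := Algebra.algebraMapSubmonoid (Completion O) (nonZeroDivisors O))
      (Q := LocalizedCompletion O) (Submonoid.le_comap_map (nonZeroDivisors O)) x)
  obtain ⟨x, s, hs, hxs⟩ := IsFractionRing.div_surjective O f
  have hs0 : algebraMap O F s ≠ 0 := IsFractionRing.to_map_ne_zero_of_mem_nonZeroDivisors hs
  have h1 : f * algebraMap O F s = algebraMap O F x := by
    rw [← hxs, div_mul_cancel₀ _ hs0]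
  have h2 : (⟨f, hf⟩ : A.ring) * hA.toRing s = hA.toRing x := Subtype.ext h1
  have h3 := key x
  rw [← h1, map_mul, map_mul, key, ← h2, map_mul, map_mul] at h3
  refine mul_right_cancel₀ ?_ h3
  intro h
  rw [FaithfulSMul.algebraMap_eq_zero_iff] at h
  exact hs0 (congrArg Subtype.val
      (algebraMap_completion_injective (h.trans (map_zero _).symm)))

variable [IsNoetherianRing O]

/-- The completed field is integral over the localized completion: `Â` is finite over `Ô`, and every
denominator divides a power of an element of `O`, which is invertible in the localized
completion. -/
theorem Place.Dominates.isIntegral_toCompletedField (h0 : maximalIdeal O ≠ ⊥)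
    (hfin : ((residue A.ring).comp hA.toRing).Finite) : hA.toCompletedField.IsIntegral := by
  have h1 := completionMap_finite hA.toRing hfin (hA.map_maximalIdeal_ne_bot h0)
  intro e
  obtain ⟨p, hp⟩ := IsDiscreteValuationRing.exists_irreducible A.ring
  obtain ⟨x, hx, hx0⟩ := Submodule.exists_mem_ne_zero_of_ne_bot h0
  have hint : ∀ c : Completion A.ring, hA.toCompletedField.IsIntegralElem
      (algebraMap (Completion A.ring) (FractionRing (Completion A.ring)) c) := by
    intro c
    obtain ⟨P, hP, hP'⟩ := h1.to_isIntegral c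
    refine ⟨P.map (algebraMap _ _), hP.map _, ?_⟩
    rw [Polynomial.eval₂_map]
    have h2 : hA.toCompletedField.comp (algebraMap (Completion O) (LocalizedCompletion O)) =
        (algebraMap (Completion A.ring) (FractionRing (Completion A.ring))).comp
          (completionMap hA.toRing) := RingHom.ext hA.toCompletedField_algebraMap
    rw [h2, ← Polynomial.hom_eval₂, hP', map_zero]
  obtain ⟨a, b, hb, rfl⟩ := IsFractionRing.div_surjective (Completion A.ring) e
  obtain ⟨j, u, rfl⟩ := exists_associated_pow_completion hp (nonZeroDivisors.ne_zero hb)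
  -- `x ^ j` is divisible by the denominator
  obtain ⟨w, hw⟩ : ∃ w, hA.toRing x = p * w := by
    have := hA.mem_maximalIdeal hx
    rw [hp.maximalIdeal_eq, Ideal.mem_span_singleton] at this
    exact this
  have hs : x ^ j ∈ nonZeroDivisors O := mem_nonZeroDivisors_of_ne_zero (pow_ne_zero _ hx0)
  set ι := algebraMap (Completion A.ring) (FractionRing (Completion A.ring))
  let s : Algebra.algebraMapSubmonoid (Completion O) (nonZeroDivisors O) :=
    ⟨algebraMap O (Completion O) (x ^ j), x ^ j, hs, rfl⟩
  have hE : ι a / ι (algebraMap A.ring (Completion A.ring) p ^ j * u) =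
      ι (a * (u⁻¹ : (Completion A.ring)ˣ) * algebraMap A.ring (Completion A.ring) w ^ j) *
      hA.toCompletedField (IsLocalization.mk' (LocalizedCompletion O) (1 : Completion O) s) := by
    have hz := congrArg hA.toCompletedField
      (IsLocalization.mk'_spec (LocalizedCompletion O) (1 : Completion O) s)
    generalize IsLocalization.mk' (LocalizedCompletion O) (1 : Completion O) s = z at hz ⊢
    rw [map_mul, hA.toCompletedField_algebraMap, completionMap_algebraMap, map_pow, hw,
      map_one, map_one, map_pow, map_mul, mul_pow] at hz
    have hu : ι (u⁻¹ : (Completion A.ring)ˣ) * ι u = 1 := by rw [← map_mul, Units.inv_mul, map_one]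
    rw [div_eq_iff (IsFractionRing.to_map_ne_zero_of_mem_nonZeroDivisors hb)]
    simp only [map_mul, map_pow] at hz ⊢
    linear_combination (-ι a) * hu - ι a * (ι u⁻¹.1 * ι u.1) * hz
  rw [hE]
  exact (hint _).mul hA.toCompletedField (RingHom.isIntegralElem_map _)

/-- The ring of integers of the completed field at a place, as the unit ball of the valuation
defined by the completed valuation ring. -/
noncomputable def Place.completedIntegers (A : Place k F) :
    ValuationSubring (FractionRing (Completion A.ring)) :=
  (ValuationRing.valuation (Completion A.ring) (FractionRing (Completion A.ring))).valuationSubring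

theorem Place.mem_completedIntegers (A : Place k F) {e : FractionRing (Completion A.ring)} :
    e ∈ A.completedIntegers ↔ ∃ c, algebraMap (Completion A.ring) _ c = e :=
  ValuationRing.mem_integer_iff _ _ _

/-- The ring of integers of the completed field is the completed valuation ring. -/
noncomputable def Place.completedIntegersEquiv (A : Place k F) :
    Completion A.ring ≃+* A.completedIntegers :=
  RingEquiv.ofBijective ((algebraMap (Completion A.ring)
    (FractionRing (Completion A.ring))).codRestrict A.completedIntegers.toSubring
      fun c => A.mem_completedIntegers.2 ⟨c, rfl⟩)
    ⟨fun _ _ h => IsFractionRing.injective _ _ (congrArg Subtype.val h), fun e =>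
      (A.mem_completedIntegers.1 e.2).imp fun _ h => Subtype.ext h⟩

instance (A : Place k F) : IsDiscreteValuationRing A.completedIntegers :=
  IsDiscreteValuationRing.RingEquivClass.isDiscreteValuationRing A.completedIntegersEquiv

/-- A place of a function field which dominates a one-dimensional local ring is induced by a
branch of that ring: its ideal is the kernel of the map from the localized completion to the
completed field, which is maximal by integrality, and its ring of integers is induced from that
field. -/
theorem Place.Dominates.exists_branch [Algebra k O] [IsScalarTower k O F] (h0 : maximalIdeal O ≠ ⊥)
    (hfin : ((residue A.ring).comp hA.toRing).Finite) : ∃ b : Branch O, b.place k F = A := by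
  let χ := hA.toCompletedField
  have hmax : (RingHom.ker χ).IsMaximal :=
    Ideal.isMaximal_comap_of_isIntegral_of_isMaximal' χ (hA.isIntegral_toCompletedField h0 hfin) ⊥
  let χ' : (RingHom.ker χ).ResidueField →+* FractionRing (Completion A.ring) :=
    Ideal.ResidueField.lift _ χ le_rfl fun x hx => by
      change IsUnit (χ x)
      rw [isUnit_iff_ne_zero]; exact hx
  have hχ' : ∀ z, χ' (algebraMap _ _ z) = χ z := fun z =>
    Ideal.ResidueField.lift_algebraMap _ _ _ _ _
  obtain ⟨p, hp⟩ := IsDiscreteValuationRing.exists_irreducible A.ring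
  let φ : F →+* (RingHom.ker χ).ResidueField :=
    (algebraMap (LocalizedCompletion O) (RingHom.ker χ).ResidueField).comp (fromFractionField O F)
  have hφ : ∀ a : A.ring, χ' (φ a) = algebraMap (Completion A.ring) _
      (algebraMap A.ring (Completion A.ring) a) := fun a =>
    (hχ' _).trans (hA.toCompletedField_fromFractionField a.2)
  have hp0 : φ p ≠ 0 := by
    rw [map_ne_zero]
    exact fun h => hp.ne_zero (Subtype.ext h)
  have hdvr : IsDiscreteValuationRing (A.completedIntegers.comap χ') := by
    refine isDiscreteValuationRing_comap χ' A.completedIntegers (Units.mk0 (φ p) hp0) ?_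
    refine ord_irreducible _ (x := A.completedIntegersEquiv (algebraMap A.ring _ p)) ?_ (hφ p)
    rw [MulEquiv.irreducible_iff, IsDiscreteValuationRing.irreducible_iff_uniformizer]
    exact maximalIdeal_completion_eq hp
  let b : Branch O :=
    { ideal := ⟨RingHom.ker χ, hmax⟩
      integers := A.completedIntegers.comap χ'
      isDiscreteValuationRing := hdvr
      mem_integers := fun y => by
        rw [ValuationSubring.mem_comap, Place.mem_completedIntegers]
        exact ⟨_, ((hχ' _).trans (hA.toCompletedField_algebraMap y)).symm⟩
      valuation_lt_one := fun x hx => by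
        by_contra! h
        have h1 : (toFactor O ⟨_, hmax⟩ (algebraMap O (Completion O) x))⁻¹ ∈
            A.completedIntegers.comap χ' := by
          rw [← ValuationSubring.valuation_le_one_iff, map_inv₀]
          exact inv_le_one_of_one_le₀ h
        have h2 : χ' (toFactor O ⟨_, hmax⟩ (algebraMap O (Completion O) x)) =
            algebraMap (Completion A.ring) _ (algebraMap A.ring _ (hA.toRing x)) := by
          rw [← completionMap_algebraMap, ← hA.toCompletedField_algebraMap]
          exact hχ' _
        obtain ⟨c, hc⟩ := A.mem_completedIntegers.1 h1
        rw [map_inv₀, h2] at hc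
        have h3 := Ideal.mem_map_of_mem (algebraMap A.ring (Completion A.ring))
          (hA.mem_maximalIdeal hx)
        rw [← AdicCompletion.maximalIdeal_eq_map] at h3
        refine h3 (IsUnit.of_mul_eq_one c (IsFractionRing.injective (Completion A.ring)
          (FractionRing (Completion A.ring)) ?_))
        rw [map_mul, map_one, hc]
        refine mul_inv_cancel₀ fun h4 => ?_
        rw [(map_eq_zero χ').1 (h2.trans h4), map_zero] at h
        exact not_le_of_gt zero_lt_one h }
  -- both rings are discrete valuation rings of `F`, so that an inclusion is enough
  refine ⟨b, Place.ext (ValuationSubring.eq_of_le_of_ne_top _ ?_ (b.place k F).ring_ne_top).symm⟩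
  intro a ha
  change χ' (φ a) ∈ A.completedIntegers
  exact A.mem_completedIntegers.2 ⟨_, (hφ ⟨a, ha⟩).symm⟩

end BranchOfPlace

/-! ### The local symbol as a product over places -/

section LocalSymbol
open IsLocalRing
open scoped IntermediateField

variable {k F O : Type u} [CommRing O] [IsLocalRing O]
  [Field k] [Field F] [Algebra O F] [Algebra k F]

/-- The places dominating `O` are among the zeros of any element `t` of its maximal ideal. -/
theorem finite_dominates [PerfectField k] {t : O} (ht : t ∈ maximalIdeal O)
    (htr : Transcendental k (algebraMap O F t))
    [FiniteDimensional k⟮algebraMap O F t⟯ F] :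
    {A : Place k F | A.Dominates O}.Finite ∧
      ∀ A : Place k F, A.Dominates O → A.residueMap.Finite := by
  have h0 : algebraMap O F t ≠ 0 := fun h => htr (h ▸ isAlgebraic_zero)
  have : FiniteDimensional k⟮((Units.mk0 (algebraMap O F t) h0 : Fˣ) : F)⟯ F := ‹_›
  have key := finite_zeros (k := k) (Units.mk0 (algebraMap O F t) h0) htr
  have h1 : ∀ A : Place k F, A.Dominates O → 0 < ord A.ring (Units.mk0 (algebraMap O F t) h0) :=
    fun A hA => (ord_pos_iff _).2 (hA.2 t ht)
  exact ⟨key.1.subset h1, fun A hA => key.2 A (h1 A hA)⟩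

variable [Algebra k O] [IsScalarTower k O F]

theorem Place.Dominates.residueMap_comp_finite {A : Place k F} (hA : A.Dominates O)
    (h : A.residueMap.Finite) : ((residue A.ring).comp hA.toRing).Finite := by
  refine RingHom.Finite.of_comp_finite (f := algebraMap k O) ?_
  convert h
  ext c
  refine congrArg (residue A.ring) (Subtype.ext ?_)
  exact (IsScalarTower.algebraMap_apply k O F c).symm

variable [IsDomain O] [IsNoetherianRing O] [IsFractionRing O F]

variable (k F O) in
/-- The branches of a one-dimensional local ring of a function field correspond to the places of
the field which dominate the local ring. -/
noncomputable def branchEquivPlace (h0 : maximalIdeal O ≠ ⊥)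
    (hres : ∀ A : Place k F, A.Dominates O → A.residueMap.Finite) :
    Branch O ≃ {A : Place k F | A.Dominates O} :=
  Equiv.ofBijective (fun b => ⟨b.place k F, b.place_dominates⟩)
    ⟨fun _ _ h => Branch.place_injective (congrArg Subtype.val h), fun ⟨A, hA⟩ =>
      (hA.exists_branch h0 (hA.residueMap_comp_finite (hres A hA))).imp
        fun _ h => Subtype.ext h⟩

variable (hres : ∀ A : Place k F, A.Dominates O → A.residueMap.Finite)
  (hfin : {A : Place k F | A.Dominates O}.Finite)
include hres hfin

theorem finite_branch (h0 : maximalIdeal O ≠ ⊥) : Finite (Branch O) :=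
  have := hfin.to_subtype
  Finite.of_equiv _ (branchEquivPlace k F O h0 hres).symm

/-- The norm to `k` of the symbol at a one-dimensional local ring is the product of the symbols at
the places dominating it. -/
theorem unitsNorm_localSymbol (h0 : maximalIdeal O ≠ ⊥) (f g : Fˣ) :
    unitsNorm ((residue O).comp (algebraMap k O)) (localSymbol O f g) =
      ∏ᶠ A ∈ {A : Place k F | A.Dominates O}, A.symbol f g := by
  have := finite_branch hres hfin h0
  rw [localSymbol, MonoidHom.map_finprod _ (Set.toFinite _)]
  refine (finprod_congr fun b => b.unitsNorm_tameSymbol f g).trans ?_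
  rw [← finprod_set_coe_eq_finprod_mem]
  exact finprod_eq_of_bijective _ (branchEquivPlace k F O h0 hres).bijective fun _ => rfl

end LocalSymbol

/-! ### Transcendence degree and dimension -/

section TranscendenceDegree
open Algebra
open scoped IntermediateField

theorem two_le_krullDim {α : Type*} [Preorder α] {a b c : α} (hab : a < b) (hbc : b < c) :
    2 ≤ Order.krullDim α :=
  Order.le_krullDim_iff (n := 2).2 ⟨
    { length := 2
      toFun := ![a, b, c]
      step := fun i => by
        fin_cases i
        · exact hab
        · exact hbc }, rfl⟩

/-- An integral extension of a ring of dimension at least two has dimension at least two. -/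
theorem two_le_ringKrullDim_of_isIntegral {P R : Type*} [CommRing P] [CommRing R] [Algebra P R]
    [FaithfulSMul P R] [Algebra.IsIntegral P R] (h : 2 ≤ ringKrullDim P) : 2 ≤ ringKrullDim R := by
  obtain ⟨l, hl⟩ := Order.le_krullDim_iff (n := 2).1 h
  have h01 : l ⟨0, by omega⟩ < l ⟨1, by omega⟩ := l.strictMono (Fin.mk_lt_mk.2 Nat.zero_lt_one)
  have h12 : l ⟨1, by omega⟩ < l ⟨2, by omega⟩ := l.strictMono (Fin.mk_lt_mk.2 Nat.one_lt_two)
  obtain ⟨q₀, -, hq₀, hq₀'⟩ := Ideal.exists_ideal_over_prime_of_isIntegral (S := R)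
    (l ⟨0, by omega⟩).asIdeal ⊥ (by
      rw [← RingHom.ker_eq_comap_bot, (RingHom.injective_iff_ker_eq_bot _).1
        (FaithfulSMul.algebraMap_injective P R)]
      exact bot_le)
  obtain ⟨q₁, h₁, hq₁, hq₁'⟩ := Ideal.exists_ideal_over_prime_of_isIntegral
    (l ⟨1, by omega⟩).asIdeal q₀ (by rw [hq₀']; exact h01.le)
  obtain ⟨q₂, h₂, hq₂, hq₂'⟩ := Ideal.exists_ideal_over_prime_of_isIntegral
    (l ⟨2, by omega⟩).asIdeal q₁ (by rw [hq₁']; exact h12.le)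
  have h₁' : (⟨q₀, hq₀⟩ : PrimeSpectrum R) < ⟨q₁, hq₁⟩ := by
    refine lt_of_le_of_ne h₁ fun h => h01.ne (PrimeSpectrum.ext ?_)
    rw [← hq₀', ← hq₁', show q₀ = q₁ from congrArg PrimeSpectrum.asIdeal h]
  have h₂' : (⟨q₁, hq₁⟩ : PrimeSpectrum R) < ⟨q₂, hq₂⟩ := by
    refine lt_of_le_of_ne h₂ fun h => h12.ne (PrimeSpectrum.ext ?_)
    rw [← hq₂', ← hq₁', show q₁ = q₂ from congrArg PrimeSpectrum.asIdeal h]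
  exact two_le_krullDim h₁' h₂'

/-- The fraction field of a finitely generated domain of dimension at most one is finite over the
subfield generated by any transcendental element. By Noether normalization its transcendence degree
is at most one. -/
theorem finiteDimensional_adjoin_of_ringKrullDim_le_one {k : Type u} (R : Type u) {F : Type u}
    [Field k] [CommRing R] [IsDomain R] [Algebra k R] [Algebra.FiniteType k R] [Field F]
    [Algebra R F] [IsFractionRing R F] [Algebra k F] [IsScalarTower k R F]
    (hdim : ringKrullDim R ≤ 1)
    (t : F) (ht : Transcendental k t) : FiniteDimensional k⟮t⟯ F := by
  obtain ⟨s, g, hg, hg'⟩ := exists_integral_inj_algHom_of_fg k R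
  let _ := g.toRingHom.toAlgebra
  have : Algebra.IsIntegral (MvPolynomial (Fin s) k) R := ⟨hg'⟩
  have : FaithfulSMul (MvPolynomial (Fin s) k) R := (faithfulSMul_iff_algebraMap_injective _ _).2 hg
  have : IsScalarTower k (MvPolynomial (Fin s) k) R :=
    .of_algebraMap_eq fun c => (g.commutes c).symm
  have hs : s ≤ 1 := by
    by_contra! hs
    have h2 : 2 ≤ ringKrullDim R := two_le_ringKrullDim_of_isIntegral
      (P := MvPolynomial (Fin s) k) (by
      simp
      exact_mod_cast hs)
    exact absurd (h2.trans hdim) (by decide)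
  have htr : Algebra.trdeg k F ≤ 1 := by
    have : FaithfulSMul k R := (faithfulSMul_iff_algebraMap_injective _ _).2
      (algebraMap k R).injective
    have h1 := trdeg_eq_zero_iff.2 (inferInstance :
      Algebra.IsAlgebraic (MvPolynomial (Fin s) k) R)
    have h2 := trdeg_eq_zero_iff.2 (IsLocalization.isAlgebraic (R := R) (S := F)
      (M := nonZeroDivisors R))
    rw [← trdeg_add_eq k R, ← trdeg_add_eq k (MvPolynomial (Fin s) k), h1, h2,
      MvPolynomial.trdeg_of_isDomain]
    simpa using hs
  have hb : IsTranscendenceBasis k (fun _ : Unit => t) :=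
    AlgebraicIndependent.isTranscendenceBasis_of_lift_trdeg_le_of_finite
      ((algebraicIndependent_unique_type_iff).2 ht) (by simpa using htr)
  have halg := hb.isAlgebraic_field
  rw [Set.range_const] at halg
  have : Algebra.EssFiniteType R F := Algebra.EssFiniteType.of_isLocalization _ (nonZeroDivisors R)
  have : Algebra.EssFiniteType k F := Algebra.EssFiniteType.comp k R F
  have : Algebra.EssFiniteType k⟮t⟯ F := Algebra.EssFiniteType.of_comp k _ _
  exact Algebra.finite_of_essFiniteType_of_isAlgebraic

end TranscendenceDegree

/-! ### Projective curves -/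

section Curve
open IsLocalRing

attribute [local instance] MvPolynomial.gradedAlgebra

/-- `Proj` is proper over the spectrum of the degree zero part, which here is `k`. -/
theorem isProper_projSpace (k : Type u) [Field k] (n : ℕ) : IsProper (ProjSpace.toSpec k n) := by
  have h0 : IsScalarTower k (MvPolynomial.homogeneousSubmodule (Fin (n + 1)) k 0)
      (MvPolynomial (Fin (n + 1)) k) :=
    ⟨fun a x y => Algebra.smul_mul_assoc a (x : MvPolynomial (Fin (n + 1)) k) y⟩
  have h1 : Algebra.FiniteType (MvPolynomial.homogeneousSubmodule (Fin (n + 1)) k 0)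
      (MvPolynomial (Fin (n + 1)) k) :=
    Algebra.FiniteType.of_restrictScalars_finiteType k _ _
  have h2 : IsClosedImmersion (Spec.map (CommRingCat.ofHom
      (algebraMap k (MvPolynomial.homogeneousSubmodule (Fin (n + 1)) k 0)))) := by
    refine IsClosedImmersion.spec_of_surjective _ fun x => ?_
    have hx := (MvPolynomial.homogeneousSubmodule_zero (σ := Fin (n + 1)) (R := k)).le x.2
    exact (Submodule.mem_one.1 hx).imp fun c hc => Subtype.ext hc
  rw [ProjSpace.toSpec]
  infer_instance

variable {k : Type u} [Field k] {C : Scheme.{u}} (s : C ⟶ Spec (CommRingCat.of k))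

theorem IsProjective.isProper (h : IsProjective s) : IsProper s := by
  obtain ⟨n, i, hi, rfl⟩ := h
  have := isProper_projSpace k n
  infer_instance

/-- The homomorphism from the base field to the local ring of a point. -/
noncomputable def baseToStalk (p : C) : k →+* C.presheaf.stalk p :=
  ((Scheme.ΓSpecIso (CommRingCat.of k)).inv ≫ s.appTop ≫ C.presheaf.germ ⊤ p trivial).hom

theorem fromSpecStalk_comp (p : C) :
    C.fromSpecStalk p ≫ s = Spec.map (CommRingCat.ofHom (baseToStalk s p)) := by
  have h := Scheme.toSpecΓ_naturality s
  rw [← cancel_mono (Spec (CommRingCat.of k)).toSpecΓ, Category.assoc, h,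
    ← SpecMap_ΓSpecIso_hom, ← Spec.map_comp, ← Category.assoc,
    Scheme.fromSpecStalk_toSpecΓ, ← Spec.map_comp]
  congr 1
  simp [baseToStalk]

theorem baseToResidueField_finite [IsProper s] {p : C} (hp : IsClosed ({p} : Set C)) :
    (baseToResidueField s p).Finite := by
  have : JacobsonSpace C := LocallyOfFiniteType.jacobsonSpace s
  have : IsFinite (C.fromSpecResidueField p ≫ s) := by
    rw [isClosed_singleton_iff_isClosedImmersion] at hp
    rw [isFinite_iff_locallyOfFiniteType_of_jacobsonSpace]
    infer_instance
  rw [Scheme.fromSpecResidueField, Category.assoc, fromSpecStalk_comp, ← Spec.map_comp,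
    IsFinite.SpecMap_iff] at this
  exact this

/-- A proper specialization `q` of `p` would give a chain `q`, `p`, generic point of length two. -/
theorem isClosed_singleton_of_ne_genericPoint [IsIntegral C] (hdim : topologicalKrullDim C ≤ 1)
    {p : C} (hp : p ≠ genericPoint C) : IsClosed ({p} : Set C) := by
  by_contra h
  obtain ⟨q, hq, hqp⟩ : ∃ q ∈ closure ({p} : Set C), q ≠ p := by
    by_contra! h'
    refine h (closure_subset_iff_isClosed.1 fun q hq => h' q hq)
  let Z : C → TopologicalSpace.IrreducibleCloseds C := fun x =>
    ⟨closure {x}, isIrreducible_singleton.closure, isClosed_closure⟩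
  have hle : ∀ {x y : C}, Z x ≤ Z y ↔ y ⤳ x := fun {x y} => by
    change closure {x} ⊆ closure {y} ↔ _
    rw [specializes_iff_closure_subset]
  have hlt : ∀ {x y : C}, y ⤳ x → x ≠ y → Z x < Z y := fun {x y} h hne =>
    lt_of_le_not_ge (hle.2 h) fun h' => hne ((hle.1 h').antisymm h).eq
  have h2 : 2 ≤ topologicalKrullDim C := two_le_krullDim
    (hlt (specializes_iff_mem_closure.2 hq) hqp)
    (hlt ((genericPoint_spec C).specializes trivial) hp)
  exact absurd (h2.trans hdim) (by decide)

theorem not_isClosed_genericPoint [IsIntegral C] (hdim : topologicalKrullDim C = 1) :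
    ¬ IsClosed ({genericPoint C} : Set C) := by
  intro h
  have h1 : ({genericPoint C} : Set C) = Set.univ := by
    rw [← h.closure_eq]; exact genericPoint_spec C
  have : Subsingleton C := Set.subsingleton_univ_iff.1 (h1 ▸ Set.subsingleton_singleton)
  have h2 := topologicalKrullDim_zero_of_discreteTopology C
  rw [hdim] at h2
  exact absurd h2 (by decide)

theorem finiteDimensional_functionField [IsIntegral C] [IsProper s]
    (hdim : topologicalKrullDim C ≤ 1) [Algebra k C.functionField]
    (h : algebraMap k C.functionField = baseToStalk s (genericPoint C)) (t : C.functionField)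
    (ht : Transcendental k t) :
    FiniteDimensional (IntermediateField.adjoin k {t}) C.functionField := by
  obtain ⟨_, ⟨U, (hU : IsAffineOpen U), rfl⟩, hxU, -⟩ :=
    C.isBasis_affineOpens.exists_subset_of_mem_open (Set.mem_univ (genericPoint C)) isOpen_univ
  have : Nonempty U := ⟨⟨_, hxU⟩⟩
  have : IsFractionRing Γ(C, U) C.functionField :=
    functionField_isFractionRing_of_isAffineOpen C U hU
  let φ : k →+* Γ(C, U) := ((Scheme.ΓSpecIso (CommRingCat.of k)).inv ≫ s.appLE ⊤ U le_top).hom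
  let _ := φ.toAlgebra
  have hφ : φ.FiniteType := by
    refine (s.finiteType_appLE (isAffineOpen_top _) hU _).comp ?_
    refine RingHom.FiniteType.of_surjective _ ?_
    exact (ConcreteCategory.bijective_of_isIso (Scheme.ΓSpecIso (CommRingCat.of k)).inv).2
  have : Algebra.FiniteType k Γ(C, U) := hφ
  have : IsScalarTower k Γ(C, U) C.functionField := by
    refine .of_algebraMap_eq' ?_
    rw [h]
    have h1 : s.appLE ⊤ U le_top ≫ C.germToFunctionField U =
        s.appTop ≫ C.presheaf.germ ⊤ (genericPoint C) trivial := by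
      change (s.app ⊤ ≫ C.presheaf.map (homOfLE le_top).op) ≫ _ = _
      rw [Category.assoc]
      exact congrArg (s.appTop ≫ ·) (TopCat.Presheaf.germ_res _ _ _ _)
    change _ = ((Scheme.ΓSpecIso (CommRingCat.of k)).inv ≫ s.appLE ⊤ U le_top ≫
      C.germToFunctionField U).hom
    rw [h1, baseToStalk]
  refine finiteDimensional_adjoin_of_ringKrullDim_le_one Γ(C, U) ?_ t ht
  rw [← PrimeSpectrum.topologicalKrullDim_eq_ringKrullDim]
  exact (hU.fromSpec.isOpenEmbedding.isInducing.topologicalKrullDim_le).trans hdim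

end Curve

/-! ### The center of a place -/

section PlacePoint
open IsLocalRing

variable {k : Type u} [Field k] {C : Scheme.{u}} (s : C ⟶ Spec (CommRingCat.of k)) [IsIntegral C]

theorem algebraMap_comp_baseToStalk (p : C) :
    (algebraMap (C.presheaf.stalk p) C.functionField).comp (baseToStalk s p) =
      baseToStalk s (genericPoint C) := by
  have h : (C.presheaf.germ ⊤ p trivial) ≫
      C.presheaf.stalkSpecializes ((genericPoint_spec C).specializes (Set.mem_univ p)) =
        C.presheaf.germ ⊤ (genericPoint C) trivial := C.presheaf.germ_stalkSpecializes _ _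
  rw [baseToStalk, baseToStalk, ← h]
  rfl

variable [Algebra k C.functionField]
  (hk : algebraMap k C.functionField = baseToStalk s (genericPoint C))
include hk

/-- The morphism from the spectrum of a valuation ring dominating the local ring of a point. -/
noncomputable def Place.Dominates.specMap {A : Place k C.functionField} {p : C}
    (hA : A.Dominates (C.presheaf.stalk p)) : Spec (CommRingCat.of A.ring) ⟶ C :=
  Spec.map (CommRingCat.ofHom hA.toRing) ≫ C.fromSpecStalk p

omit hk in
theorem Place.Dominates.specMap_closedPoint {A : Place k C.functionField} {p : C}
    (hA : A.Dominates (C.presheaf.stalk p)) : hA.specMap (closedPoint A.ring) = p := by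
  have : IsLocalHom (CommRingCat.ofHom hA.toRing).hom := inferInstanceAs (IsLocalHom hA.toRing)
  have h := Spec_closedPoint (f := CommRingCat.ofHom hA.toRing)
  exact (congrArg (C.fromSpecStalk p) h).trans Scheme.fromSpecStalk_closedPoint

/-- The square of the valuative criterion given by a place: the spectrum of the function field maps
to the generic point, and the spectrum of the valuation ring to the base. -/
@[reducible] noncomputable def Place.valuativeCommSq (A : Place k C.functionField) :
    ValuativeCommSq s where
  R := A.ring
  K := C.functionField
  i₁ := C.fromSpecStalk (genericPoint C)
  i₂ := Spec.map (CommRingCat.ofHom ((algebraMap k C.functionField).codRestrict A.ring.toSubring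
    A.algebraMap_mem))
  commSq := ⟨by
    rw [fromSpecStalk_comp, ← Spec.map_comp, ← hk]
    rfl⟩

theorem Place.Dominates.specMap_comp {A : Place k C.functionField} {p : C}
    (hA : A.Dominates (C.presheaf.stalk p)) :
    hA.specMap ≫ s = (A.valuativeCommSq s hk).i₂ := by
  rw [Place.Dominates.specMap, Category.assoc, fromSpecStalk_comp, ← Spec.map_comp]
  refine congrArg Spec.map ?_
  refine CommRingCat.hom_ext (RingHom.ext fun c => ?_)
  refine Subtype.ext ?_
  refine (RingHom.congr_fun (algebraMap_comp_baseToStalk s p) c).trans ?_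
  rw [← hk]
  rfl

omit hk in
theorem Place.Dominates.specMap_fromSpecStalk {A : Place k C.functionField} {p : C}
    (hA : A.Dominates (C.presheaf.stalk p)) :
    Spec.map (CommRingCat.ofHom (algebraMap A.ring C.functionField)) ≫ hA.specMap =
      C.fromSpecStalk (genericPoint C) := by
  rw [Place.Dominates.specMap, ← Category.assoc, ← Spec.map_comp,
    ← Scheme.SpecMap_stalkSpecializes_fromSpecStalk
      ((genericPoint_spec C).specializes (Set.mem_univ p))]
  rfl

omit hk in
/-- A morphism from the spectrum of the valuation ring that extends the generic point is given by a
local homomorphism out of the local ring at the image of the closed point. -/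
theorem dominates_of_specMap {A : Place k C.functionField} {l : Spec (CommRingCat.of A.ring) ⟶ C}
    (hl : Spec.map (CommRingCat.ofHom (algebraMap A.ring C.functionField)) ≫ l =
      C.fromSpecStalk (genericPoint C)) :
    A.Dominates (C.presheaf.stalk (l (closedPoint A.ring))) := by
  let φ := Scheme.stalkClosedPointTo l
  have h1 : φ ≫ CommRingCat.ofHom (algebraMap A.ring C.functionField) =
      C.presheaf.stalkSpecializes ((genericPoint_spec C).specializes (Set.mem_univ _)) := by
    apply Spec.map_injective
    rw [← cancel_mono (C.fromSpecStalk _), Spec.map_comp, Category.assoc,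
      Scheme.Spec_stalkClosedPointTo_fromSpecStalk, hl,
      Scheme.SpecMap_stalkSpecializes_fromSpecStalk]
  have h2 : ∀ x, algebraMap _ C.functionField x = (φ.hom x : C.functionField) := fun x =>
    (RingHom.congr_fun (congrArg CommRingCat.Hom.hom h1) x).symm
  refine ⟨fun x => ?_, fun x hx => ?_⟩
  · rw [h2]; exact (φ.hom x).2
  · rw [h2]
    refine (A.ring.valuation_lt_one_iff _).1 ?_
    have : IsLocalHom φ.hom := inferInstance
    exact fun h => hx (isUnit_of_map_unit φ.hom x h)

/-- Every place of the function field has exactly one center: by the valuative criterion of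
properness the generic point extends uniquely to the spectrum of the valuation ring, and the center
is the image of the closed point. -/
theorem existsUnique_dominates [IsProper s] (A : Place k C.functionField) :
    ∃! p : C, A.Dominates (C.presheaf.stalk p) := by
  have h1 : ValuativeCriterion s := by
    have : IsProper s := inferInstance
    rw [IsProper.eq_valuativeCriterion] at this
    exact this.1.1.1
  obtain ⟨⟨⟨⟨l, hl₁, hl₂⟩⟩, hl⟩⟩ := h1 (A.valuativeCommSq s hk)
  have key : ∀ q, ∀ hq : A.Dominates (C.presheaf.stalk q), hq.specMap = l := fun q hq =>
    congrArg CommSq.LiftStruct.l (hl ⟨hq.specMap, hq.specMap_fromSpecStalk, hq.specMap_comp s hk⟩)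
  refine ⟨l (closedPoint A.ring), dominates_of_specMap hl₁, fun q hq => ?_⟩
  rw [← key q hq]
  exact hq.specMap_closedPoint.symm

end PlacePoint

/-! ### Products over the closed points -/

section Assembly
open IsLocalRing
open scoped IntermediateField

theorem finprod_fiberwise {α β M : Type*} [CommMonoid M] (f : α → M) (c : α → β)
    (hf : (Function.mulSupport f).Finite) :
    ∏ᶠ b, ∏ᶠ a ∈ c ⁻¹' {b}, f a = ∏ᶠ a, f a := by
  classical
  have h1 : ∀ b, ∏ᶠ a ∈ c ⁻¹' {b}, f a = ∏ a ∈ hf.toFinset with c a = b, f a := by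
    intro b
    rw [← finprod_mem_inter_mulSupport, ← finprod_mem_coe_finset]
    refine finprod_mem_congr ?_ fun _ _ => rfl
    ext a
    simp [and_comm]
  simp only [h1]
  rw [finprod_eq_prod_of_mulSupport_subset (s := hf.toFinset.image c),
    Finset.prod_fiberwise_of_maps_to (fun a ha => Finset.mem_image_of_mem c ha),
    finprod_eq_prod_of_mulSupport_subset (s := hf.toFinset) _ (by simp)]
  intro b hb
  obtain ⟨a, ha, -⟩ := Finset.exists_ne_one_of_prod_ne_one hb
  rw [Finset.mem_filter] at ha
  exact Finset.mem_coe.2 (Finset.mem_image.2 ⟨a, ha⟩)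

theorem finite_finprod_fiber_ne_one {α β M : Type*} [CommMonoid M] (f : α → M) (c : α → β)
    (hf : (Function.mulSupport f).Finite) :
    {b | ∏ᶠ a ∈ c ⁻¹' {b}, f a ≠ 1}.Finite := by
  refine (hf.image c).subset fun b hb => ?_
  obtain ⟨a, ha, ha'⟩ := exists_ne_one_of_finprod_mem_ne_one hb
  exact ⟨a, ha', ha⟩

theorem transcendental_of_mem_maximalIdeal {k O : Type*} [Field k] [CommRing O] [IsLocalRing O]
    [IsDomain O] [Algebra k O] {t : O} (ht : t ∈ maximalIdeal O) (h0 : t ≠ 0) :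
    Transcendental k t := fun h => ht (h.isIntegral.isUnit h0)

variable {k : Type u} [Field k] {C : Scheme.{u}} (s : C ⟶ Spec (CommRingCat.of k)) [IsIntegral C]

theorem maximalIdeal_stalk_ne_bot {p : C} (hp : p ≠ genericPoint C) :
    maximalIdeal (C.presheaf.stalk p) ≠ ⊥ := by
  intro h
  have h1 : genericPoint C ∈ Set.range (C.fromSpecStalk p) := by
    rw [Scheme.range_fromSpecStalk]
    exact (genericPoint_spec C).specializes trivial
  obtain ⟨q, hq⟩ := h1
  have h2 : q = closedPoint (C.presheaf.stalk p) := by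
    refine PrimeSpectrum.ext ?_
    exact le_antisymm (le_maximalIdeal q.2.ne_top) (h.le.trans bot_le)
  rw [h2, Scheme.fromSpecStalk_closedPoint] at hq
  exact hp hq

theorem Place.Dominates.ne_genericPoint [Algebra k C.functionField] {A : Place k C.functionField}
    {p : C} (h : A.Dominates (C.presheaf.stalk p)) : p ≠ genericPoint C := by
  rintro rfl
  refine A.ring_ne_top (top_le_iff.1 fun x _ => ?_)
  have h1 := RingHom.congr_fun (congrArg CommRingCat.Hom.hom
    (TopCat.Presheaf.stalkSpecializes_refl C.presheaf (genericPoint C))) x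
  exact Eq.subst (motive := fun y : C.functionField => y ∈ A.ring) h1 (h.1 x)

end Assembly

end WeilReciprocity

open WeilReciprocity

theorem mainTheorem4 {k : Type u} [Field k] [PerfectField k]
    {C : Scheme.{u}} (s : C ⟶ Spec (CommRingCat.of k)) [IsIntegral C]
    (hproj : WeilReciprocity.IsProjective s) (hdim : topologicalKrullDim C = 1)
    (f g : C.functionFieldˣ) :
    (∀ p : {p : C // IsClosed ({p} : Set C)},
      (WeilReciprocity.baseToResidueField s p.1).Finite ∧
      Finite (WeilReciprocity.Branch (C.presheaf.stalk p.1)) ∧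
      ∀ b : WeilReciprocity.Branch (C.presheaf.stalk p.1), b.residueMap.Finite) ∧
    {p : {p : C // IsClosed ({p} : Set C)} |
      WeilReciprocity.localFactor s f g p.1 ≠ 1}.Finite ∧
    ∏ᶠ p : {p : C // IsClosed ({p} : Set C)}, WeilReciprocity.localFactor s f g p.1 = 1 := by
  have := hproj.isProper
  have : IsLocallyNoetherian C := LocallyOfFiniteType.isLocallyNoetherian s
  let _ : Algebra k C.functionField := (baseToStalk s (genericPoint C)).toAlgebra
  have hfd := finiteDimensional_functionField s hdim.le rfl
  -- the local factor at a closed point is the product over the places centered there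
  have hlocal : ∀ p : C, IsClosed ({p} : Set C) → Finite (Branch (C.presheaf.stalk p)) ∧
      (∀ b : Branch (C.presheaf.stalk p), b.residueMap.Finite) ∧
      localFactor s f g p = ∏ᶠ A ∈ {A : Place k C.functionField | A.Dominates (C.presheaf.stalk p)},
        A.symbol f g := by
    intro p hp
    have hp' : p ≠ genericPoint C := by
      rintro rfl; exact not_isClosed_genericPoint hdim hp
    let _ : Algebra k (C.presheaf.stalk p) := (baseToStalk s p).toAlgebra
    have : IsScalarTower k (C.presheaf.stalk p) C.functionField :=
      .of_algebraMap_eq' (algebraMap_comp_baseToStalk s p).symm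
    have h0 := maximalIdeal_stalk_ne_bot hp'
    obtain ⟨t, ht, ht0⟩ := Submodule.exists_mem_ne_zero_of_ne_bot h0
    have htr : Transcendental k (algebraMap (C.presheaf.stalk p) C.functionField t) :=
      (transcendental_algebraMap_iff (FaithfulSMul.algebraMap_injective _ _)).2
        (transcendental_of_mem_maximalIdeal ht ht0)
    have := hfd _ htr
    obtain ⟨hfin, hres⟩ := finite_dominates ht htr
    have hb := finite_branch hres hfin h0
    exact ⟨hb, fun b => b.residueMap_finite (hres _ b.place_dominates),
      unitsNorm_localSymbol hres hfin h0 f g⟩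
  -- the center `c A` of a place `A` is a closed point
  choose c hc hc' using existsUnique_dominates s rfl
  have hcl : ∀ A, IsClosed ({c A} : Set C) := fun A =>
    isClosed_singleton_of_ne_genericPoint hdim.le (hc A).ne_genericPoint
  have hfac : ∀ p : {p : C // IsClosed ({p} : Set C)}, localFactor s f g p.1 =
      ∏ᶠ A ∈ (fun A => (⟨c A, hcl A⟩ : {p : C // IsClosed ({p} : Set C)})) ⁻¹' {p},
        A.symbol f g := by
    intro p
    rw [(hlocal p.1 p.2).2.2]
    refine finprod_mem_congr (Set.ext fun A => ?_) fun _ _ => rfl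
    exact ⟨fun h => Subtype.ext (hc' A _ h).symm, fun h => congrArg Subtype.val h ▸ hc A⟩
  obtain ⟨hsupp, hprod⟩ := finprod_symbol hfd f g
  refine ⟨fun p => ⟨baseToResidueField_finite s p.2, (hlocal p.1 p.2).1, (hlocal p.1 p.2).2.1⟩,
    ?_, ?_⟩
  · simp only [hfac]
    exact finite_finprod_fiber_ne_one _ _ hsupp
  · simp only [hfac]
    rw [finprod_fiberwise _ _ hsupp, hprod]
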